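/- Let $k$ be an algebraically closed field of characteristic $p>2$ and let $\mathfrak g=\mathfrak g_{\bar 0}\oplus\mathfrak g_{\bar 1}$ be one of the basic classical Lie superalgebras over $k$: $\mathfrak{gl}(m|n)$; $\mathfrak{sl}(m|n)$ with $p\nmid m-n$; $\mathfrak{osp}(m|2n)$; $D(2,1;a)$ with $a\ne 0,-1$ and $p>3$; $F(4)$ or $G(3)$ with $p>15$. Let $T$ be the standard (diagonal) maximal torus, $\mathfrak h$ the corresponding Cartan subalgebra, $\Delta=\Delta_0\cup\Delta_1$ the set of roots (nonzero weights of $T$), with $\Delta_0$ the even and $\Delta_1$ the odd roots. Put $\overline\Delta_0=\{\alpha\in\Delta_0:\alpha/2\notin\Delta_1\}$ and $\overline\Delta_1=\{\beta\in\Delta_1: 2\beta\notin\Delta_0\}$ (the isotropic roots); the other roots, $\Delta_0\cup(\Delta_1\setminus\overline\Delta_1)$, are non-isotropic. A positive system is the set of roots on which some real linear functional that vanishes on no root is positive. Let $\mathcal B$ be the set of Borel subalgebras containing $\mathfrak h$, i.e. of the subalgebras $B=\mathfrak h+\sum_{\alpha\in\Delta(B)^+}\mathfrak g_\alpha$ with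 $\Delta(B)^+$ a positive system; let $\Pi(B)$ be the set of simple roots, i.e. of those elements of $\Delta(B)^+$ that are not a sum of two elements of $\Delta(B)^+$. For $\theta\in\Delta$ define a permutation $\hat r_\theta$ of $\mathcal B$ as follows. If $\theta$ is non-isotropic, $\hat r_\theta(B)=\mathfrak h+\sum_{\alpha\in\Delta(B)^+}\mathfrak g_{s_\theta(\alpha)}$, with $s_\theta$ the reflection in $\theta$ (a real reflection). If $\theta$ is isotropic (an odd reflection), then $\hat r_\theta(B)$ is the Borel subalgebra with positive system $(\Delta(B)^+\setminus\{\theta\})\cup\{-\theta\}$ if $\theta\in\Pi(B)$, the one with positive system $(\Delta(B)^+\setminus\{-\theta\})\cup\{\theta\}$ if $-\theta\in\Pi(B)$, and $B$ itself otherwise. The super Weyl group $\hat W$ is the subgroup of the group of permutations of $\mathcal B$ generated by all $\hat r_\theta$. For $\hat w\in\hat W$ and $B\in\mathcal B$ with $\Pi=\Pi(B)$, $\Delta^+=\Delta(B)^+$ write $\hat w(\Pi)=\Pi(\hat w(B))$ and $\hat w(\Delta^+)=\Delta(\hat w(B))^+$. Fix $B\in\mathcal B$ and let $\Pi=\Pi(B)$,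 $\Delta^+=\Delta(B)^+$, $\Delta_1^+=\Delta_1\cap\Delta^+$, $\overline\Delta_1^+=\overline\Delta_1\cap\Delta^+$. A standard expression from $\Pi$ to $-\Pi$ of length $n$ is a product $\hat r_{\theta_n}\cdots\hat r_{\theta_1}$ with $\theta_i\in\hat r_{\theta_{i-1}}\cdots\hat r_{\theta_1}(\Pi)$ for $1\le i\le n$ and $\hat r_{\theta_n}\cdots\hat r_{\theta_1}(\Pi)=-\Pi$; it is reduced if no standard expression from $\Pi$ to $-\Pi$ is shorter. An element of $\hat W$ is distinguished if it has a reduced standard expression from $\Pi$ to $-\Pi$. **Theorem.** There is a distinguished element $\hat w_0=\hat r_N\cdots\hat r_1\in\hat W$, where $\hat r_i=\hat r_{\theta_i}$ for roots $\theta_1,\dots,\theta_N\in\Delta^+$ and this product is a reduced standard expression, such that, with $\hat\sigma_i=\hat r_i\cdots\hat r_1$ and $\hat\sigma_0=\mathrm{id}$: 1. For $1\le i\le N$, $\theta_i$ is a simple root of $\hat\sigma_{i-1}(B)$, i.e. $\theta_i\in\hat\sigma_{i-1}(\Pi)$. 2. $\hat w_0(\Pi)=-\Pi$ and $\hat w_0(\Delta^+)=-\Delta^+$.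 3. For $1\le i\le N$, $$\hat\sigma_i(\Delta^+)=\begin{cases}(\hat\sigma_{i-1}(\Delta^+)\setminus\{\theta_i\})\cup\{-\theta_i\}&\text{if }\theta_i\in\hat\sigma_{i-1}(\Delta^+)\cap\overline\Delta_0,\\ (\hat\sigma_{i-1}(\Delta^+)\setminus\{\theta_i\})\cup\{-\theta_i\}&\text{if }\theta_i\in\hat\sigma_{i-1}(\Delta^+)\cap\overline\Delta_1,\\ (\hat\sigma_{i-1}(\Delta^+)\setminus\{2\theta_i,\theta_i\})\cup\{-2\theta_i,-\theta_i\}&\text{if }\theta_i\in\hat\sigma_{i-1}(\Delta^+)\cap(\Delta_1\setminus\overline\Delta_1).\end{cases}$$ 4. $N=\#\Delta^+-\#(\Delta_1^+\setminus\overline\Delta_1^+)$. 5. $\Delta^+=\{\theta_i: 1\le i\le N\}\cup\{2\theta_i: 1\le i\le N,\ \theta_i\in(\Delta_1^+\setminus\overline\Delta_1^+)\cap\hat\sigma_{i-1}(\Delta^+)\}$. -/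

import Mathlib

set_option linter.unusedSectionVars false
set_option linter.unusedSimpArgs false

open Matrix

attribute [local instance 100] LieRing.ofAssociativeRing LieAlgebra.ofAssociativeAlgebra

namespace SuperLie

section Torus

variable {k : Type*} [Field k] {ι κ I : Type} [Fintype ι] [DecidableEq ι] [Fintype κ] [DecidableEq κ]
  [Fintype I]

/-- The character `t ↦ ∏ i, t i ^ lam i` of the torus `(kˣ)^I`; the character lattice is `I → ℤ`. -/
def torusChar (t : I → kˣ) (lam : I → ℤ) : kˣ := ∏ i, t i ^ lam i

/-- The diagonal matrix by which `t` acts on the space with basis `ι` and weights `w`. -/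
def torusMat (w : ι → I → ℤ) (t : I → kˣ) : Matrix ι ι k :=
  Matrix.diagonal fun i => (torusChar t (w i) : k)

theorem torusChar_add (t : I → kˣ) (a b : I → ℤ) :
    torusChar t (a + b) = torusChar t a * torusChar t b := by
  simp [torusChar, _root_.zpow_add, Finset.prod_mul_distrib]

theorem torusChar_neg (t : I → kˣ) (a : I → ℤ) : torusChar t (-a) = (torusChar t a)⁻¹ := by
  simp [torusChar]

theorem torusChar_inv (t : I → kˣ) (a : I → ℤ) : torusChar t⁻¹ a = (torusChar t a)⁻¹ := by
  simp [torusChar]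

theorem torusMat_mul_inv (w : ι → I → ℤ) (t : I → kˣ) : torusMat w t * torusMat w t⁻¹ = 1 := by
  simp [torusMat, torusChar_inv]

theorem torusMat_inv_mul (w : ι → I → ℤ) (t : I → kˣ) : torusMat w t⁻¹ * torusMat w t = 1 := by
  simp [torusMat, torusChar_inv]

theorem torusMat_transpose (w : ι → I → ℤ) (t : I → kˣ) : (torusMat w t)ᵀ = torusMat w t := by
  simp [torusMat]

theorem torusMat_mul_of_weight (w : ι → I → ℤ) (w' : κ → I → ℤ) (F : Matrix ι κ k) (mu : I → ℤ)
    (h : ∀ i j, F i j ≠ 0 → w i = w' j + mu) (t : I → kˣ) :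
    torusMat w t * F = (torusChar t mu : k) • (F * torusMat w' t) := by
  ext i j
  by_cases hF : F i j = 0
  · simp [torusMat, hF]
  · simp [torusMat, h i j hF, torusChar_add]; ring

theorem torusMat_mul_form (w : ι → I → ℤ) (F : Matrix ι ι k)
    (h : ∀ i j, F i j ≠ 0 → w i + w j = 0) (t : I → kˣ) :
    torusMat w t * F = F * torusMat w t⁻¹ := by
  ext i j
  by_cases hF : F i j = 0
  · simp [torusMat, hF]
  · simp [torusMat, eq_neg_of_add_eq_zero_left (h i j hF), torusChar_neg, torusChar_inv, mul_comm]

theorem conj_apply (w : ι → I → ℤ) (t : I → kˣ) (x : Matrix ι ι k) (i j : ι) :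
    (torusMat w t * x * torusMat w t⁻¹) i j =
      (torusChar t (w i) : k) * x i j * ((torusChar t (w j))⁻¹ : kˣ) := by
  simp [torusMat, torusChar_inv]

theorem conj_mul (w : ι → I → ℤ) (t : I → kˣ) (x y : Matrix ι ι k) :
    torusMat w t * (x * y) * torusMat w t⁻¹ =
      (torusMat w t * x * torusMat w t⁻¹) * (torusMat w t * y * torusMat w t⁻¹) := by
  have h : torusMat w t * x * torusMat w t⁻¹ * (torusMat w t * y * torusMat w t⁻¹) =
    torusMat w t * x * (torusMat w t⁻¹ * torusMat w t) * y * torusMat w t⁻¹ := by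
    noncomm_ring
  rw [h, torusMat_inv_mul]
  noncomm_ring

end Torus

/-- A finite-dimensional Lie superalgebra `𝔤 = even ⊕ odd` over `k` with a torus `T = (kˣ)^I` acting
on it by automorphisms.  The even part is a Lie algebra of matrices, the odd part is a module over it
(a space of matrices on which the even part acts by commutators), and `oddBracket` is the bracket of
two odd elements: symmetric, equivariant, and with `[[x, x], x] = 0` for odd `x`; together with the
Jacobi identity of the even part and the module axiom this is the super Jacobi identity.
The bracket of odd elements need not be the anticommutator of matrices.
`T` acts by conjugation with the diagonal matrices whose entries are the characters `wt i`. -/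
structure ToralLieSuperalgebra (k : Type*) [Field k] where
  ι : Type
  [fintypeι : Fintype ι]
  [decEqι : DecidableEq ι]
  I : Type
  [fintypeI : Fintype I]
  even : LieSubalgebra k (Matrix ι ι k)
  odd : LieSubmodule k even (Matrix ι ι k)
  oddBracket : odd →ₗ[k] odd →ₗ[k] even
  oddBracket_symm : ∀ x y, oddBracket x y = oddBracket y x
  lie_oddBracket : ∀ (a : even) (x y : odd),
    ⁅a, oddBracket x y⁆ = oddBracket ⁅a, x⁆ y + oddBracket x ⁅a, y⁆
  oddBracket_lie_self : ∀ x, ⁅oddBracket x x, x⁆ = 0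
  wt : ι → I → ℤ
  conj_mem_even : ∀ t, ∀ x ∈ even, torusMat wt t * x * torusMat wt t⁻¹ ∈ even
  conj_mem_odd : ∀ t, ∀ x ∈ odd, torusMat wt t * x * torusMat wt t⁻¹ ∈ odd
  conj_oddBracket : ∀ (t) (x y : odd),
    torusMat wt t * (oddBracket x y : Matrix ι ι k) * torusMat wt t⁻¹ =
      oddBracket ⟨_, conj_mem_odd t x x.2⟩ ⟨_, conj_mem_odd t y y.2⟩

attribute [instance] ToralLieSuperalgebra.fintypeι ToralLieSuperalgebra.decEqι
  ToralLieSuperalgebra.fintypeI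

/-! ### Matrix superalgebras with the supercommutator -/

section Blocks

variable {k : Type*} [Field k] {α β I : Type} [Fintype α] [DecidableEq α] [Fintype β] [DecidableEq β]
  [Fintype I]

def IsEvenMat (x : Matrix (α ⊕ β) (α ⊕ β) k) : Prop :=
  (∀ i j, x (.inl i) (.inr j) = 0) ∧ ∀ i j, x (.inr i) (.inl j) = 0

def IsOddMat (x : Matrix (α ⊕ β) (α ⊕ β) k) : Prop :=
  (∀ i j, x (.inl i) (.inl j) = 0) ∧ ∀ i j, x (.inr i) (.inr j) = 0

theorem IsEvenMat.mul {x y : Matrix (α ⊕ β) (α ⊕ β) k} (hx : IsEvenMat x) (hy : IsEvenMat y) :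
    IsEvenMat (x * y) := by
  constructor <;> intro i j <;> simp [Matrix.mul_apply, hx.1, hx.2, hy.1, hy.2]

theorem IsEvenMat.mul_odd {x y : Matrix (α ⊕ β) (α ⊕ β) k} (hx : IsEvenMat x) (hy : IsOddMat y) :
    IsOddMat (x * y) := by
  constructor <;> intro i j <;> simp [Matrix.mul_apply, hx.1, hx.2, hy.1, hy.2]

theorem IsOddMat.mul_even {x y : Matrix (α ⊕ β) (α ⊕ β) k} (hx : IsOddMat x) (hy : IsEvenMat y) :
    IsOddMat (x * y) := by
  constructor <;> intro i j <;> simp [Matrix.mul_apply, hx.1, hx.2, hy.1, hy.2]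

theorem IsOddMat.mul {x y : Matrix (α ⊕ β) (α ⊕ β) k} (hx : IsOddMat x) (hy : IsOddMat y) :
    IsEvenMat (x * y) := by
  constructor <;> intro i j <;> simp [Matrix.mul_apply, hx.1, hx.2, hy.1, hy.2]

theorem IsEvenMat.add {x y : Matrix (α ⊕ β) (α ⊕ β) k} (hx : IsEvenMat x) (hy : IsEvenMat y) :
    IsEvenMat (x + y) := by
  constructor <;> intro i j <;> simp [hx.1, hx.2, hy.1, hy.2]

theorem IsEvenMat.sub {x y : Matrix (α ⊕ β) (α ⊕ β) k} (hx : IsEvenMat x) (hy : IsEvenMat y) :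
    IsEvenMat (x - y) := by
  constructor <;> intro i j <;> simp [hx.1, hx.2, hy.1, hy.2]

theorem IsOddMat.sub {x y : Matrix (α ⊕ β) (α ⊕ β) k} (hx : IsOddMat x) (hy : IsOddMat y) :
    IsOddMat (x - y) := by
  constructor <;> intro i j <;> simp [hx.1, hx.2, hy.1, hy.2]

theorem IsOddMat.add {x y : Matrix (α ⊕ β) (α ⊕ β) k} (hx : IsOddMat x) (hy : IsOddMat y) :
    IsOddMat (x + y) := by
  constructor <;> intro i j <;> simp [hx.1, hx.2, hy.1, hy.2]

theorem IsEvenMat.conj {x : Matrix (α ⊕ β) (α ⊕ β) k} (hx : IsEvenMat x) (w : α ⊕ β → I → ℤ)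
    (t : I → kˣ) : IsEvenMat (torusMat w t * x * torusMat w t⁻¹) := by
  constructor <;> intro i j <;> simp [conj_apply, hx.1, hx.2]

theorem IsOddMat.conj {x : Matrix (α ⊕ β) (α ⊕ β) k} (hx : IsOddMat x) (w : α ⊕ β → I → ℤ)
    (t : I → kˣ) : IsOddMat (torusMat w t * x * torusMat w t⁻¹) := by
  constructor <;> intro i j <;> simp [conj_apply, hx.1, hx.2]

/-- The Lie superalgebra of matrices with given even and odd parts and the supercommutator
`[x, y] = x y + y x` of odd elements. -/
def ofSupercommutator (ι : Type) [Fintype ι] [DecidableEq ι] (I : Type) [Fintype I]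
    (wt : ι → I → ℤ)
    (even : LieSubalgebra k (Matrix ι ι k)) (odd : LieSubmodule k even (Matrix ι ι k))
    (h : ∀ x ∈ odd, ∀ y ∈ odd, x * y + y * x ∈ even)
    (conj_mem_even : ∀ t, ∀ x ∈ even, torusMat wt t * x * torusMat wt t⁻¹ ∈ even)
    (conj_mem_odd : ∀ t, ∀ x ∈ odd, torusMat wt t * x * torusMat wt t⁻¹ ∈ odd) :
    ToralLieSuperalgebra k where
  ι := ι
  I := I
  even := even
  odd := odd
  oddBracket := LinearMap.mk₂ k
    (fun x y => ⟨(x : Matrix ι ι k) * y + y * x, h x x.2 y y.2⟩)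
    (fun x y z => Subtype.ext (by simp; noncomm_ring))
    (fun c x y => Subtype.ext (by simp))
    (fun x y z => Subtype.ext (by simp; noncomm_ring))
    (fun c x y => Subtype.ext (by simp))
  oddBracket_symm x y := Subtype.ext (by simp [add_comm])
  lie_oddBracket a x y := Subtype.ext (by
    simp [LieSubmodule.coe_bracket, LieSubalgebra.coe_bracket_of_module, Ring.lie_def]
    noncomm_ring)
  oddBracket_lie_self x := Subtype.ext (by
    simp [LieSubmodule.coe_bracket, LieSubalgebra.coe_bracket_of_module, Ring.lie_def]
    noncomm_ring)
  wt := wt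
  conj_mem_even := conj_mem_even
  conj_mem_odd := conj_mem_odd
  conj_oddBracket t x y := by
    simp only [LinearMap.mk₂_apply, ← conj_mul]
    noncomm_ring

theorem IsEvenMat.smul {x : Matrix (α ⊕ β) (α ⊕ β) k} (c : k) (hx : IsEvenMat x) :
    IsEvenMat (c • x) := by
  constructor <;> intro i j <;> simp [hx.1, hx.2]

theorem IsOddMat.smul {x : Matrix (α ⊕ β) (α ⊕ β) k} (c : k) (hx : IsOddMat x) :
    IsOddMat (c • x) := by
  constructor <;> intro i j <;> simp [hx.1, hx.2]

def supertrace (x : Matrix (α ⊕ β) (α ⊕ β) k) : k :=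
  ∑ i, x (.inl i) (.inl i) - ∑ j, x (.inr j) (.inr j)

theorem supertrace_mul_comm_of_even {x y : Matrix (α ⊕ β) (α ⊕ β) k} (hx : IsEvenMat x) :
    supertrace (x * y) = supertrace (y * x) := by
  simp only [supertrace, Matrix.mul_apply, Fintype.sum_sum_type, hx.1, hx.2, zero_mul, mul_zero,
    Finset.sum_const_zero, add_zero, zero_add]
  congr 1 <;> · rw [Finset.sum_comm]; simp only [mul_comm]

theorem supertrace_mul_comm_of_odd {x y : Matrix (α ⊕ β) (α ⊕ β) k} (hx : IsOddMat x) :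
    supertrace (x * y) = -supertrace (y * x) := by
  simp only [supertrace, Matrix.mul_apply, Fintype.sum_sum_type, hx.1, hx.2, zero_mul, mul_zero,
    Finset.sum_const_zero, add_zero, zero_add]
  rw [neg_sub]
  congr 1 <;> · rw [Finset.sum_comm]; simp only [mul_comm]

theorem supertrace_conj (w : α ⊕ β → I → ℤ) (t : I → kˣ) (x : Matrix (α ⊕ β) (α ⊕ β) k) :
    supertrace (torusMat w t * x * torusMat w t⁻¹) = supertrace x := by
  have h : ∀ i, (torusMat w t * x * torusMat w t⁻¹) i i = x i i := fun i => by
    rw [conj_apply, mul_right_comm, ← Units.val_mul]; simp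
  simp [supertrace, h]

variable (k α β)

/-- The even part of `𝔤𝔩(α|β)`. -/
def glEven : LieSubalgebra k (Matrix (α ⊕ β) (α ⊕ β) k) where
  carrier := {x | IsEvenMat x}
  add_mem' := IsEvenMat.add
  zero_mem' := by constructor <;> simp
  smul_mem' c _ := IsEvenMat.smul c
  lie_mem' hx hy := (hx.mul hy).sub (hy.mul hx)

/-- The even part of `𝔰𝔩(α|β)`. -/
def slEven : LieSubalgebra k (Matrix (α ⊕ β) (α ⊕ β) k) where
  carrier := {x | IsEvenMat x ∧ supertrace x = 0}
  add_mem' hx hy := ⟨hx.1.add hy.1, by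
    have h1 := hx.2; have h2 := hy.2
    simp only [supertrace] at h1 h2 ⊢
    simp only [Matrix.add_apply, Finset.sum_add_distrib]
    linear_combination h1 + h2⟩
  zero_mem' := ⟨by constructor <;> simp, by simp [supertrace]⟩
  smul_mem' c x hx := ⟨hx.1.smul c, by
    have h1 := hx.2
    simp only [supertrace] at h1 ⊢
    simp only [Matrix.smul_apply, smul_eq_mul, ← Finset.mul_sum]
    linear_combination c * h1⟩
  lie_mem' {x y} hx hy := ⟨(hx.1.mul hy.1).sub (hy.1.mul hx.1), by
    have h := supertrace_mul_comm_of_even (y := y) hx.1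
    simp only [supertrace, Ring.lie_def, Matrix.sub_apply, Finset.sum_sub_distrib] at h ⊢
    linear_combination h⟩

/-- The odd part of `𝔤𝔩(α|β)`, as a module over its even part. -/
def glOdd : LieSubmodule k (glEven k α β) (Matrix (α ⊕ β) (α ⊕ β) k) where
  carrier := {x | IsOddMat x}
  add_mem' := IsOddMat.add
  zero_mem' := by constructor <;> simp
  smul_mem' c _ := IsOddMat.smul c
  lie_mem {a _} hx := (a.2.mul_odd hx).sub (hx.mul_even a.2)

/-- The odd part of `𝔰𝔩(α|β)`, as a module over its even part. -/
def slOdd : LieSubmodule k (slEven k α β) (Matrix (α ⊕ β) (α ⊕ β) k) where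
  carrier := {x | IsOddMat x}
  add_mem' := IsOddMat.add
  zero_mem' := by constructor <;> simp
  smul_mem' c _ := IsOddMat.smul c
  lie_mem {a _} hx := (a.2.1.mul_odd hx).sub (hx.mul_even a.2.1)

/-- `𝔤𝔩(m|n)` with the torus of diagonal matrices. -/
def gl (m n : ℕ) : ToralLieSuperalgebra k :=
  ofSupercommutator (Fin m ⊕ Fin n) (Fin m ⊕ Fin n) (fun i => Pi.single i 1)
    (glEven k (Fin m) (Fin n)) (glOdd k (Fin m) (Fin n))
    (fun _ hx _ hy => (hx.mul hy).add (hy.mul hx))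
    (fun t _ hx => hx.conj _ t) (fun t _ hx => hx.conj _ t)

/-- `𝔰𝔩(m|n)`.  The diagonal torus of `GL(m|n)` acts on it; when `m - n` is invertible in `k` this
torus is, up to the scalar matrices (which act trivially), the diagonal torus of `SL(m|n)`, so that
both have the same root spaces and the same root lattice. -/
def sl (m n : ℕ) : ToralLieSuperalgebra k :=
  ofSupercommutator (Fin m ⊕ Fin n) (Fin m ⊕ Fin n) (fun i => Pi.single i 1)
    (slEven k (Fin m) (Fin n)) (slOdd k (Fin m) (Fin n))
    (fun x hx y hy => ⟨(hx.mul hy).add (hy.mul hx), by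
      have h := supertrace_mul_comm_of_odd (y := y) hx
      simp only [supertrace, Matrix.add_apply, Finset.sum_add_distrib] at h ⊢
      linear_combination h⟩)
    (fun t _ hx => ⟨hx.1.conj _ t, by rw [supertrace_conj]; exact hx.2⟩) (fun t _ hx => hx.conj _ t)

variable {α β}

/-- The parity automorphism of `k^(α|β)`. -/
def parityMat : Matrix (α ⊕ β) (α ⊕ β) k := Matrix.diagonal (Sum.elim (fun _ => 1) (fun _ => -1))

variable {k}

theorem parityMat_mul_self : parityMat k * parityMat k = (1 : Matrix (α ⊕ β) (α ⊕ β) k) := by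
  ext i j
  rcases i with i | i <;> rcases j with j | j <;>
    simp [parityMat, Matrix.diagonal_apply, Matrix.one_apply]
  split_ifs <;> simp

theorem IsEvenMat.mul_parity {x : Matrix (α ⊕ β) (α ⊕ β) k} (hx : IsEvenMat x) :
    x * parityMat k = parityMat k * x := by
  ext i j
  rcases i with i | i <;> rcases j with j | j <;> simp [parityMat, hx.1, hx.2]

theorem IsOddMat.mul_parity {x : Matrix (α ⊕ β) (α ⊕ β) k} (hx : IsOddMat x) :
    x * parityMat k = -(parityMat k * x) := by
  ext i j
  rcases i with i | i <;> rcases j with j | j <;> simp [parityMat, hx.1, hx.2]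

theorem IsEvenMat.transpose {x : Matrix (α ⊕ β) (α ⊕ β) k} (hx : IsEvenMat x) : IsEvenMat xᵀ :=
  ⟨fun i j => hx.2 j i, fun i j => hx.1 j i⟩

theorem IsOddMat.transpose {x : Matrix (α ⊕ β) (α ⊕ β) k} (hx : IsOddMat x) : IsOddMat xᵀ :=
  ⟨fun i j => hx.1 j i, fun i j => hx.2 j i⟩

/-- Even matrices `x` with `B(x u, v) + B(u, x v) = 0`, where `B(u, v) = uᵀ F v`. -/
def ospEven (F : Matrix (α ⊕ β) (α ⊕ β) k) : LieSubalgebra k (Matrix (α ⊕ β) (α ⊕ β) k) where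
  carrier := {x | IsEvenMat x ∧ xᵀ * F + F * x = 0}
  add_mem' {x y} hx hy := ⟨hx.1.add hy.1, by
    have := congrArg₂ (· + ·) hx.2 hy.2
    simp only [Matrix.transpose_add, add_zero] at this ⊢
    rw [← this]; noncomm_ring⟩
  zero_mem' := ⟨by constructor <;> simp, by simp⟩
  smul_mem' c x hx := ⟨hx.1.smul c, by
    have := congrArg (c • ·) hx.2
    simpa using this⟩
  lie_mem' {x y} hx hy := ⟨(hx.1.mul hy.1).sub (hy.1.mul hx.1), by
    have h1 : xᵀ * F = -(F * x) := eq_neg_of_add_eq_zero_left hx.2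
    have h2 : yᵀ * F = -(F * y) := eq_neg_of_add_eq_zero_left hy.2
    simp only [Ring.lie_def, Matrix.transpose_sub, Matrix.transpose_mul, Matrix.sub_mul,
      Matrix.mul_assoc, h1, h2, Matrix.mul_neg]
    simp only [← Matrix.mul_assoc, h1, h2]
    noncomm_ring⟩

/-- Odd matrices `x` with `B(x u, v) + (-1)^|u| B(u, x v) = 0` for homogeneous `u`, where
`B(u, v) = uᵀ F v`. -/
def ospOdd (F : Matrix (α ⊕ β) (α ⊕ β) k) :
    LieSubmodule k (ospEven F) (Matrix (α ⊕ β) (α ⊕ β) k) where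
  carrier := {x | IsOddMat x ∧ xᵀ * F + parityMat k * F * x = 0}
  add_mem' {x y} hx hy := ⟨hx.1.add hy.1, by
    have := congrArg₂ (· + ·) hx.2 hy.2
    simp only [Matrix.transpose_add, add_zero] at this ⊢
    rw [← this]; noncomm_ring⟩
  zero_mem' := ⟨by constructor <;> simp, by simp⟩
  smul_mem' c x hx := ⟨hx.1.smul c, by
    have := congrArg (c • ·) hx.2
    simpa using this⟩
  lie_mem {a x} hx := ⟨(a.2.1.mul_odd hx.1).sub (hx.1.mul_even a.2.1), by
    obtain ⟨a, ha⟩ := a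
    change (a * x - x * a)ᵀ * F + parityMat k * F * (a * x - x * a) = 0
    have h1 : aᵀ * F = -(F * a) := eq_neg_of_add_eq_zero_left ha.2
    have h2 : xᵀ * F = -(parityMat k * F * x) := eq_neg_of_add_eq_zero_left hx.2
    have h3 : aᵀ * parityMat k = parityMat k * aᵀ := ha.1.transpose.mul_parity
    have e1 : (a * x - x * a)ᵀ * F = xᵀ * (aᵀ * F) - aᵀ * (xᵀ * F) := by
      simp only [Matrix.transpose_sub, Matrix.transpose_mul]; noncomm_ring
    have e2 : xᵀ * (F * a) = -(parityMat k * F * x) * a := by rw [← h2]; noncomm_ring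
    have e3 : aᵀ * (parityMat k * F * x) = parityMat k * -(F * a) * x := by
      rw [← h1]
      calc aᵀ * (parityMat k * F * x) = (aᵀ * parityMat k) * F * x := by noncomm_ring
        _ = _ := by rw [h3]; noncomm_ring
    rw [e1, h1, h2, Matrix.mul_neg, e2, Matrix.mul_neg, e3]
    noncomm_ring⟩

theorem ospOdd_anticomm (F : Matrix (α ⊕ β) (α ⊕ β) k) (x : Matrix (α ⊕ β) (α ⊕ β) k)
    (hx : x ∈ ospOdd F) (y) (hy : y ∈ ospOdd F) : x * y + y * x ∈ ospEven F := by
  refine ⟨(hx.1.mul hy.1).add (hy.1.mul hx.1), ?_⟩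
  have key : ∀ x ∈ ospOdd F, ∀ y ∈ ospOdd F, (x * y)ᵀ * F = -(F * y * x) := by
    intro x hx y hy
    have h1 : xᵀ * F = -(parityMat k * F * x) := eq_neg_of_add_eq_zero_left hx.2
    have h2 : yᵀ * F = -(parityMat k * F * y) := eq_neg_of_add_eq_zero_left hy.2
    have h3 : yᵀ * parityMat k = -(parityMat k * yᵀ) := hy.1.transpose.mul_parity
    calc (x * y)ᵀ * F = yᵀ * (xᵀ * F) := by rw [Matrix.transpose_mul]; noncomm_ring
      _ = -(yᵀ * parityMat k) * F * x := by rw [h1]; noncomm_ring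
      _ = parityMat k * (yᵀ * F) * x := by rw [h3]; noncomm_ring
      _ = -(parityMat k * parityMat k) * F * y * x := by rw [h2]; noncomm_ring
      _ = _ := by rw [parityMat_mul_self]; noncomm_ring
  rw [Matrix.transpose_add, Matrix.add_mul, key x hx y hy, key y hy x hx]
  noncomm_ring

/-- The split even supersymmetric form on `k^(2l+e|2n)`: the symmetric form pairs the first `l` basis
vectors with the next `l` and is the standard form on the last `e`; the alternating form pairs the
first `n` odd basis vectors with the last `n`. -/
def ospForm (k : Type*) [Field k] (l e n : ℕ) :
    Matrix ((Fin l ⊕ Fin l ⊕ Fin e) ⊕ (Fin n ⊕ Fin n)) ((Fin l ⊕ Fin l ⊕ Fin e) ⊕ (Fin n ⊕ Fin n)) k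
  | .inl (.inl i), .inl (.inr (.inl j)) => if i = j then 1 else 0
  | .inl (.inr (.inl i)), .inl (.inl j) => if i = j then 1 else 0
  | .inl (.inr (.inr i)), .inl (.inr (.inr j)) => if i = j then 1 else 0
  | .inr (.inl i), .inr (.inr j) => if i = j then 1 else 0
  | .inr (.inr i), .inr (.inl j) => if i = j then -1 else 0
  | _, _ => 0

/-- The weights of the standard basis of `k^(2l+e|2n)`: `±ε_i`, `0` and `±δ_j`. -/
def ospWt (l e n : ℕ) : (Fin l ⊕ Fin l ⊕ Fin e) ⊕ (Fin n ⊕ Fin n) → Fin l ⊕ Fin n → ℤ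
  | .inl (.inl i) => Pi.single (.inl i) 1
  | .inl (.inr (.inl i)) => -Pi.single (.inl i) 1
  | .inl (.inr (.inr _)) => 0
  | .inr (.inl j) => Pi.single (.inr j) 1
  | .inr (.inr j) => -Pi.single (.inr j) 1

theorem ospForm_weight (l e n : ℕ) (i j) (h : ospForm k l e n i j ≠ 0) :
    ospWt l e n i + ospWt l e n j = 0 := by
  rcases i with (i | i | i) | (i | i) <;> rcases j with (j | j | j) | (j | j) <;>
    simp [ospForm] at h <;> simp [ospWt, h]

theorem conj_transpose_mul_form {ι : Type} [Fintype ι] [DecidableEq ι] (w : ι → I → ℤ)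
    (F : Matrix ι ι k) (h : ∀ i j, F i j ≠ 0 → w i + w j = 0) (t : I → kˣ) (x : Matrix ι ι k) :
    (torusMat w t * x * torusMat w t⁻¹)ᵀ * F = torusMat w t⁻¹ * (xᵀ * F) * torusMat w t⁻¹ ∧
    F * (torusMat w t * x * torusMat w t⁻¹) = torusMat w t⁻¹ * (F * x) * torusMat w t⁻¹ := by
  have h1 : torusMat w t * F = F * torusMat w t⁻¹ := torusMat_mul_form w F h t
  have h2 : torusMat w t⁻¹ * F = F * torusMat w t := by
    simpa using torusMat_mul_form w F h t⁻¹
  constructor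
  · calc _ = torusMat w t⁻¹ * xᵀ * (torusMat w t * F) := by
          simp only [Matrix.transpose_mul, torusMat_transpose]; noncomm_ring
      _ = _ := by rw [h1]; noncomm_ring
  · calc _ = (F * torusMat w t) * x * torusMat w t⁻¹ := by noncomm_ring
      _ = _ := by rw [← h2]; noncomm_ring

theorem torusMat_mul_parity (w : α ⊕ β → I → ℤ) (t : I → kˣ) :
    torusMat w t * parityMat k = parityMat k * torusMat w t := by
  simp [torusMat, parityMat, mul_comm]

/-- `𝔬𝔰𝔭(2l+e|2n)` with its diagonal torus; `e = 0` or `e = 1` is meant. -/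
def osp (k : Type*) [Field k] (l e n : ℕ) : ToralLieSuperalgebra k :=
  ofSupercommutator _ (Fin l ⊕ Fin n) (ospWt l e n) (ospEven (ospForm k l e n))
    (ospOdd (ospForm k l e n)) (ospOdd_anticomm _)
    (fun t x hx => ⟨hx.1.conj _ t, by
      have h := conj_transpose_mul_form (ospWt l e n) (ospForm k l e n) (ospForm_weight l e n) t x
      rw [h.1, h.2, ← Matrix.add_mul, ← Matrix.mul_add, hx.2]; simp⟩)
    (fun t x hx => ⟨hx.1.conj _ t, by
      have h := conj_transpose_mul_form (ospWt l e n) (ospForm k l e n) (ospForm_weight l e n) t x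
      have hp := torusMat_mul_parity (k := k) (ospWt l e n) t⁻¹
      rw [Matrix.mul_assoc (parityMat k), h.1, h.2]
      calc _ = torusMat (ospWt l e n) t⁻¹ * (xᵀ * ospForm k l e n) * torusMat (ospWt l e n) t⁻¹ +
            (parityMat k * torusMat (ospWt l e n) t⁻¹) * (ospForm k l e n * x) *
              torusMat (ospWt l e n) t⁻¹ := by noncomm_ring
        _ = torusMat (ospWt l e n) t⁻¹ * (xᵀ * ospForm k l e n + parityMat k * ospForm k l e n * x) *
              torusMat (ospWt l e n) t⁻¹ := by rw [← hp]; noncomm_ring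
        _ = 0 := by rw [hx.2]; simp⟩)

end Blocks
/-! ### Superalgebras with even part `𝔰𝔩₂ ⊕ L` and odd part `k² ⊗ V` -/

section Triple

variable {k : Type*} [Field k] {S I : Type} [Fintype S] [DecidableEq S] [Fintype I]

/-- Data on `V = k^S`: a Lie algebra `L` of endomorphisms of `V`, an `L`-invariant symmetric bilinear
form `uᵀ b v` and an `L`-equivariant bilinear alternating map `D : V × V → L` with
`D(u, v) u = b(u, v) u - b(u, u) v`; all compatible with the action of a torus on `V`. -/
structure TripleData (k : Type*) [Field k] (S I : Type) [Fintype S] [DecidableEq S] [Fintype I] where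
  L : LieSubalgebra k (Matrix S S k)
  b : Matrix S S k
  D : (S → k) →ₗ[k] (S → k) →ₗ[k] Matrix S S k
  wt : S → I → ℤ
  b_symm : bᵀ = b
  b_invariant : ∀ A ∈ L, Aᵀ * b + b * A = 0
  D_mem : ∀ u v, D u v ∈ L
  D_swap : ∀ u v, D u v = -D v u
  D_equivariant : ∀ A ∈ L, ∀ u v, A * D u v - D u v * A = D (A *ᵥ u) v + D u (A *ᵥ v)
  D_apply_self : ∀ u v, D u v *ᵥ u = (u ⬝ᵥ b *ᵥ v) • u - (u ⬝ᵥ b *ᵥ u) • v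
  conj_mem : ∀ t, ∀ A ∈ L, torusMat wt t * A * torusMat wt t⁻¹ ∈ L
  b_weight : ∀ i j, b i j ≠ 0 → wt i + wt j = 0
  conj_D : ∀ t u v, torusMat wt t * D u v * torusMat wt t⁻¹ =
    D (torusMat wt t *ᵥ u) (torusMat wt t *ᵥ v)

variable (d : TripleData k S I)

theorem fromBlocks_sub' {l m n o : Type} (A : Matrix n l k) (B : Matrix n m k) (C : Matrix o l k)
    (D : Matrix o m k) (A' : Matrix n l k) (B' : Matrix n m k) (C' : Matrix o l k)
    (D' : Matrix o m k) : fromBlocks A B C D - fromBlocks A' B' C' D' =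
      fromBlocks (A - A') (B - B') (C - C') (D - D') := by
  simp [sub_eq_add_neg, fromBlocks_neg, fromBlocks_add]

/-- The alternating form on `k²`. -/
def altForm (k : Type*) [Field k] : Matrix (Fin 2) (Fin 2) k := !![0, 1; -1, 0]

/-- `𝔰𝔩₂ ⊕ L` as block diagonal matrices. -/
def tripleEven : LieSubalgebra k (Matrix (S ⊕ Fin 2) (S ⊕ Fin 2) k) where
  carrier := {x | ∃ A ∈ d.L, ∃ s : Matrix (Fin 2) (Fin 2) k, s.trace = 0 ∧ x = fromBlocks A 0 0 s}
  add_mem' := by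
    rintro _ _ ⟨A, hA, s, hs, rfl⟩ ⟨A', hA', s', hs', rfl⟩
    exact ⟨A + A', add_mem hA hA', s + s', by simp [hs, hs'], by simp [fromBlocks_add]⟩
  zero_mem' := ⟨0, zero_mem _, 0, by simp, by simp⟩
  smul_mem' := by
    rintro c _ ⟨A, hA, s, hs, rfl⟩
    exact ⟨c • A, d.L.smul_mem c hA, c • s, by simp [hs], by simp [fromBlocks_smul]⟩
  lie_mem' := by
    rintro _ _ ⟨A, hA, s, hs, rfl⟩ ⟨A', hA', s', hs', rfl⟩
    refine ⟨⁅A, A'⁆, d.L.lie_mem hA hA', ⁅s, s'⁆, ?_, ?_⟩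
    · simp [Ring.lie_def, Matrix.trace_mul_comm s s']
    · simp [Ring.lie_def, fromBlocks_multiply, fromBlocks_sub']

/-- `Hom(k², V) ≅ k² ⊗ V` as block matrices: `(A, s)` acts by `X ↦ A X - X s`. -/
def tripleOdd : LieSubmodule k (tripleEven d) (Matrix (S ⊕ Fin 2) (S ⊕ Fin 2) k) where
  carrier := {x | ∃ X : Matrix S (Fin 2) k, x = fromBlocks 0 X 0 0}
  add_mem' := by
    rintro _ _ ⟨X, rfl⟩ ⟨Y, rfl⟩
    exact ⟨X + Y, by simp [fromBlocks_add]⟩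
  zero_mem' := ⟨0, by simp⟩
  smul_mem' := by
    rintro c _ ⟨X, rfl⟩
    exact ⟨c • X, by simp [fromBlocks_smul]⟩
  lie_mem := by
    rintro ⟨_, A, hA, s, hs, rfl⟩ _ ⟨X, rfl⟩
    refine ⟨A * X - X * s, ?_⟩
    change _ * _ - _ * _ = _
    simp [fromBlocks_multiply, fromBlocks_sub']

/-- The component in `𝔰𝔩₂` of the bracket of `X, Y ∈ Hom(k², V)`. -/
def tripleSl (X Y : Matrix S (Fin 2) k) : Matrix (Fin 2) (Fin 2) k :=
  altForm k * (Xᵀ * d.b * Y + Yᵀ * d.b * X)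

/-- The component in `L` of the bracket of `X, Y ∈ Hom(k², V)`. -/
def tripleL (X Y : Matrix S (Fin 2) k) : Matrix S S k := d.D (X.col 0) (Y.col 1) - d.D (X.col 1) (Y.col 0)

theorem tripleL_symm (X Y) : tripleL d X Y = tripleL d Y X := by
  simp only [tripleL, d.D_swap (X.col _)]
  abel

theorem tripleSl_symm (X Y) : tripleSl d X Y = tripleSl d Y X := by
  simp only [tripleSl, add_comm]

theorem tripleSl_trace (X Y) : (tripleSl d X Y).trace = 0 := by
  have h : (Xᵀ * d.b * Y)ᵀ = Yᵀ * d.b * X := by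
    simp [Matrix.transpose_mul, d.b_symm, Matrix.mul_assoc]
  rw [tripleSl, ← h]
  generalize Xᵀ * d.b * Y = P
  simp [altForm, Matrix.trace_fin_two, Matrix.vecMul, dotProduct, Fin.sum_univ_two]
  ring

theorem tripleL_add (X X' Y) : tripleL d (X + X') Y = tripleL d X Y + tripleL d X' Y := by
  have h : ∀ i, (X + X').col i = X.col i + X'.col i := fun i => rfl
  simp only [tripleL, h, map_add, LinearMap.add_apply]; abel

theorem tripleL_smul (c : k) (X Y) : tripleL d (c • X) Y = c • tripleL d X Y := by
  have h : ∀ i, (c • X).col i = c • X.col i := fun i => rfl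
  simp only [tripleL, h, map_smul, LinearMap.smul_apply, smul_sub]

theorem tripleSl_add (X X' Y) : tripleSl d (X + X') Y = tripleSl d X Y + tripleSl d X' Y := by
  simp only [tripleSl, Matrix.transpose_add, Matrix.mul_add, Matrix.add_mul]; abel

theorem tripleSl_smul (c : k) (X Y) : tripleSl d (c • X) Y = c • tripleSl d X Y := by
  simp [tripleSl, ← smul_add]

theorem tripleL_equivariant (A : Matrix S S k) (hA : A ∈ d.L) (s : Matrix (Fin 2) (Fin 2) k)
    (hs : s.trace = 0) (X Y) : A * tripleL d X Y - tripleL d X Y * A =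
      tripleL d (A * X - X * s) Y + tripleL d X (A * Y - Y * s) := by
  have hc : ∀ (X : Matrix S (Fin 2) k) i,
      (A * X - X * s).col i = A *ᵥ X.col i - (s 0 i • X.col 0 + s 1 i • X.col 1) := by
    intro X i
    ext j
    simp [Matrix.mul_apply, Fin.sum_univ_two, Matrix.mulVec, dotProduct]
    ring
  have h11 : s 1 1 = -s 0 0 := by
    rw [Matrix.trace_fin_two] at hs; linear_combination hs
  have e : A * tripleL d X Y - tripleL d X Y * A =
      (A * d.D (X.col 0) (Y.col 1) - d.D (X.col 0) (Y.col 1) * A) -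
      (A * d.D (X.col 1) (Y.col 0) - d.D (X.col 1) (Y.col 0) * A) := by
    simp only [tripleL]; noncomm_ring
  rw [e, d.D_equivariant A hA, d.D_equivariant A hA]
  simp only [tripleL, hc, map_add, map_sub, map_smul, LinearMap.add_apply, LinearMap.sub_apply,
    LinearMap.smul_apply, h11]
  module

theorem tripleSl_equivariant (A : Matrix S S k) (hA : A ∈ d.L) (s : Matrix (Fin 2) (Fin 2) k)
    (hs : s.trace = 0) (X Y) : s * tripleSl d X Y - tripleSl d X Y * s =
      tripleSl d (A * X - X * s) Y + tripleSl d X (A * Y - Y * s) := by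
  have hJ : s * altForm k = -(altForm k * sᵀ) := by
    rw [Matrix.trace_fin_two] at hs
    ext i j
    fin_cases i <;> fin_cases j <;>
      simp [altForm, Matrix.mul_apply, Fin.sum_univ_two, Matrix.vecMul, dotProduct] <;>
      first | done | linear_combination hs | linear_combination -hs
  have hA' : Aᵀ * d.b = -(d.b * A) := eq_neg_of_add_eq_zero_left (d.b_invariant A hA)
  have key : ∀ X Y : Matrix S (Fin 2) k, (A * X - X * s)ᵀ * d.b * Y + Xᵀ * d.b * (A * Y - Y * s) =
      -(sᵀ * (Xᵀ * d.b * Y)) - Xᵀ * d.b * Y * s := by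
    intro X Y
    have e : (A * X - X * s)ᵀ * d.b * Y = Xᵀ * (Aᵀ * d.b) * Y - sᵀ * (Xᵀ * d.b * Y) := by
      simp only [Matrix.transpose_sub, Matrix.transpose_mul, Matrix.sub_mul, Matrix.mul_assoc]
    rw [e, hA']
    simp only [Matrix.mul_sub, Matrix.mul_neg, Matrix.neg_mul, Matrix.mul_assoc]
    abel
  have e : tripleSl d (A * X - X * s) Y + tripleSl d X (A * Y - Y * s) = altForm k *
      (((A * X - X * s)ᵀ * d.b * Y + Xᵀ * d.b * (A * Y - Y * s)) +
        ((A * Y - Y * s)ᵀ * d.b * X + Yᵀ * d.b * (A * X - X * s))) := by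
    simp only [tripleSl, Matrix.mul_add]; abel
  rw [e, key, key]
  simp only [tripleSl]
  rw [← Matrix.mul_assoc s, hJ]
  simp only [Matrix.mul_sub, Matrix.mul_neg, Matrix.neg_mul, Matrix.mul_add, Matrix.add_mul,
    Matrix.mul_assoc]
  abel

theorem triple_cubic (X : Matrix S (Fin 2) k) : tripleL d X X * X - X * tripleSl d X X = 0 := by
  have h0 := d.D_apply_self (X.col 0) (X.col 1)
  have h1 := d.D_apply_self (X.col 1) (X.col 0)
  have hsym : ∀ u v : S → k, u ⬝ᵥ d.b *ᵥ v = v ⬝ᵥ d.b *ᵥ u := by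
    intro u v
    rw [Matrix.dotProduct_mulVec, ← Matrix.mulVec_transpose, d.b_symm, dotProduct_comm]
  have hG : ∀ i j, (Xᵀ * d.b * X) i j = X.col i ⬝ᵥ d.b *ᵥ X.col j := by
    intro i j
    rw [Matrix.mul_assoc]; rfl
  have hL : tripleL d X X = (2 : k) • d.D (X.col 0) (X.col 1) := by
    rw [tripleL, d.D_swap (X.col 1) (X.col 0)]; module
  have hL' : tripleL d X X = -(2 : k) • d.D (X.col 1) (X.col 0) := by
    rw [hL, d.D_swap (X.col 1) (X.col 0)]; module
  have hcol : ∀ (M : Matrix S S k) i j, (M * X) i j = (M *ᵥ X.col j) i := fun M i j => rfl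
  ext i j
  rw [Matrix.sub_apply, hcol, Matrix.zero_apply]
  have hs := hsym (X.col 1) (X.col 0)
  have hX : ∀ j, (X * tripleSl d X X) i j =
      X i 0 * tripleSl d X X 0 j + X i 1 * tripleSl d X X 1 j := fun j => by
    rw [Matrix.mul_apply, Fin.sum_univ_two]
  have h2 : ∀ j, tripleSl d X X 0 j = 2 * (X.col 1 ⬝ᵥ d.b *ᵥ X.col j) := fun j => by
    rw [tripleSl, Matrix.mul_apply, Fin.sum_univ_two, Matrix.add_apply, Matrix.add_apply, hG, hG]
    simp only [altForm, Matrix.of_apply, Matrix.cons_val_zero, Matrix.cons_val_one]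
    ring
  have h3 : ∀ j, tripleSl d X X 1 j = -2 * (X.col 0 ⬝ᵥ d.b *ᵥ X.col j) := fun j => by
    rw [tripleSl, Matrix.mul_apply, Fin.sum_univ_two, Matrix.add_apply, Matrix.add_apply, hG, hG]
    simp only [altForm, Matrix.of_apply, Matrix.cons_val_zero, Matrix.cons_val_one]
    ring
  obtain rfl | rfl : j = 0 ∨ j = 1 := by omega
  · rw [hL, Matrix.smul_mulVec, h0, hX, h2, h3, hs]
    simp only [Pi.smul_apply, Pi.sub_apply, smul_eq_mul, Matrix.col_apply]
    ring
  · rw [hL', Matrix.smul_mulVec, h1, hX, h2, h3, hs]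
    simp only [Pi.smul_apply, Pi.sub_apply, smul_eq_mul, Matrix.col_apply]
    ring

/-- The element of `Hom(k², V)` that corresponds to an odd element. -/
def oddBlock (x : tripleOdd d) : Matrix S (Fin 2) k :=
  toBlocks₁₂ (x : Matrix (S ⊕ Fin 2) (S ⊕ Fin 2) k)

theorem oddBlock_add (x y) : oddBlock d (x + y) = oddBlock d x + oddBlock d y := rfl

theorem oddBlock_smul (c : k) (x) : oddBlock d (c • x) = c • oddBlock d x := rfl

/-- The bracket of two odd elements. -/
def tripleBracket : tripleOdd d →ₗ[k] tripleOdd d →ₗ[k] tripleEven d :=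
  LinearMap.mk₂ k
    (fun x y => ⟨fromBlocks (tripleL d (oddBlock d x) (oddBlock d y)) 0 0
        (tripleSl d (oddBlock d x) (oddBlock d y)),
      ⟨_, sub_mem (d.D_mem _ _) (d.D_mem _ _), _, tripleSl_trace d _ _, rfl⟩⟩)
    (fun x y z => Subtype.ext (by
      simp [oddBlock_add, tripleL_add, tripleSl_add, fromBlocks_add]))
    (fun c x y => Subtype.ext (by
      simp [oddBlock_smul, tripleL_smul, tripleSl_smul, fromBlocks_smul]))
    (fun x y z => Subtype.ext (by
      simp [oddBlock_add, tripleL_symm d (oddBlock d x), tripleSl_symm d (oddBlock d x), tripleL_add,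
        tripleSl_add, fromBlocks_add]))
    (fun c x y => Subtype.ext (by
      simp [oddBlock_smul, tripleL_symm d (oddBlock d x), tripleSl_symm d (oddBlock d x),
        tripleL_smul, tripleSl_smul, fromBlocks_smul]))

/-- The weights on `V ⊕ k²`, where `k²` has the weights `ν, -ν`. -/
def tripleWt (nu : I → ℤ) : S ⊕ Fin 2 → I → ℤ := Sum.elim d.wt ![nu, -nu]

theorem torusMat_tripleWt (nu : I → ℤ) (t : I → kˣ) : torusMat (tripleWt d nu) t =
    fromBlocks (torusMat d.wt t) 0 0 (torusMat ![nu, -nu] t) := by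
  ext (i | i) (j | j) <;> simp [torusMat, tripleWt, Matrix.diagonal_apply]

/-- The Lie superalgebra `(𝔰𝔩₂ ⊕ L) ⊕ (k² ⊗ V)`; `nu` is the weight of the torus on `k²`. -/
def tripleSuper (nu : I → ℤ) : ToralLieSuperalgebra k where
  ι := S ⊕ Fin 2
  I := I
  even := tripleEven d
  odd := tripleOdd d
  oddBracket := tripleBracket d
  oddBracket_symm x y := Subtype.ext (by
    simp [tripleBracket, tripleL_symm d (oddBlock d x), tripleSl_symm d (oddBlock d x)])
  lie_oddBracket := by
    rintro ⟨_, A, hA, s, hs, rfl⟩ ⟨_, X, rfl⟩ ⟨_, Y, rfl⟩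
    have hX : ∀ X : Matrix S (Fin 2) k, fromBlocks A 0 0 s * fromBlocks 0 X 0 0 -
        fromBlocks 0 X 0 0 * fromBlocks A 0 0 s = fromBlocks 0 (A * X - X * s) 0 0 := by
      intro X; simp [fromBlocks_multiply, fromBlocks_sub']
    apply Subtype.ext
    change fromBlocks A 0 0 s * fromBlocks (tripleL d X Y) 0 0 (tripleSl d X Y) -
      fromBlocks (tripleL d X Y) 0 0 (tripleSl d X Y) * fromBlocks A 0 0 s =
      fromBlocks (tripleL d (toBlocks₁₂ (fromBlocks A 0 0 s * fromBlocks 0 X 0 0 -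
        fromBlocks 0 X 0 0 * fromBlocks A 0 0 s)) Y) 0 0 (tripleSl d (toBlocks₁₂
        (fromBlocks A 0 0 s * fromBlocks 0 X 0 0 - fromBlocks 0 X 0 0 * fromBlocks A 0 0 s)) Y) +
      fromBlocks (tripleL d X (toBlocks₁₂ (fromBlocks A 0 0 s * fromBlocks 0 Y 0 0 -
        fromBlocks 0 Y 0 0 * fromBlocks A 0 0 s))) 0 0 (tripleSl d X (toBlocks₁₂
        (fromBlocks A 0 0 s * fromBlocks 0 Y 0 0 - fromBlocks 0 Y 0 0 * fromBlocks A 0 0 s)))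
    rw [hX, hX, toBlocks_fromBlocks₁₂, toBlocks_fromBlocks₁₂, fromBlocks_add,
      ← tripleL_equivariant d A hA s hs, ← tripleSl_equivariant d A hA s hs]
    simp [fromBlocks_multiply, fromBlocks_sub']
  oddBracket_lie_self := by
    rintro ⟨_, X, rfl⟩
    apply Subtype.ext
    change fromBlocks (tripleL d X X) 0 0 (tripleSl d X X) * fromBlocks 0 X 0 0 -
      fromBlocks 0 X 0 0 * fromBlocks (tripleL d X X) 0 0 (tripleSl d X X) = 0
    simp [fromBlocks_multiply, fromBlocks_sub', triple_cubic]
  wt := tripleWt d nu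
  conj_mem_even := by
    rintro t _ ⟨A, hA, s, hs, rfl⟩
    refine ⟨_, d.conj_mem t A hA, torusMat ![nu, -nu] t * s * torusMat ![nu, -nu] t⁻¹, ?_, ?_⟩
    · rw [Matrix.mul_assoc, Matrix.trace_mul_comm, Matrix.mul_assoc, torusMat_inv_mul,
        Matrix.mul_one, hs]
    · simp [torusMat_tripleWt, fromBlocks_multiply]
  conj_mem_odd := by
    rintro t _ ⟨X, rfl⟩
    exact ⟨torusMat d.wt t * X * torusMat ![nu, -nu] t⁻¹, by
      simp [torusMat_tripleWt, fromBlocks_multiply]⟩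
  conj_oddBracket := by
    rintro t ⟨_, X, rfl⟩ ⟨_, Y, rfl⟩
    have hX : ∀ X : Matrix S (Fin 2) k, toBlocks₁₂ (torusMat (tripleWt d nu) t *
        fromBlocks 0 X 0 0 * torusMat (tripleWt d nu) t⁻¹) =
        torusMat d.wt t * X * torusMat ![nu, -nu] t⁻¹ := by
      intro X; simp [torusMat_tripleWt, fromBlocks_multiply]
    change torusMat (tripleWt d nu) t * fromBlocks (tripleL d X Y) 0 0 (tripleSl d X Y) *
      torusMat (tripleWt d nu) t⁻¹ = fromBlocks (tripleL d (toBlocks₁₂ (torusMat (tripleWt d nu) t *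
        fromBlocks 0 X 0 0 * torusMat (tripleWt d nu) t⁻¹)) (toBlocks₁₂ (torusMat (tripleWt d nu) t *
        fromBlocks 0 Y 0 0 * torusMat (tripleWt d nu) t⁻¹))) 0 0
        (tripleSl d (toBlocks₁₂ (torusMat (tripleWt d nu) t *
        fromBlocks 0 X 0 0 * torusMat (tripleWt d nu) t⁻¹)) (toBlocks₁₂ (torusMat (tripleWt d nu) t *
        fromBlocks 0 Y 0 0 * torusMat (tripleWt d nu) t⁻¹)))
    rw [hX, hX, torusMat_tripleWt, torusMat_tripleWt]
    simp only [fromBlocks_multiply, Matrix.mul_zero, Matrix.zero_mul, add_zero, zero_add]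
    congr 1
    · have hc : ∀ (X : Matrix S (Fin 2) k) i, (torusMat d.wt t * X * torusMat ![nu, -nu] t⁻¹).col i =
          (((torusChar t ((![nu, -nu] : Fin 2 → I → ℤ) i))⁻¹ : kˣ) : k) •
            (torusMat d.wt t *ᵥ X.col i) := by
        intro X i
        ext j
        simp [torusMat, Matrix.mulVec_diagonal, torusChar_inv, mul_comm]
      simp only [tripleL, hc, map_smul, LinearMap.smul_apply, smul_smul, ← Units.val_mul,
        ← d.conj_D]
      simp [torusChar_neg, Matrix.mul_sub, Matrix.sub_mul]
    · have hb : torusMat d.wt t * d.b * torusMat d.wt t = d.b := by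
        rw [torusMat_mul_form d.wt d.b d.b_weight, Matrix.mul_assoc, torusMat_inv_mul, Matrix.mul_one]
      have hJ : torusMat ![nu, -nu] t * altForm k =
          altForm k * torusMat ![nu, -nu] t⁻¹ :=
        torusMat_mul_form _ _ (by
          intro i j; fin_cases i <;> fin_cases j <;> simp [altForm]) t
      have e : ∀ X Y : Matrix S (Fin 2) k, (torusMat d.wt t * X * torusMat ![nu, -nu] t⁻¹)ᵀ * d.b *
          (torusMat d.wt t * Y * torusMat ![nu, -nu] t⁻¹) =
          torusMat ![nu, -nu] t⁻¹ * (Xᵀ * d.b * Y) * torusMat ![nu, -nu] t⁻¹ := by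
        intro X Y
        calc _ = torusMat ![nu, -nu] t⁻¹ * Xᵀ * (torusMat d.wt t * d.b * torusMat d.wt t) * Y *
              torusMat ![nu, -nu] t⁻¹ := by
              simp only [Matrix.transpose_mul, torusMat_transpose, Matrix.mul_assoc]
          _ = _ := by rw [hb]; simp only [Matrix.mul_assoc]
      simp only [tripleSl, e]
      rw [← Matrix.mul_assoc (torusMat _ _), hJ]
      simp only [Matrix.mul_add, Matrix.add_mul, Matrix.mul_assoc]

end Triple
/-! ### `D(2,1;a)` -/

section D21

variable {k : Type*} [Field k]

/-- `p ⊗ 1 + 1 ⊗ q` acting on `k² ⊗ k²`. -/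
def kronSum (p q : Matrix (Fin 2) (Fin 2) k) : Matrix (Fin 2 × Fin 2) (Fin 2 × Fin 2) k :=
  kroneckerMap (· * ·) p 1 + kroneckerMap (· * ·) 1 q

theorem kronSum_lie (p q p' q' : Matrix (Fin 2) (Fin 2) k) :
    kronSum p q * kronSum p' q' - kronSum p' q' * kronSum p q =
      kronSum (p * p' - p' * p) (q * q' - q' * q) := by
  have h : ∀ p q p' q' : Matrix (Fin 2) (Fin 2) k, kronSum p q * kronSum p' q' =
      kroneckerMap (· * ·) (p * p') 1 + kroneckerMap (· * ·) p q' + (kroneckerMap (· * ·) p' q +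
        kroneckerMap (· * ·) 1 (q * q')) := by
    intro p q p' q'
    have e : ∀ A B A' B' : Matrix (Fin 2) (Fin 2) k,
        kroneckerMap (· * ·) A A' * kroneckerMap (· * ·) B B' =
          kroneckerMap (· * ·) (A * B) (A' * B') := fun A B A' B' =>
      (Matrix.mul_kronecker_mul A B A' B').symm
    simp only [kronSum, Matrix.add_mul, Matrix.mul_add, e, Matrix.one_mul, Matrix.mul_one]
    abel
  rw [h, h]
  ext i j
  simp only [kronSum, Matrix.sub_apply, Matrix.add_apply, Matrix.kroneckerMap_apply]
  ring

theorem kronSum_mulVec (p q : Matrix (Fin 2) (Fin 2) k) (u : Fin 2 × Fin 2 → k) (i j) :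
    (kronSum p q *ᵥ u) (i, j) =
      p i 0 * u (0, j) + p i 1 * u (1, j) + q j 0 * u (i, 0) + q j 1 * u (i, 1) := by
  fin_cases i <;> fin_cases j <;>
    simp [kronSum, Matrix.mulVec, dotProduct, Fintype.sum_prod_type, Fin.sum_univ_two] <;> ring

/-- `𝔰𝔩₂ ⊕ 𝔰𝔩₂` acting on `k² ⊗ k²`. -/
def d21L (k : Type*) [Field k] : LieSubalgebra k (Matrix (Fin 2 × Fin 2) (Fin 2 × Fin 2) k) where
  carrier := {x | ∃ p q : Matrix (Fin 2) (Fin 2) k, p.trace = 0 ∧ q.trace = 0 ∧ x = kronSum p q}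
  add_mem' := by
    rintro _ _ ⟨p, q, hp, hq, rfl⟩ ⟨p', q', hp', hq', rfl⟩
    refine ⟨p + p', q + q', by simp [hp, hp'], by simp [hq, hq'], ?_⟩
    ext i j; simp [kronSum]; ring
  zero_mem' := ⟨0, 0, by simp, by simp, by ext; simp [kronSum]⟩
  smul_mem' := by
    rintro c _ ⟨p, q, hp, hq, rfl⟩
    refine ⟨c • p, c • q, by simp [hp], by simp [hq], ?_⟩
    ext i j; simp [kronSum]; ring
  lie_mem' := by
    rintro _ _ ⟨p, q, hp, hq, rfl⟩ ⟨p', q', hp', hq', rfl⟩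
    exact ⟨p * p' - p' * p, q * q' - q' * q, by simp [Matrix.trace_mul_comm p],
      by simp [Matrix.trace_mul_comm q], kronSum_lie p q p' q'⟩

/-- The linear map from `k² ⊗ k²` to `𝔰𝔩₂` that sends `u ⊗ v` to `z ↦ ω(u, z) v + ω(v, z) u`, with `ω`
the standard alternating form; `f i j` is the coefficient of `e i ⊗ e j`. -/
def symEnd (f : Matrix (Fin 2) (Fin 2) k) : Matrix (Fin 2) (Fin 2) k := (f + fᵀ) * altForm k

theorem symEnd_apply (f : Matrix (Fin 2) (Fin 2) k) (i : Fin 2) :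
    symEnd f i 0 = -(f i 1 + f 1 i) ∧ symEnd f i 1 = f i 0 + f 0 i := by
  constructor <;> simp [symEnd, altForm, Matrix.mul_apply, Fin.sum_univ_two]

/-- For `u = Σ u_ij e_i ⊗ e_j` and `v` likewise, `D(u, v) = S₂ ⊗ 1 + a (1 ⊗ S₃)`, where on pure tensors
`S₂ = ω(u₃, v₃) (z ↦ ω(u₂, z) v₂ + ω(v₂, z) u₂)` and symmetrically for `S₃`. -/
def d21D (a : k) (u v : Fin 2 × Fin 2 → k) : Matrix (Fin 2 × Fin 2) (Fin 2 × Fin 2) k :=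
  kronSum (symEnd (Matrix.of fun i j => u (i, 0) * v (j, 1) - u (i, 1) * v (j, 0)))
    (a • symEnd (Matrix.of fun i j => u (0, i) * v (1, j) - u (1, i) * v (0, j)))

def d21Wt : Fin 2 × Fin 2 → Fin 3 → ℤ := fun i =>
  ![0, if i.1 = 0 then 1 else -1, if i.2 = 0 then 1 else -1]

/-- The form `ω ⊗ ω` on `k² ⊗ k²`, times `c`. -/
def d21Form (c : k) : Matrix (Fin 2 × Fin 2) (Fin 2 × Fin 2) k :=
  c • kroneckerMap (· * ·) (altForm k) (altForm k)

theorem d21_torus (t : Fin 3 → kˣ) (i : Fin 2 × Fin 2) : (torusChar t (d21Wt i) : k) =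
    (if i.1 = 0 then (t 1 : k) else (t 1 : k)⁻¹) * (if i.2 = 0 then (t 2 : k) else (t 2 : k)⁻¹) := by
  simp only [torusChar, d21Wt, Fin.prod_univ_three]
  split_ifs <;> simp

theorem d21D_equivariant (a : k) (p q : Matrix (Fin 2) (Fin 2) k) (hp : p.trace = 0)
    (hq : q.trace = 0) (u v : Fin 2 × Fin 2 → k) :
    kronSum p q * d21D a u v - d21D a u v * kronSum p q =
      d21D a (kronSum p q *ᵥ u) v + d21D a u (kronSum p q *ᵥ v) := by
  rw [Matrix.trace_fin_two] at hp hq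
  have hp' := eq_neg_of_add_eq_zero_right hp
  have hq' := eq_neg_of_add_eq_zero_right hq
  have ha : ∀ p q p' q' : Matrix (Fin 2) (Fin 2) k,
      kronSum p q + kronSum p' q' = kronSum (p + p') (q + q') := by
    intro p q p' q'; ext i j; simp [kronSum]; ring
  simp only [d21D, kronSum_lie, ha]
  congr 1 <;>
  · ext i j
    fin_cases i <;> fin_cases j <;>
      simp only [Fin.zero_eta, Fin.mk_one, symEnd_apply, kronSum_mulVec, Matrix.mul_apply,
        Matrix.smul_apply, smul_eq_mul, Matrix.sub_apply, Matrix.add_apply, Fin.sum_univ_two, hp',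
        hq', Matrix.of_apply] <;>
      ring

/-- Conjugation by `diag(z, z⁻¹)`. -/
def conj2 (z : k) (p : Matrix (Fin 2) (Fin 2) k) : Matrix (Fin 2) (Fin 2) k :=
  !![p 0 0, z * p 0 1 * z; z⁻¹ * p 1 0 * z⁻¹, p 1 1]

theorem d21_conj (t : Fin 3 → kˣ) (p q : Matrix (Fin 2) (Fin 2) k) :
    torusMat d21Wt t * kronSum p q * torusMat d21Wt t⁻¹ =
      kronSum (conj2 (t 1 : k) p) (conj2 (t 2 : k) q) := by
  have ht1 := (t 1).ne_zero
  have ht2 := (t 2).ne_zero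
  ext ⟨i, i'⟩ ⟨j, j'⟩
  rw [conj_apply, Units.val_inv_eq_inv_val, d21_torus, d21_torus]
  fin_cases i <;> fin_cases i' <;> fin_cases j <;> fin_cases j' <;>
    simp [kronSum, conj2] <;> field_simp

theorem d21_conj_D (a : k) (t : Fin 3 → kˣ) (u v : Fin 2 × Fin 2 → k) :
    torusMat d21Wt t * d21D a u v * torusMat d21Wt t⁻¹ =
    d21D a (torusMat d21Wt t *ᵥ u) (torusMat d21Wt t *ᵥ v) := by
  have ht1 := (t 1).ne_zero
  have ht2 := (t 2).ne_zero
  have hv : ∀ u : Fin 2 × Fin 2 → k, torusMat d21Wt t *ᵥ u = fun i => torusChar t (d21Wt i) * u i :=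
    fun u => by ext i; simp [torusMat, Matrix.mulVec_diagonal]
  simp only [hv, d21D, d21_conj, d21_torus]
  congr 1 <;>
  · ext i j
    fin_cases i <;> fin_cases j <;>
      simp [conj2, symEnd_apply] <;> field_simp <;> simp

theorem d21D_apply_self (a : k) (u v : Fin 2 × Fin 2 → k) :
    d21D a u v *ᵥ u = (u ⬝ᵥ d21Form (-(1 + a)) *ᵥ v) • u -
      (u ⬝ᵥ d21Form (-(1 + a)) *ᵥ u) • v := by
  have hb : ∀ c (u v : Fin 2 × Fin 2 → k), u ⬝ᵥ d21Form c *ᵥ v =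
      c * (u (0, 0) * v (1, 1) - u (0, 1) * v (1, 0) - u (1, 0) * v (0, 1) +
        u (1, 1) * v (0, 0)) := by
    intro c u v
    have h00 : altForm k 0 0 = 0 := rfl
    have h01 : altForm k 0 1 = 1 := rfl
    have h10 : altForm k 1 0 = -1 := rfl
    have h11 : altForm k 1 1 = 0 := rfl
    simp only [d21Form, dotProduct, Matrix.mulVec, Fintype.sum_prod_type, Fin.sum_univ_two,
      Matrix.smul_apply, Matrix.kroneckerMap_apply, smul_eq_mul, h00, h01, h10, h11]
    ring
  rw [hb, hb]
  ext ⟨i, j⟩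
  rw [d21D, kronSum_mulVec]
  fin_cases i <;> fin_cases j <;>
    simp only [Fin.zero_eta, Fin.mk_one, symEnd_apply, Pi.sub_apply, Pi.smul_apply,
      Matrix.smul_apply, smul_eq_mul, Matrix.of_apply] <;>
    ring

/-- `V = k² ⊗ k²` with `L = 𝔰𝔩₂ ⊕ 𝔰𝔩₂`, the form `-(1 + a) ω ⊗ ω` and the map `d21D a`. -/
def d21Data (a : k) : TripleData k (Fin 2 × Fin 2) (Fin 3) where
  L := d21L k
  b := d21Form (-(1 + a))
  D := LinearMap.mk₂ k (d21D a)
    (fun u u' v => by ext i j; simp [d21D, kronSum, symEnd, Matrix.mul_apply, Fin.sum_univ_two]; ring)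
    (fun c u v => by ext i j; simp [d21D, kronSum, symEnd, Matrix.mul_apply, Fin.sum_univ_two]; ring)
    (fun u v v' => by ext i j; simp [d21D, kronSum, symEnd, Matrix.mul_apply, Fin.sum_univ_two]; ring)
    (fun c u v => by ext i j; simp [d21D, kronSum, symEnd, Matrix.mul_apply, Fin.sum_univ_two]; ring)
  wt := d21Wt
  b_symm := by
    ext ⟨i, i'⟩ ⟨j, j'⟩
    fin_cases i <;> fin_cases i' <;> fin_cases j <;> fin_cases j' <;> simp [d21Form, altForm]
  b_invariant := by
    rintro _ ⟨p, q, hp, hq, rfl⟩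
    rw [Matrix.trace_fin_two] at hp hq
    have hp' := eq_neg_of_add_eq_zero_right hp
    have hq' := eq_neg_of_add_eq_zero_right hq
    ext ⟨i, i'⟩ ⟨j, j'⟩
    fin_cases i <;> fin_cases i' <;> fin_cases j <;> fin_cases j' <;>
      simp [kronSum, d21Form, altForm, Matrix.mul_apply, Fintype.sum_prod_type, Fin.sum_univ_two,
        hp', hq'] <;> ring
  D_mem u v := by
    have h : ∀ f : Matrix (Fin 2) (Fin 2) k, (symEnd f).trace = 0 := by
      intro f
      simp [symEnd, altForm, Matrix.trace_fin_two, Matrix.mul_apply, Fin.sum_univ_two]; ring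
    exact ⟨_, _, h _, by simp [h], rfl⟩
  D_swap u v := by
    ext i j; simp [d21D, kronSum, symEnd, Matrix.mul_apply, Fin.sum_univ_two]; ring
  D_equivariant := by
    rintro _ ⟨p, q, hp, hq, rfl⟩ u v
    exact d21D_equivariant a p q hp hq u v
  D_apply_self := d21D_apply_self a
  conj_mem := by
    rintro t _ ⟨p, q, hp, hq, rfl⟩
    refine ⟨_, _, ?_, ?_, d21_conj t p q⟩
    · simpa [conj2, Matrix.trace_fin_two] using hp
    · simpa [conj2, Matrix.trace_fin_two] using hq
  b_weight := by
    rintro ⟨i, i'⟩ ⟨j, j'⟩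
    fin_cases i <;> fin_cases i' <;> fin_cases j <;> fin_cases j' <;>
      simp [d21Form, altForm, d21Wt]
  conj_D := d21_conj_D a

/-- `D(2,1;a)`. -/
def d21 (a : k) : ToralLieSuperalgebra k := tripleSuper (d21Data a) ![1, 0, 0]

end D21
/-! ### `G(3)` -/

section G3

variable {k : Type*} [Field k]

/-- The imaginary split octonions: the Zorn matrices with diagonal `(x (inl 0), -x (inl 0))` and
off-diagonal vectors `x ∘ inr ∘ inl` and `x ∘ inr ∘ inr` in `k³`. -/
abbrev OctIndex := Fin 1 ⊕ Fin 3 ⊕ Fin 3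

/-- The commutator `x y - y x` of imaginary split octonions. -/
def octComm (x y : OctIndex → k) : OctIndex → k :=
  let u : (OctIndex → k) → Fin 3 → k := fun x i => x (.inr (.inl i))
  let v : (OctIndex → k) → Fin 3 → k := fun x i => x (.inr (.inr i))
  let a : (OctIndex → k) → k := fun x => x (.inl 0)
  Sum.elim (fun _ => u x ⬝ᵥ v y - v x ⬝ᵥ u y)
    (Sum.elim (fun i => 2 * (a x * u y i - a y * u x i - (v x ⨯₃ v y) i))
      (fun i => 2 * (a y * v x i - a x * v y i + (u x ⨯₃ u y) i)))

/-- The Gram matrix of the polar form of the norm of imaginary split octonions. -/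
def octForm (k : Type*) [Field k] : Matrix OctIndex OctIndex k
  | .inl _, .inl _ => -2
  | .inr (.inl i), .inr (.inr j) => if i = j then -1 else 0
  | .inr (.inr i), .inr (.inl j) => if i = j then -1 else 0
  | _, _ => 0

theorem octComm_zero (x y : OctIndex → k) : octComm x y (.inl 0) =
    x (.inr (.inl 0)) * y (.inr (.inr 0)) + x (.inr (.inl 1)) * y (.inr (.inr 1)) +
      x (.inr (.inl 2)) * y (.inr (.inr 2)) - (x (.inr (.inr 0)) * y (.inr (.inl 0)) +
      x (.inr (.inr 1)) * y (.inr (.inl 1)) + x (.inr (.inr 2)) * y (.inr (.inl 2))) := by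
  simp [octComm, dotProduct, Fin.sum_univ_three]

theorem octComm_u0 (x y : OctIndex → k) : octComm x y (.inr (.inl 0)) =
    2 * (x (.inl 0) * y (.inr (.inl 0)) - y (.inl 0) * x (.inr (.inl 0)) -
      (x (.inr (.inr 1)) * y (.inr (.inr 2)) - x (.inr (.inr 2)) * y (.inr (.inr 1)))) := by
  simp [octComm, crossProduct]

theorem octComm_u1 (x y : OctIndex → k) : octComm x y (.inr (.inl 1)) =
    2 * (x (.inl 0) * y (.inr (.inl 1)) - y (.inl 0) * x (.inr (.inl 1)) -
      (x (.inr (.inr 2)) * y (.inr (.inr 0)) - x (.inr (.inr 0)) * y (.inr (.inr 2)))) := by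
  simp [octComm, crossProduct]

theorem octComm_u2 (x y : OctIndex → k) : octComm x y (.inr (.inl 2)) =
    2 * (x (.inl 0) * y (.inr (.inl 2)) - y (.inl 0) * x (.inr (.inl 2)) -
      (x (.inr (.inr 0)) * y (.inr (.inr 1)) - x (.inr (.inr 1)) * y (.inr (.inr 0)))) := by
  simp [octComm, crossProduct]

theorem octComm_v0 (x y : OctIndex → k) : octComm x y (.inr (.inr 0)) =
    2 * (y (.inl 0) * x (.inr (.inr 0)) - x (.inl 0) * y (.inr (.inr 0)) +
      (x (.inr (.inl 1)) * y (.inr (.inl 2)) - x (.inr (.inl 2)) * y (.inr (.inl 1)))) := by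
  simp [octComm, crossProduct]

theorem octComm_v1 (x y : OctIndex → k) : octComm x y (.inr (.inr 1)) =
    2 * (y (.inl 0) * x (.inr (.inr 1)) - x (.inl 0) * y (.inr (.inr 1)) +
      (x (.inr (.inl 2)) * y (.inr (.inl 0)) - x (.inr (.inl 0)) * y (.inr (.inl 2)))) := by
  simp [octComm, crossProduct]

theorem octComm_v2 (x y : OctIndex → k) : octComm x y (.inr (.inr 2)) =
    2 * (y (.inl 0) * x (.inr (.inr 2)) - x (.inl 0) * y (.inr (.inr 2)) +
      (x (.inr (.inl 0)) * y (.inr (.inl 1)) - x (.inr (.inl 1)) * y (.inr (.inl 0)))) := by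
  simp [octComm, crossProduct]

theorem octComm_add (x x' y : OctIndex → k) : octComm (x + x') y = octComm x y + octComm x' y := by
  ext (i | i | i) <;> fin_cases i <;>
    simp only [Fin.zero_eta, Fin.mk_one, Fin.reduceFinMk, octComm_zero, octComm_u0, octComm_u1, octComm_u2, octComm_v0, octComm_v1, octComm_v2,
      Pi.add_apply, Pi.sub_apply, Pi.smul_apply, Pi.neg_apply, smul_eq_mul] <;>
    ring

theorem octComm_smul (c : k) (x y : OctIndex → k) : octComm (c • x) y = c • octComm x y := by
  ext (i | i | i) <;> fin_cases i <;>
    simp only [Fin.zero_eta, Fin.mk_one, Fin.reduceFinMk, octComm_zero, octComm_u0, octComm_u1, octComm_u2, octComm_v0, octComm_v1, octComm_v2,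
      Pi.add_apply, Pi.sub_apply, Pi.smul_apply, Pi.neg_apply, smul_eq_mul] <;>
    ring

theorem octComm_swap (x y : OctIndex → k) : octComm x y = -octComm y x := by
  ext (i | i | i) <;> fin_cases i <;>
    simp only [Fin.zero_eta, Fin.mk_one, Fin.reduceFinMk, octComm_zero, octComm_u0, octComm_u1, octComm_u2, octComm_v0, octComm_v1, octComm_v2,
      Pi.add_apply, Pi.sub_apply, Pi.smul_apply, Pi.neg_apply, smul_eq_mul] <;>
    ring

theorem octComm_add_right (x y y' : OctIndex → k) :
    octComm x (y + y') = octComm x y + octComm x y' := by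
  rw [octComm_swap, octComm_add, octComm_swap y x, octComm_swap y' x]; abel

theorem octComm_smul_right (c : k) (x y : OctIndex → k) : octComm x (c • y) = c • octComm x y := by
  rw [octComm_swap, octComm_smul, octComm_swap y x]; simp

/-- `z ↦ [w, z]` for an imaginary split octonion `w`. -/
def octAd (w : OctIndex → k) : Matrix OctIndex OctIndex k :=
  Matrix.of fun i j => octComm w (Pi.single j 1) i

theorem octAd_mulVec (w z : OctIndex → k) : octAd w *ᵥ z = octComm w z := by
  have h : octComm w z = octComm w (∑ j, z j • Pi.single j (1 : k)) := by
    congr 1; ext i; simp [Finset.sum_apply, Pi.single_apply]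
  let f : (OctIndex → k) →ₗ[k] (OctIndex → k) :=
    { toFun := octComm w, map_add' := octComm_add_right w
      map_smul' := fun c y => octComm_smul_right c w y }
  have hf : f (∑ j, z j • Pi.single j (1 : k)) = ∑ j, z j • f (Pi.single j 1) := by simp
  change _ = f z
  rw [show f z = f (∑ j, z j • Pi.single j (1 : k)) from h, hf]
  ext i
  simp [octAd, Matrix.mulVec, dotProduct, f, mul_comm, Finset.sum_apply]

/-- The derivation `z ↦ [[x, y], z] + 6 n(y, z) x - 6 n(x, z) y` of the split octonions. -/
def octD (x y : OctIndex → k) : Matrix OctIndex OctIndex k :=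
  octAd (octComm x y) + (6 : k) • (vecMulVec x (octForm k *ᵥ y) - vecMulVec y (octForm k *ᵥ x))

theorem octForm_symm : (octForm k)ᵀ = octForm k := by
  ext (i | i | i) (j | j | j) <;> simp [octForm, eq_comm]

theorem octD_mulVec (x y z : OctIndex → k) : octD x y *ᵥ z =
    octComm (octComm x y) z + (6 * (y ⬝ᵥ octForm k *ᵥ z)) • x - (6 * (x ⬝ᵥ octForm k *ᵥ z)) • y := by
  have h : ∀ u v : OctIndex → k, (octForm k *ᵥ u) ⬝ᵥ v = u ⬝ᵥ octForm k *ᵥ v := by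
    intro u v
    rw [Matrix.dotProduct_mulVec, ← Matrix.mulVec_transpose, octForm_symm]
  rw [octD, Matrix.add_mulVec, octAd_mulVec, Matrix.smul_mulVec, Matrix.sub_mulVec,
    Matrix.vecMulVec_mulVec, Matrix.vecMulVec_mulVec, h, h]
  ext i
  simp
  ring

theorem octForm_apply (x y : OctIndex → k) : x ⬝ᵥ octForm k *ᵥ y =
    -2 * (x (.inl 0) * y (.inl 0)) - (x (.inr (.inl 0)) * y (.inr (.inr 0)) +
      x (.inr (.inl 1)) * y (.inr (.inr 1)) + x (.inr (.inl 2)) * y (.inr (.inr 2))) -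
      (x (.inr (.inr 0)) * y (.inr (.inl 0)) + x (.inr (.inr 1)) * y (.inr (.inl 1)) +
      x (.inr (.inr 2)) * y (.inr (.inl 2))) := by
  simp [octForm, dotProduct, Matrix.mulVec, Fin.sum_univ_three]
  ring

theorem octD_apply_self (x y : OctIndex → k) : octD x y *ᵥ x =
    (x ⬝ᵥ ((4 : k) • octForm k) *ᵥ y) • x - (x ⬝ᵥ ((4 : k) • octForm k) *ᵥ x) • y := by
  rw [octD_mulVec]
  simp only [Matrix.smul_mulVec, dotProduct_smul, octForm_apply]
  ext (i | i | i) <;> fin_cases i <;>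
    simp only [Fin.zero_eta, Fin.mk_one, Fin.reduceFinMk, octComm_zero, octComm_u0, octComm_u1, octComm_u2, octComm_v0, octComm_v1, octComm_v2,
      Pi.add_apply, Pi.sub_apply, Pi.smul_apply, Pi.neg_apply, smul_eq_mul] <;>
    ring

set_option maxHeartbeats 1000000 in
theorem octD_derivation (x y z w : OctIndex → k) : octD x y *ᵥ octComm z w =
    octComm (octD x y *ᵥ z) w + octComm z (octD x y *ᵥ w) := by
  simp only [octD_mulVec, octForm_apply]
  ext (i | i | i) <;> fin_cases i <;>
    simp only [Fin.zero_eta, Fin.mk_one, Fin.reduceFinMk, octComm_zero, octComm_u0, octComm_u1, octComm_u2, octComm_v0,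
      octComm_v1, octComm_v2,
      Pi.add_apply, Pi.sub_apply, Pi.smul_apply, smul_eq_mul] <;>
    ring

theorem octD_skew (x y : OctIndex → k) : (octD x y)ᵀ * octForm k + octForm k * octD x y = 0 := by
  have h : ∀ z w : OctIndex → k, (octD x y *ᵥ z) ⬝ᵥ octForm k *ᵥ w +
      z ⬝ᵥ octForm k *ᵥ (octD x y *ᵥ w) = 0 := by
    intro z w
    simp only [octD_mulVec, octForm_apply]
    simp only [octComm_zero, octComm_u0, octComm_u1, octComm_u2, octComm_v0, octComm_v1, octComm_v2,
      Pi.add_apply, Pi.sub_apply, Pi.smul_apply, Pi.neg_apply, smul_eq_mul]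
    ring
  ext i j
  have := h (Pi.single i 1) (Pi.single j 1)
  simpa [Matrix.mulVec_single_one, Matrix.mul_apply, dotProduct, Matrix.mulVec,
    Pi.single_apply] using this

/-- The exceptional Lie algebra `𝔤₂`: the derivations of the imaginary split octonions that are
skew for the norm. -/
def octL (k : Type*) [Field k] : LieSubalgebra k (Matrix OctIndex OctIndex k) where
  carrier := {A | Aᵀ * octForm k + octForm k * A = 0 ∧
    ∀ x y, A *ᵥ octComm x y = octComm (A *ᵥ x) y + octComm x (A *ᵥ y)}
  add_mem' {A A'} hA hA' := ⟨by
    have := congrArg₂ (· + ·) hA.1 hA'.1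
    simp only [Matrix.transpose_add, add_zero] at this ⊢
    rw [← this]; noncomm_ring, fun x y => by
    simp only [Matrix.add_mulVec, hA.2, hA'.2, octComm_add, octComm_add_right]; abel⟩
  zero_mem' := ⟨by simp, fun x y => by
    have h : ∀ y : OctIndex → k, octComm 0 y = 0 := fun y => by
      simpa using octComm_smul (0 : k) 0 y
    simp [h, octComm_swap _ 0]⟩
  smul_mem' c A hA := ⟨by
    have := congrArg (c • ·) hA.1
    simpa using this, fun x y => by
    simp only [Matrix.smul_mulVec, hA.2, octComm_smul, octComm_smul_right, smul_add]⟩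
  lie_mem' {A A'} hA hA' := ⟨by
    have h1 : Aᵀ * octForm k = -(octForm k * A) := eq_neg_of_add_eq_zero_left hA.1
    have h2 : A'ᵀ * octForm k = -(octForm k * A') := eq_neg_of_add_eq_zero_left hA'.1
    simp only [Ring.lie_def, Matrix.transpose_sub, Matrix.transpose_mul, Matrix.sub_mul,
      Matrix.mul_assoc, h1, h2, Matrix.mul_neg]
    simp only [← Matrix.mul_assoc, h1, h2]
    noncomm_ring, fun x y => by
    have hs : ∀ x x' y : OctIndex → k, octComm (x - x') y = octComm x y - octComm x' y := by
      intro x x' y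
      have := octComm_smul (-1 : k) x' y
      rw [sub_eq_add_neg, octComm_add, ← neg_one_smul k x', this, neg_one_smul, sub_eq_add_neg]
    have hs' : ∀ x y y' : OctIndex → k, octComm x (y - y') = octComm x y - octComm x y' := by
      intro x y y'
      rw [octComm_swap, hs, octComm_swap y x, octComm_swap y' x]; abel
    simp only [Ring.lie_def, Matrix.sub_mulVec, ← Matrix.mulVec_mulVec, hA.2, hA'.2,
      Matrix.mulVec_add, hs, hs']
    abel⟩

/-- The weights of `𝔤₂`: `0`, `±ε₁, ±ε₂, ±ε₃` with `ε₁ + ε₂ + ε₃ = 0`. -/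
def octWt : OctIndex → Fin 3 → ℤ
  | .inl _ => 0
  | .inr (.inl i) => ![![0, 1, 0], ![0, 0, 1], ![0, -1, -1]] i
  | .inr (.inr i) => -![![0, 1, 0], ![0, 0, 1], ![0, -1, -1]] i

theorem octForm_weight (i j) (h : octForm k i j ≠ 0) : octWt i + octWt j = 0 := by
  rcases i with i | i | i <;> rcases j with j | j | j <;> simp [octForm] at h <;>
    simp [octWt, h]

theorem oct_torus (t : Fin 3 → kˣ) (x y : OctIndex → k) :
    torusMat octWt t *ᵥ octComm x y = octComm (torusMat octWt t *ᵥ x) (torusMat octWt t *ᵥ y) := by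
  have hv : ∀ (x : OctIndex → k) i, (torusMat octWt t *ᵥ x) i = torusChar t (octWt i) * x i :=
    fun x i => by simp [torusMat, Matrix.mulVec_diagonal]
  have ht1 := (t 1).ne_zero
  have ht2 := (t 2).ne_zero
  have h0 : (torusChar t (octWt (.inl 0)) : k) = 1 := by simp [torusChar, octWt]
  have hu0 : (torusChar t (octWt (.inr (.inl 0))) : k) = t 1 := by
    simp [torusChar, octWt, Fin.prod_univ_three]
  have hu1 : (torusChar t (octWt (.inr (.inl 1))) : k) = t 2 := by
    simp [torusChar, octWt, Fin.prod_univ_three]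
  have hu2 : (torusChar t (octWt (.inr (.inl 2))) : k) = (t 1 : k)⁻¹ * (t 2 : k)⁻¹ := by
    simp [torusChar, octWt, Fin.prod_univ_three]
  have hv0 : (torusChar t (octWt (.inr (.inr 0))) : k) = (t 1 : k)⁻¹ := by
    simp [torusChar, octWt, Fin.prod_univ_three]
  have hv1 : (torusChar t (octWt (.inr (.inr 1))) : k) = (t 2 : k)⁻¹ := by
    simp [torusChar, octWt, Fin.prod_univ_three]
  have hv2 : (torusChar t (octWt (.inr (.inr 2))) : k) = t 1 * t 2 := by
    simp [torusChar, octWt, Fin.prod_univ_three, mul_comm]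
  ext (i | i | i) <;> fin_cases i <;>
    simp only [Fin.zero_eta, Fin.mk_one, Fin.reduceFinMk, hv, octComm_zero, octComm_u0, octComm_u1,
      octComm_u2, octComm_v0, octComm_v1, octComm_v2, h0, hu0, hu1, hu2, hv0, hv1, hv2] <;>
    field_simp

theorem octForm_torus (t : Fin 3 → kˣ) (x y : OctIndex → k) :
    (torusMat octWt t *ᵥ x) ⬝ᵥ octForm k *ᵥ (torusMat octWt t *ᵥ y) = x ⬝ᵥ octForm k *ᵥ y := by
  have h : torusMat octWt t * octForm k * torusMat octWt t = octForm k := by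
    rw [torusMat_mul_form octWt (octForm k) octForm_weight, Matrix.mul_assoc, torusMat_inv_mul,
      Matrix.mul_one]
  conv_rhs => rw [← h]
  rw [← Matrix.mulVec_mulVec, ← Matrix.mulVec_mulVec, Matrix.dotProduct_mulVec x,
    ← Matrix.mulVec_transpose, torusMat_transpose]

theorem octForm_invariant {A : Matrix OctIndex OctIndex k} (hA : A ∈ octL k) (x y : OctIndex → k) :
    (A *ᵥ x) ⬝ᵥ octForm k *ᵥ y + x ⬝ᵥ octForm k *ᵥ (A *ᵥ y) = 0 := by
  have h := congrArg (fun M => x ⬝ᵥ M *ᵥ y) hA.1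
  simp only [Matrix.add_mulVec, dotProduct_add, ← Matrix.mulVec_mulVec, Matrix.zero_mulVec,
    dotProduct_zero] at h
  rw [← h, Matrix.dotProduct_mulVec x Aᵀ, Matrix.vecMul_transpose]

/-- `V` = the imaginary split octonions with `L = 𝔤₂`, `4` times the norm form and the map `octD`. -/
def g3Data (k : Type*) [Field k] : TripleData k OctIndex (Fin 3) where
  L := octL k
  b := (4 : k) • octForm k
  D := LinearMap.mk₂ k octD
    (fun x x' y => Matrix.ext_of_mulVec_single fun i => by
      simp only [Matrix.add_mulVec, octD_mulVec, octComm_add, Matrix.mulVec_add, add_dotProduct]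
      module)
    (fun c x y => Matrix.ext_of_mulVec_single fun i => by
      simp only [Matrix.smul_mulVec, octD_mulVec, octComm_smul, smul_dotProduct, smul_eq_mul]
      module)
    (fun x y y' => Matrix.ext_of_mulVec_single fun i => by
      simp only [Matrix.add_mulVec, octD_mulVec, octComm_add, octComm_add_right, add_dotProduct]
      module)
    (fun c x y => Matrix.ext_of_mulVec_single fun i => by
      simp only [Matrix.smul_mulVec, octD_mulVec, octComm_smul, octComm_smul_right, smul_dotProduct,
        smul_eq_mul]
      module)
  wt := octWt
  b_symm := by simp [octForm_symm]
  b_invariant A hA := by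
    have := congrArg ((4 : k) • ·) hA.1
    simpa using this
  D_mem x y := ⟨octD_skew x y, octD_derivation x y⟩
  D_swap x y := Matrix.ext_of_mulVec_single fun i => by
    have h := octComm_smul (-1 : k) (octComm y x) (Pi.single i 1)
    simp only [LinearMap.mk₂_apply, Matrix.neg_mulVec, octD_mulVec]
    rw [octComm_swap x y, ← neg_one_smul k (octComm y x), h]
    module
  D_equivariant A hA x y := Matrix.ext_of_mulVec_single fun i => by
    have h1 := octForm_invariant hA x (Pi.single i 1)
    have h2 := octForm_invariant hA y (Pi.single i 1)
    simp only [LinearMap.mk₂_apply, Matrix.sub_mulVec, Matrix.add_mulVec, ← Matrix.mulVec_mulVec,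
      octD_mulVec, Matrix.mulVec_add, Matrix.mulVec_sub, Matrix.mulVec_smul, hA.2, octComm_add,
      eq_neg_of_add_eq_zero_left h1, eq_neg_of_add_eq_zero_left h2]
    module
  D_apply_self := octD_apply_self
  conj_mem t A hA := by
    have h1 := conj_transpose_mul_form octWt (octForm k) octForm_weight t A
    refine ⟨?_, fun x y => ?_⟩
    · rw [h1.1, h1.2, ← Matrix.add_mul, ← Matrix.mul_add, hA.1]; simp
    · simp only [← Matrix.mulVec_mulVec, oct_torus, hA.2, Matrix.mulVec_add]
      simp only [Matrix.mulVec_mulVec, torusMat_mul_inv, Matrix.mul_assoc, Matrix.one_mulVec]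
  b_weight i j h := octForm_weight (k := k) i j (by
    intro h0; simp [h0] at h)
  conj_D t x y := by
    have h : torusMat octWt t * octD x y =
        octD (torusMat octWt t *ᵥ x) (torusMat octWt t *ᵥ y) * torusMat octWt t :=
      Matrix.ext_of_mulVec_single fun i => by
        simp only [← Matrix.mulVec_mulVec, octD_mulVec, Matrix.mulVec_add, Matrix.mulVec_sub,
          Matrix.mulVec_smul, oct_torus, octForm_torus]
    simp only [LinearMap.mk₂_apply, h, Matrix.mul_assoc, torusMat_mul_inv, Matrix.mul_one]

/-- `G(3)`. -/
def g3 (k : Type*) [Field k] : ToralLieSuperalgebra k := tripleSuper (g3Data k) ![1, 0, 0]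

end G3
/-! ### `F(4)` -/

section F4

variable {k : Type*} [Field k]

/-- The index set of the spin representation `k² ⊗ k² ⊗ k²` of `𝔰𝔬(7)`. -/
abbrev SpinIndex := Fin 2 × Fin 2 × Fin 2

def kron3 {R : Type*} [CommRing R] (A B C : Matrix (Fin 2) (Fin 2) R) :
    Matrix SpinIndex SpinIndex R :=
  Matrix.of fun i j => A i.1 j.1 * B i.2.1 j.2.1 * C i.2.2 j.2.2

/-- The Clifford generators of a seven-dimensional quadratic space acting on the spin representation:
three creation operators, the three annihilation operators and the grading operator. -/
def spinGamma (R : Type*) [CommRing R] : Fin 7 → Matrix SpinIndex SpinIndex R :=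
  let c : Matrix (Fin 2) (Fin 2) R := !![0, 1; 0, 0]
  let d : Matrix (Fin 2) (Fin 2) R := !![0, 0; 1, 0]
  let z : Matrix (Fin 2) (Fin 2) R := !![1, 0; 0, -1]
  ![kron3 c 1 1, kron3 z c 1, kron3 z z c, kron3 d 1 1, kron3 z d 1, kron3 z z d, kron3 z z z]

/-- `spinGamma i * spinGamma j + spinGamma j * spinGamma i = spinQ i j`. -/
def spinQ (R : Type*) [CommRing R] : Matrix (Fin 7) (Fin 7) R :=
  Matrix.of fun i j => if i = 6 ∧ j = 6 then 2 else if i.val + 3 = j.val ∧ j.val < 6 then 1 else if j.val + 3 = i.val ∧ i.val < 6 then 1 else 0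

/-- The invariant symmetric form on the spin representation. -/
def spinForm (R : Type*) [CommRing R] : Matrix SpinIndex SpinIndex R :=
  kron3 !![0, 1; -1, 0] !![0, 1; 1, 0] !![0, 1; -1, 0]

theorem spin_clifford_int : ∀ i j, spinGamma ℤ i * spinGamma ℤ j + spinGamma ℤ j * spinGamma ℤ i =
    spinQ ℤ i j • 1 := by
  decide +kernel
theorem spin_skew_int : ∀ i, (spinGamma ℤ i)ᵀ * spinForm ℤ = -(spinForm ℤ * spinGamma ℤ i) := by
  decide +kernel
theorem spin_symm_int : (spinForm ℤ)ᵀ = spinForm ℤ := by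
  decide +kernel

/-- The vector with the given eight coordinates. -/
def spinVec (a b c d e f g h : k) : SpinIndex → k := fun i =>
  ![![![a, b], ![c, d]], ![![e, f], ![g, h]]] i.1 i.2.1 i.2.2

theorem spinGamma_vec0 (a b c d e f g h : k) : spinGamma k 0 *ᵥ spinVec a b c d e f g h =
    spinVec e f g h 0 0 0 0 := by
  ext ⟨i, j, l⟩
  fin_cases i <;> fin_cases j <;> fin_cases l <;>
    simp [spinGamma, kron3, spinVec, Matrix.mulVec, dotProduct, Fintype.sum_prod_type]

theorem spinGamma_vec1 (a b c d e f g h : k) : spinGamma k 1 *ᵥ spinVec a b c d e f g h =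
    spinVec c d 0 0 (-g) (-h) 0 0 := by
  ext ⟨i, j, l⟩
  fin_cases i <;> fin_cases j <;> fin_cases l <;>
    simp [spinGamma, kron3, spinVec, Matrix.mulVec, dotProduct, Fintype.sum_prod_type]

theorem spinGamma_vec2 (a b c d e f g h : k) : spinGamma k 2 *ᵥ spinVec a b c d e f g h =
    spinVec b 0 (-d) 0 (-f) 0 h 0 := by
  ext ⟨i, j, l⟩
  fin_cases i <;> fin_cases j <;> fin_cases l <;>
    simp [spinGamma, kron3, spinVec, Matrix.mulVec, dotProduct, Fintype.sum_prod_type]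

theorem spinGamma_vec3 (a b c d e f g h : k) : spinGamma k 3 *ᵥ spinVec a b c d e f g h =
    spinVec 0 0 0 0 a b c d := by
  ext ⟨i, j, l⟩
  fin_cases i <;> fin_cases j <;> fin_cases l <;>
    simp [spinGamma, kron3, spinVec, Matrix.mulVec, dotProduct, Fintype.sum_prod_type]

theorem spinGamma_vec4 (a b c d e f g h : k) : spinGamma k 4 *ᵥ spinVec a b c d e f g h =
    spinVec 0 0 a b 0 0 (-e) (-f) := by
  ext ⟨i, j, l⟩
  fin_cases i <;> fin_cases j <;> fin_cases l <;>
    simp [spinGamma, kron3, spinVec, Matrix.mulVec, dotProduct, Fintype.sum_prod_type]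

theorem spinGamma_vec5 (a b c d e f g h : k) : spinGamma k 5 *ᵥ spinVec a b c d e f g h =
    spinVec 0 a 0 (-c) 0 (-e) 0 g := by
  ext ⟨i, j, l⟩
  fin_cases i <;> fin_cases j <;> fin_cases l <;>
    simp [spinGamma, kron3, spinVec, Matrix.mulVec, dotProduct, Fintype.sum_prod_type]

theorem spinGamma_vec6 (a b c d e f g h : k) : spinGamma k 6 *ᵥ spinVec a b c d e f g h =
    spinVec a (-b) (-c) d (-e) f g (-h) := by
  ext ⟨i, j, l⟩
  fin_cases i <;> fin_cases j <;> fin_cases l <;>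
    simp [spinGamma, kron3, spinVec, Matrix.mulVec, dotProduct, Fintype.sum_prod_type]

theorem spinForm_vec (a b c d e f g h a' b' c' d' e' f' g' h' : k) :
    spinVec a b c d e f g h ⬝ᵥ spinForm k *ᵥ spinVec a' b' c' d' e' f' g' h' =
      a * h' - b * g' + c * f' - d * e' - e * d' + f * c' - g * b' + h * a' := by
  simp [spinForm, kron3, spinVec, Matrix.mulVec, dotProduct, Fintype.sum_prod_type]
  ring


theorem spinVec_add (a b c d e f g h a' b' c' d' e' f' g' h' : k) :
    spinVec a b c d e f g h + spinVec a' b' c' d' e' f' g' h' =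
      spinVec (a + a') (b + b') (c + c') (d + d') (e + e') (f + f') (g + g') (h + h') := by
  ext ⟨i, j, l⟩
  fin_cases i <;> fin_cases j <;> fin_cases l <;> simp [spinVec]

theorem spinVec_sub (a b c d e f g h a' b' c' d' e' f' g' h' : k) :
    spinVec a b c d e f g h - spinVec a' b' c' d' e' f' g' h' =
      spinVec (a - a') (b - b') (c - c') (d - d') (e - e') (f - f') (g - g') (h - h') := by
  ext ⟨i, j, l⟩
  fin_cases i <;> fin_cases j <;> fin_cases l <;> simp [spinVec]

theorem spinVec_smul (r a b c d e f g h : k) :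
    r • spinVec a b c d e f g h =
      spinVec (r * a) (r * b) (r * c) (r * d) (r * e) (r * f) (r * g) (r * h) := by
  ext ⟨i, j, l⟩
  fin_cases i <;> fin_cases j <;> fin_cases l <;> simp [spinVec]

theorem exists_spinVec (x : SpinIndex → k) : ∃ a b c d e f g h, x = spinVec a b c d e f g h := by
  refine ⟨x (0, 0, 0), x (0, 0, 1), x (0, 1, 0), x (0, 1, 1), x (1, 0, 0), x (1, 0, 1), x (1, 1, 0),
    x (1, 1, 1), ?_⟩
  ext ⟨i, j, l⟩
  fin_cases i <;> fin_cases j <;> fin_cases l <;> simp [spinVec]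

/-- The bivectors of the Clifford algebra, spanning the image of `𝔰𝔬(7)`. -/
def spinE (k : Type*) [Field k] (i j : Fin 7) : Matrix SpinIndex SpinIndex k :=
  spinGamma k i * spinGamma k j - spinGamma k j * spinGamma k i

/-- Twice the inverse of `spinQ`. -/
def spinQInv (k : Type*) [Field k] : Matrix (Fin 7) (Fin 7) k :=
  Matrix.of fun i j => if i = 6 ∧ j = 6 then 1 else 2 * spinQ k i j

/-- The basis dual to `spinGamma`, up to the factor `2`. -/
def spinDual (k : Type*) [Field k] (i : Fin 7) : Matrix SpinIndex SpinIndex k :=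
  ∑ j, spinQInv k i j • spinGamma k j

/-- The computation behind the identity `D(x, y) x = b(x, y) x - b(x, x) y`, in coordinates. -/
theorem spin_abstract {k V : Type*} [Field k] [AddCommGroup V] [Module k V]
    (v : k → k → k → k → k → k → k → k → V)
    (g d : Fin 7 → V → V) (B : V → V → k)
    (hadd : ∀ a b c d e f g h a' b' c' d' e' f' g' h', v a b c d e f g h + v a' b' c' d' e' f' g' h' =
      v (a + a') (b + b') (c + c') (d + d') (e + e') (f + f') (g + g') (h + h'))
    (hsub : ∀ a b c d e f g h a' b' c' d' e' f' g' h', v a b c d e f g h - v a' b' c' d' e' f' g' h' =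
      v (a - a') (b - b') (c - c') (d - d') (e - e') (f - f') (g - g') (h - h'))
    (hsmul : ∀ r a b c d e f g h, r • v a b c d e f g h =
      v (r * a) (r * b) (r * c) (r * d) (r * e) (r * f) (r * g) (r * h))
    (g0 : ∀ a b c d e f g' h, g 0 (v a b c d e f g' h) = v e f g' h 0 0 0 0)
    (g1 : ∀ a b c d e f g' h, g 1 (v a b c d e f g' h) = v c d 0 0 (-g') (-h) 0 0)
    (g2 : ∀ a b c d e f g' h, g 2 (v a b c d e f g' h) = v b 0 (-d) 0 (-f) 0 h 0)
    (g3 : ∀ a b c d e f g' h, g 3 (v a b c d e f g' h) = v 0 0 0 0 a b c d)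
    (g4 : ∀ a b c d e f g' h, g 4 (v a b c d e f g' h) = v 0 0 a b 0 0 (-e) (-f))
    (g5 : ∀ a b c d e f g' h, g 5 (v a b c d e f g' h) = v 0 a 0 (-c) 0 (-e) 0 g')
    (g6 : ∀ a b c d e f g' h, g 6 (v a b c d e f g' h) = v a (-b) (-c) d (-e) f g' (-h))
    (d0 : ∀ x, d 0 x = (2 : k) • g 3 x) (d1 : ∀ x, d 1 x = (2 : k) • g 4 x)
    (d2 : ∀ x, d 2 x = (2 : k) • g 5 x) (d3 : ∀ x, d 3 x = (2 : k) • g 0 x)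
    (d4 : ∀ x, d 4 x = (2 : k) • g 1 x) (d5 : ∀ x, d 5 x = (2 : k) • g 2 x)
    (d6 : ∀ x, d 6 x = g 6 x)
    (hB : ∀ a b c d e f g h a' b' c' d' e' f' g' h', B (v a b c d e f g h)
      (v a' b' c' d' e' f' g' h') =
      a * h' - b * g' + c * f' - d * e' - e * d' + f * c' - g * b' + h * a')
    (a b c e f h m n a' b' c' e' f' h' m' n' : k) :
    (∑ i, ∑ j, B (g i (g j (v a b c e f h m n)) - g j (g i (v a b c e f h m n)))
      (v a' b' c' e' f' h' m' n') •
      (d j (d i (v a b c e f h m n)) - d i (d j (v a b c e f h m n)))) =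
      (24 * B (v a b c e f h m n) (v a' b' c' e' f' h' m' n')) • v a b c e f h m n
      - (24 * B (v a b c e f h m n) (v a b c e f h m n)) • v a' b' c' e' f' h' m' n' := by
  simp only [Fin.sum_univ_seven, d0, d1, d2, d3, d4, d5, d6, g0, g1, g2, g3, g4, g5, g6, hsmul, hsub,
   hB, hadd, mul_zero, zero_mul, neg_zero, sub_zero, zero_sub, add_zero, zero_add, sub_self]
  congr 1 <;> ring
theorem spinDual_mulVec (x : SpinIndex → k) :
    spinDual k 0 *ᵥ x = (2 : k) • (spinGamma k 3 *ᵥ x) ∧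
    spinDual k 1 *ᵥ x = (2 : k) • (spinGamma k 4 *ᵥ x) ∧
    spinDual k 2 *ᵥ x = (2 : k) • (spinGamma k 5 *ᵥ x) ∧
    spinDual k 3 *ᵥ x = (2 : k) • (spinGamma k 0 *ᵥ x) ∧
    spinDual k 4 *ᵥ x = (2 : k) • (spinGamma k 1 *ᵥ x) ∧
    spinDual k 5 *ᵥ x = (2 : k) • (spinGamma k 2 *ᵥ x) ∧
    spinDual k 6 *ᵥ x = spinGamma k 6 *ᵥ x := by
  refine ⟨?_, ?_, ?_, ?_, ?_, ?_, ?_⟩ <;>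
    simp [spinDual, Fin.sum_univ_seven, spinQInv, spinQ, Matrix.smul_mulVec]

/-- The bivector dual to `spinE i j`, up to a scalar. -/
def spinF (k : Type*) [Field k] (i j : Fin 7) : Matrix SpinIndex SpinIndex k :=
  spinDual k j * spinDual k i - spinDual k i * spinDual k j

/-- The map `D(x, y) = Σ_ij B(E_ij x, y) E^ji`. -/
def spinD (x y : SpinIndex → k) : Matrix SpinIndex SpinIndex k :=
  ∑ i, ∑ j, ((spinE k i j *ᵥ x) ⬝ᵥ spinForm k *ᵥ y) • spinF k i j

theorem spinD_apply_self (x y : SpinIndex → k) : spinD x y *ᵥ x =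
    (x ⬝ᵥ ((24 : k) • spinForm k) *ᵥ y) • x - (x ⬝ᵥ ((24 : k) • spinForm k) *ᵥ x) • y := by
  obtain ⟨a, b, c, d, e, f, g, h, rfl⟩ := exists_spinVec x
  obtain ⟨a', b', c', d', e', f', g', h', rfl⟩ := exists_spinVec y
  have H := spin_abstract spinVec (fun i x => spinGamma k i *ᵥ x) (fun i x => spinDual k i *ᵥ x)
    (fun x y => x ⬝ᵥ spinForm k *ᵥ y) spinVec_add spinVec_sub spinVec_smul spinGamma_vec0
    spinGamma_vec1 spinGamma_vec2 spinGamma_vec3 spinGamma_vec4 spinGamma_vec5 spinGamma_vec6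
    (fun x => (spinDual_mulVec x).1) (fun x => (spinDual_mulVec x).2.1)
    (fun x => (spinDual_mulVec x).2.2.1) (fun x => (spinDual_mulVec x).2.2.2.1)
    (fun x => (spinDual_mulVec x).2.2.2.2.1) (fun x => (spinDual_mulVec x).2.2.2.2.2.1)
    (fun x => (spinDual_mulVec x).2.2.2.2.2.2) spinForm_vec a b c d e f g h a' b' c' d' e' f' g' h'
  generalize spinVec a b c d e f g h = x at *
  generalize spinVec a' b' c' d' e' f' g' h' = y at *
  simp only [Matrix.smul_mulVec, dotProduct_smul, smul_eq_mul]
  rw [← H]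
  simp only [spinD, spinE, spinF, Matrix.sum_mulVec, Matrix.smul_mulVec, Matrix.sub_mulVec,
    Matrix.mulVec_mulVec]

theorem kron3_map {R R' : Type*} [CommRing R] [CommRing R'] (f : R →+* R')
    (A B C : Matrix (Fin 2) (Fin 2) R) :
    (kron3 A B C).map f = kron3 (A.map f) (B.map f) (C.map f) := by
  ext i j; simp [kron3]

theorem spinGamma_map (i) : (spinGamma ℤ i).map (Int.castRingHom k) = spinGamma k i := by
  have h : ∀ a b c d : ℤ, (!![a, b; c, d]).map (Int.castRingHom k) =
      !![(a : k), (b : k); (c : k), (d : k)] := by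
    intro a b c d; ext i j; fin_cases i <;> fin_cases j <;> rfl
  have h1 : (1 : Matrix (Fin 2) (Fin 2) ℤ).map (Int.castRingHom k) = 1 := by simp
  fin_cases i <;> change (kron3 _ _ _).map (Int.castRingHom k) = kron3 _ _ _ <;>
    simp only [kron3_map, h, h1, Int.cast_zero, Int.cast_one, Int.cast_neg]

theorem spinQ_map (i j) : Int.castRingHom k (spinQ ℤ i j) = spinQ k i j := by
  simp only [spinQ, Matrix.of_apply]
  split_ifs <;> simp

theorem spinForm_map : (spinForm ℤ).map (Int.castRingHom k) = spinForm k := by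
  have h : ∀ a b c d : ℤ, (!![a, b; c, d]).map (Int.castRingHom k) =
      !![(a : k), (b : k); (c : k), (d : k)] := by
    intro a b c d; ext i j; fin_cases i <;> fin_cases j <;> rfl
  simp only [spinForm, kron3_map, h, Int.cast_zero, Int.cast_one, Int.cast_neg]

theorem spin_clifford (i j) : spinGamma k i * spinGamma k j + spinGamma k j * spinGamma k i =
    spinQ k i j • 1 := by
  have h := congrArg (fun M => M.map (Int.castRingHom k)) (spin_clifford_int i j)
  simp only [Matrix.map_add _ (map_add (Int.castRingHom k)), Matrix.map_mul, spinGamma_map] at h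
  rw [h, ← spinQ_map]
  ext a b
  simp only [Matrix.map_apply, Matrix.smul_apply, Matrix.one_apply]
  split_ifs <;> simp

theorem spin_skew (i) : (spinGamma k i)ᵀ * spinForm k = -(spinForm k * spinGamma k i) := by
  have h := congrArg (fun M => M.map (Int.castRingHom k)) (spin_skew_int i)
  have hn : ∀ M : Matrix SpinIndex SpinIndex ℤ, (-M).map (Int.castRingHom k) =
      -M.map (Int.castRingHom k) := by intro M; ext; simp
  simpa only [hn, Matrix.map_mul, Matrix.transpose_map, spinGamma_map, spinForm_map] using h

theorem spin_symm : (spinForm k)ᵀ = spinForm k := by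
  have h := congrArg (fun M => M.map (Int.castRingHom k)) spin_symm_int
  simpa only [Matrix.transpose_map, spinForm_map] using h

theorem spinForm_comm (x y : SpinIndex → k) :
    x ⬝ᵥ spinForm k *ᵥ y = y ⬝ᵥ spinForm k *ᵥ x := by
  rw [Matrix.dotProduct_mulVec, ← Matrix.mulVec_transpose, spin_symm, dotProduct_comm]

theorem spinE_skew (i j) : (spinE k i j)ᵀ * spinForm k + spinForm k * spinE k i j = 0 := by
  have h : ∀ i j, (spinGamma k i * spinGamma k j)ᵀ * spinForm k =
      spinForm k * (spinGamma k j * spinGamma k i) := by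
    intro i j
    rw [Matrix.transpose_mul, Matrix.mul_assoc, spin_skew, Matrix.mul_neg, ← Matrix.mul_assoc,
      spin_skew, Matrix.neg_mul, neg_neg, Matrix.mul_assoc]
  simp only [spinE, Matrix.transpose_sub, Matrix.sub_mul, h, Matrix.mul_sub]
  abel

theorem spin_invariant {A : Matrix SpinIndex SpinIndex k}
    (hA : Aᵀ * spinForm k + spinForm k * A = 0) (x y : SpinIndex → k) :
    (A *ᵥ x) ⬝ᵥ spinForm k *ᵥ y = -(x ⬝ᵥ spinForm k *ᵥ (A *ᵥ y)) := by
  have h := congrArg (fun M => x ⬝ᵥ M *ᵥ y) hA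
  simp only [Matrix.add_mulVec, dotProduct_add, ← Matrix.mulVec_mulVec, Matrix.zero_mulVec,
    dotProduct_zero] at h
  rw [← eq_neg_of_add_eq_zero_left h, Matrix.dotProduct_mulVec x Aᵀ, Matrix.vecMul_transpose]

/-- The spin representation of `𝔰𝔬(7)`: the endomorphisms that are skew for the invariant form and
act on the span of the Clifford generators through a matrix that is skew for its quadratic form. -/
def spinL (k : Type*) [Field k] : LieSubalgebra k (Matrix SpinIndex SpinIndex k) where
  carrier := {A | Aᵀ * spinForm k + spinForm k * A = 0 ∧ ∃ R : Matrix (Fin 7) (Fin 7) k,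
    Rᵀ * spinQInv k + spinQInv k * R = 0 ∧
    ∀ i, A * spinGamma k i - spinGamma k i * A = ∑ j, R i j • spinGamma k j}
  add_mem' := by
    rintro A A' ⟨hA, R, hR, h⟩ ⟨hA', R', hR', h'⟩
    refine ⟨?_, R + R', ?_, fun i => ?_⟩
    · rw [← add_zero (0 : Matrix SpinIndex SpinIndex k)]
      nth_rewrite 1 [← hA]
      rw [← hA', Matrix.transpose_add]; noncomm_ring
    · rw [← add_zero (0 : Matrix (Fin 7) (Fin 7) k)]
      nth_rewrite 1 [← hR]
      rw [← hR', Matrix.transpose_add]; noncomm_ring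
    · simp only [Matrix.add_apply, add_smul, Finset.sum_add_distrib, ← h, ← h']; noncomm_ring
  zero_mem' := ⟨by simp, 0, by simp, by simp⟩
  smul_mem' := by
    rintro c A ⟨hA, R, hR, h⟩
    refine ⟨?_, c • R, ?_, fun i => ?_⟩
    · simpa using congrArg (c • ·) hA
    · simpa using congrArg (c • ·) hR
    · simp only [Matrix.smul_apply, smul_eq_mul, ← smul_smul, ← Finset.smul_sum, ← h]
      simp [smul_sub]
  lie_mem' := by
    rintro A A' ⟨hA, R, hR, h⟩ ⟨hA', R', hR', h'⟩
    have key : ∀ {n : Type} [Fintype n] (F A A' : Matrix n n k), Aᵀ * F + F * A = 0 →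
        A'ᵀ * F + F * A' = 0 → (A * A' - A' * A)ᵀ * F + F * (A * A' - A' * A) = 0 := by
      intro n _ F A A' hA hA'
      have h1 : Aᵀ * F = -(F * A) := eq_neg_of_add_eq_zero_left hA
      have h2 : A'ᵀ * F = -(F * A') := eq_neg_of_add_eq_zero_left hA'
      simp only [Matrix.transpose_sub, Matrix.transpose_mul, Matrix.sub_mul, Matrix.mul_assoc, h1, h2,
        Matrix.mul_neg]
      simp only [← Matrix.mul_assoc, h1, h2]
      simp only [Matrix.neg_mul, Matrix.mul_sub, Matrix.mul_assoc]
      abel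
    refine ⟨key _ _ _ hA hA', R' * R - R * R', key _ _ _ hR' hR, fun i => ?_⟩
    have e1 : ∀ (A : Matrix SpinIndex SpinIndex k) (R R' : Matrix (Fin 7) (Fin 7) k),
        (∀ i, A * spinGamma k i - spinGamma k i * A = ∑ j, R i j • spinGamma k j) →
        A * (∑ j, R' i j • spinGamma k j) - (∑ j, R' i j • spinGamma k j) * A =
          ∑ j, (R' * R) i j • spinGamma k j := by
      intro A R R' h
      simp only [Finset.mul_sum, Finset.sum_mul, ← Finset.sum_sub_distrib, Matrix.mul_smul,
        Matrix.smul_mul, ← smul_sub, h, Finset.smul_sum, smul_smul, Matrix.mul_apply, Finset.sum_smul]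
      exact Finset.sum_comm
    have e : ⁅A, A'⁆ * spinGamma k i - spinGamma k i * ⁅A, A'⁆ =
        (A * (A' * spinGamma k i - spinGamma k i * A') -
          (A' * spinGamma k i - spinGamma k i * A') * A) -
        (A' * (A * spinGamma k i - spinGamma k i * A) -
          (A * spinGamma k i - spinGamma k i * A) * A') := by
      rw [Ring.lie_def]; noncomm_ring
    rw [e, h, h', e1 A R R' h, e1 A' R' R h']
    simp only [Matrix.sub_apply, sub_smul, Finset.sum_sub_distrib]
theorem spinQInv_int : ∀ a b : Fin 7, ∀ i j : Fin 7,
    ∑ m, ((spinQ ℤ b m * if a = i then 1 else 0) - (spinQ ℤ a m * if b = i then 1 else 0)) *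
      (if m = 6 ∧ j = 6 then 1 else 2 * spinQ ℤ m j) +
    ∑ m, (if i = 6 ∧ m = 6 then 1 else 2 * spinQ ℤ i m) *
      ((spinQ ℤ b m * if a = j then 1 else 0) - (spinQ ℤ a m * if b = j then 1 else 0)) = 0 := by
  decide +kernel

theorem spinE_mem (a b) : spinE k a b ∈ spinL k := by
  refine ⟨spinE_skew a b, Matrix.of fun c j => 2 * ((spinQ k b c * if a = j then 1 else 0) -
    (spinQ k a c * if b = j then 1 else 0)), ?_, fun c => ?_⟩
  · ext i j
    have h := congrArg (Int.castRingHom k) (spinQInv_int a b i j)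
    simp only [map_add, map_sum, map_mul, map_sub, spinQ_map, apply_ite (Int.castRingHom k), map_one,
      map_zero, map_ofNat] at h
    simp only [Matrix.add_apply, Matrix.mul_apply, Matrix.transpose_apply, Matrix.of_apply, spinQInv,
      Matrix.zero_apply]
    refine Eq.trans ?_ ((congrArg (fun z => 2 * z) h).trans (mul_zero _))
    simp only [mul_add, Finset.mul_sum]
    congr 1 <;> exact Finset.sum_congr rfl fun m _ => by ring
  · have h : ∀ i j, spinGamma k i * spinGamma k j =
        spinQ k i j • 1 - spinGamma k j * spinGamma k i := fun i j =>
      eq_sub_of_add_eq (spin_clifford i j)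
    have h2 : ∀ a b, spinGamma k a * spinGamma k b * spinGamma k c = spinQ k b c • spinGamma k a -
        spinQ k a c • spinGamma k b + spinGamma k c * (spinGamma k a * spinGamma k b) := by
      intro a b
      rw [Matrix.mul_assoc, h b c, Matrix.mul_sub, ← Matrix.mul_assoc, h a c]
      simp only [Matrix.mul_smul, Matrix.mul_one, Matrix.sub_mul, Matrix.smul_mul, Matrix.one_mul,
        Matrix.mul_assoc]
      abel
    have h3 : ∀ a b : Fin 7, ∑ j, (spinQ k b c * if a = j then 1 else 0) • spinGamma k j =
        spinQ k b c • spinGamma k a := by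
      intro a b; simp [Finset.sum_ite_eq]
    simp only [Matrix.of_apply, mul_sub, sub_smul, ← smul_smul (2 : k), Finset.sum_sub_distrib,
      ← Finset.smul_sum, h3]
    rw [spinE, Matrix.sub_mul, h2, h2, Matrix.mul_sub]
    module

theorem spinF_mem (i j) : spinF k i j ∈ spinL k := by
  have h : ∀ i j, spinDual k j * spinDual k i =
      ∑ a, ∑ b, (spinQInv k j a * spinQInv k i b) • (spinGamma k a * spinGamma k b) := by
    intro i j
    simp only [spinDual, Finset.sum_mul, Finset.mul_sum, Matrix.smul_mul, Matrix.mul_smul, smul_smul,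
      mul_comm]
    exact Finset.sum_comm
  have e : spinF k i j = ∑ a, ∑ b, (spinQInv k j a * spinQInv k i b) • spinE k a b := by
    rw [spinF, h, h j i, Finset.sum_comm (f := fun a b => (spinQInv k i a * spinQInv k j b) • _),
      ← Finset.sum_sub_distrib]
    refine Finset.sum_congr rfl fun a _ => ?_
    rw [← Finset.sum_sub_distrib]
    refine Finset.sum_congr rfl fun b _ => ?_
    rw [spinE, smul_sub, mul_comm (spinQInv k i b)]
  rw [e]
  exact sum_mem fun a _ => sum_mem fun b _ => (spinL k).smul_mem _ (spinE_mem a b)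

theorem spinD_mem (x y : SpinIndex → k) : spinD x y ∈ spinL k :=
  sum_mem fun i _ => sum_mem fun j _ => (spinL k).smul_mem _ (spinF_mem i j)

theorem spinD_swap (x y : SpinIndex → k) : spinD x y = -spinD y x := by
  simp only [spinD, ← Finset.sum_neg_distrib, ← neg_smul]
  refine Finset.sum_congr rfl fun i _ => Finset.sum_congr rfl fun j _ => ?_
  rw [spin_invariant (spinE_skew i j), spinForm_comm]

theorem spinD_equivariant {A : Matrix SpinIndex SpinIndex k} (hA : A ∈ spinL k)
    (x y : SpinIndex → k) :
    A * spinD x y - spinD x y * A = spinD (A *ᵥ x) y + spinD x (A *ᵥ y) := by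
  obtain ⟨hB, R, hR, h⟩ := hA
  have hd : ∀ i, A * spinDual k i - spinDual k i * A = -∑ j, R j i • spinDual k j := by
    intro i
    have e : ∀ j, (∑ m, spinQInv k i m * R m j) = -∑ m, R m i * spinQInv k m j := by
      intro j
      have := congrFun (congrFun hR i) j
      simp only [Matrix.add_apply, Matrix.mul_apply, Matrix.transpose_apply, Matrix.zero_apply] at this
      exact eq_neg_of_add_eq_zero_right this
    have e2 : A * spinDual k i - spinDual k i * A =
        ∑ j, (∑ m, spinQInv k i m * R m j) • spinGamma k j := by
      simp only [spinDual, Finset.mul_sum, Finset.sum_mul, ← Finset.sum_sub_distrib, Matrix.mul_smul,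
        Matrix.smul_mul, ← smul_sub, h, Finset.smul_sum, smul_smul, Finset.sum_smul]
      exact Finset.sum_comm
    rw [e2]
    simp only [e, neg_smul, Finset.sum_neg_distrib, spinDual, Finset.smul_sum, smul_smul,
      Finset.sum_smul]
    rw [Finset.sum_comm]
  have hF : ∀ i j, A * spinF k i j - spinF k i j * A =
      -∑ m, (R m j • spinF k i m + R m i • spinF k m j) := by
    intro i j
    have e : A * spinF k i j - spinF k i j * A =
        ((A * spinDual k j - spinDual k j * A) * spinDual k i -
          spinDual k i * (A * spinDual k j - spinDual k j * A)) +
        (spinDual k j * (A * spinDual k i - spinDual k i * A) -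
          (A * spinDual k i - spinDual k i * A) * spinDual k j) := by
      rw [spinF]; noncomm_ring
    rw [e, hd, hd]
    simp only [spinF, Finset.sum_add_distrib, smul_sub, Finset.sum_sub_distrib, Matrix.neg_mul,
      Matrix.mul_neg, Finset.sum_mul, Finset.mul_sum, Matrix.smul_mul, Matrix.mul_smul]
    abel
  have hE : ∀ i j, A * spinE k i j - spinE k i j * A =
      ∑ m, (R i m • spinE k m j + R j m • spinE k i m) := by
    intro i j
    have e : A * spinE k i j - spinE k i j * A =
        ((A * spinGamma k i - spinGamma k i * A) * spinGamma k j -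
          spinGamma k j * (A * spinGamma k i - spinGamma k i * A)) +
        (spinGamma k i * (A * spinGamma k j - spinGamma k j * A) -
          (A * spinGamma k j - spinGamma k j * A) * spinGamma k i) := by
      rw [spinE]; noncomm_ring
    rw [e, h, h]
    simp only [spinE, Finset.sum_add_distrib, smul_sub, Finset.sum_sub_distrib,
      Finset.sum_mul, Finset.mul_sum, Matrix.smul_mul, Matrix.mul_smul]
  set c : Fin 7 → Fin 7 → k := fun i j => (spinE k i j *ᵥ x) ⬝ᵥ spinForm k *ᵥ y with hc
  have hcA : ∀ i j, (spinE k i j *ᵥ (A *ᵥ x)) ⬝ᵥ spinForm k *ᵥ y +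
      (spinE k i j *ᵥ x) ⬝ᵥ spinForm k *ᵥ (A *ᵥ y) = -∑ m, (R i m * c m j + R j m * c i m) := by
    intro i j
    have e : (∑ m, (R i m * c m j + R j m * c i m)) =
        ((A * spinE k i j - spinE k i j * A) *ᵥ x) ⬝ᵥ spinForm k *ᵥ y := by
      rw [hE, Matrix.sum_mulVec, sum_dotProduct]
      simp only [Matrix.add_mulVec, Matrix.smul_mulVec, add_dotProduct, smul_dotProduct, smul_eq_mul,
        hc]
    have := spin_invariant hB (spinE k i j *ᵥ x) y
    rw [e, Matrix.sub_mulVec, sub_dotProduct, ← Matrix.mulVec_mulVec, ← Matrix.mulVec_mulVec, this]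
    ring
  have hl : A * spinD x y - spinD x y * A =
      -∑ i, ∑ j, ∑ m, ((c i j * R m j) • spinF k i m + (c i j * R m i) • spinF k m j) := by
    simp only [spinD, Finset.mul_sum, Finset.sum_mul, ← Finset.sum_sub_distrib, Matrix.mul_smul,
      Matrix.smul_mul, ← smul_sub, hF, smul_neg, Finset.smul_sum, smul_add, smul_smul,
      Finset.sum_neg_distrib, hc]
  have hr : spinD (A *ᵥ x) y + spinD x (A *ᵥ y) =
      -∑ i, ∑ j, ∑ m, ((R i m * c m j) • spinF k i j + (R j m * c i m) • spinF k i j) := by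
    simp only [spinD, ← Finset.sum_add_distrib, ← add_smul, hcA, neg_smul, Finset.sum_neg_distrib,
      Finset.sum_smul]
  rw [hl, hr]
  simp only [Finset.sum_add_distrib]
  rw [add_comm]
  congr 2
  · calc _ = ∑ j, ∑ i, ∑ m, (c i j * R m i) • spinF k m j := Finset.sum_comm
      _ = ∑ j, ∑ m, ∑ i, (c i j * R m i) • spinF k m j :=
        Finset.sum_congr rfl fun _ _ => Finset.sum_comm
      _ = ∑ m, ∑ j, ∑ i, (c i j * R m i) • spinF k m j := Finset.sum_comm
      _ = _ := by simp only [mul_comm]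
  · refine Finset.sum_congr rfl fun i _ => ?_
    rw [Finset.sum_comm]
    simp only [mul_comm]

/-- The sign of the weight of a basis vector of `k²`. -/
def spinSign (i : Fin 2) : ℤ := ![1, -1] i

/-- Twice the weights `(±ε₁ ± ε₂ ± ε₃)/2` of the spin representation. -/
def spinWt (i : SpinIndex) : Fin 4 → ℤ := ![0, spinSign i.1, spinSign i.2.1, spinSign i.2.2]

/-- Twice the weights `±ε₁, ±ε₂, ±ε₃, 0` of the Clifford generators. -/
def gammaWt : Fin 7 → Fin 4 → ℤ := ![![0, 2, 0, 0], ![0, 0, 2, 0], ![0, 0, 0, 2], ![0, -2, 0, 0],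
  ![0, 0, -2, 0], ![0, 0, 0, -2], 0]

theorem spinGamma_weight_int : ∀ m i j l,
    spinGamma ℤ m i j * (spinWt i l - (spinWt j l + gammaWt m l)) = 0 := by
  decide +kernel

theorem spinForm_weight_int : ∀ i j l, spinForm ℤ i j * (spinWt i l + spinWt j l) = 0 := by
  decide +kernel

theorem spinQ_weight_int : ∀ i j l, spinQ ℤ i j * (gammaWt i l + gammaWt j l) = 0 := by
  decide +kernel

theorem spinForm_weight (i j) (h : spinForm k i j ≠ 0) : spinWt i + spinWt j = 0 := by
  ext l
  refine (mul_eq_zero.1 (spinForm_weight_int i j l)).resolve_left (fun h0 => h ?_)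
  rw [← spinForm_map, Matrix.map_apply, h0, map_zero]

theorem spinQInv_weight (i j) (h : spinQInv k i j ≠ 0) : gammaWt i + gammaWt j = 0 := by
  ext l
  refine (mul_eq_zero.1 (spinQ_weight_int i j l)).resolve_left (fun h0 => h ?_)
  have h1 : ¬ (i = 6 ∧ j = 6) := by
    rintro ⟨rfl, rfl⟩
    simp [spinQ] at h0
  rw [spinQInv, Matrix.of_apply, if_neg h1, ← spinQ_map, h0, map_zero, mul_zero]

theorem torus_spinGamma (t : Fin 4 → kˣ) (i) : torusMat spinWt t * spinGamma k i =
    (torusChar t (gammaWt i) : k) • (spinGamma k i * torusMat spinWt t) := by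
  refine torusMat_mul_of_weight spinWt spinWt _ _ (fun a b h => ?_) t
  ext l
  refine sub_eq_zero.1 ((mul_eq_zero.1 (spinGamma_weight_int i a b l)).resolve_left
    (fun h0 => h ?_))
  rw [← spinGamma_map, Matrix.map_apply, h0, map_zero]

theorem torus_spinDual (t : Fin 4 → kˣ) (i) : (torusChar t (gammaWt i) : k) •
    (torusMat spinWt t * spinDual k i) = spinDual k i * torusMat spinWt t := by
  simp only [spinDual, Finset.mul_sum, Finset.sum_mul, Finset.smul_sum, Matrix.mul_smul,
    Matrix.smul_mul, torus_spinGamma, smul_smul]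
  refine Finset.sum_congr rfl fun j _ => ?_
  by_cases h : spinQInv k i j = 0
  · simp [h]
  · rw [eq_neg_of_add_eq_zero_left (spinQInv_weight i j h), torusChar_neg]
    congr 1
    field_simp
    simp

theorem torus_spinE (t : Fin 4 → kˣ) (i j) : torusMat spinWt t * spinE k i j =
    ((torusChar t (gammaWt i) : k) * torusChar t (gammaWt j)) • (spinE k i j * torusMat spinWt t) := by
  have h : ∀ i j, torusMat spinWt t * (spinGamma k i * spinGamma k j) =
      ((torusChar t (gammaWt i) : k) * torusChar t (gammaWt j)) •
        (spinGamma k i * spinGamma k j * torusMat spinWt t) := by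
    intro i j
    rw [← Matrix.mul_assoc, torus_spinGamma, Matrix.smul_mul, Matrix.mul_assoc, torus_spinGamma,
      Matrix.mul_smul, smul_smul, Matrix.mul_assoc]
  rw [spinE, Matrix.mul_sub, h, h, mul_comm (torusChar t (gammaWt j) : k), ← smul_sub, Matrix.sub_mul]

theorem torus_spinF (t : Fin 4 → kˣ) (i j) :
    ((torusChar t (gammaWt i) : k) * torusChar t (gammaWt j)) • (torusMat spinWt t * spinF k i j) =
      spinF k i j * torusMat spinWt t := by
  have h : ∀ i j, ((torusChar t (gammaWt i) : k) * torusChar t (gammaWt j)) •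
      (torusMat spinWt t * (spinDual k i * spinDual k j)) =
        spinDual k i * spinDual k j * torusMat spinWt t := by
    intro i j
    rw [Matrix.mul_assoc, ← torus_spinDual, Matrix.mul_smul, ← Matrix.mul_assoc (spinDual k i),
      ← torus_spinDual, Matrix.smul_mul, smul_smul, Matrix.mul_assoc,
      mul_comm (torusChar t (gammaWt i) : k)]
  rw [spinF, Matrix.mul_sub, Matrix.sub_mul, smul_sub, h, mul_comm, h]

theorem torus_spinForm (t : Fin 4 → kˣ) (x y : SpinIndex → k) :
    (torusMat spinWt t *ᵥ x) ⬝ᵥ spinForm k *ᵥ (torusMat spinWt t *ᵥ y) = x ⬝ᵥ spinForm k *ᵥ y := by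
  have h : torusMat spinWt t * spinForm k * torusMat spinWt t = spinForm k := by
    rw [torusMat_mul_form spinWt (spinForm k) spinForm_weight, Matrix.mul_assoc, torusMat_inv_mul,
      Matrix.mul_one]
  conv_rhs => rw [← h]
  rw [← Matrix.mulVec_mulVec, ← Matrix.mulVec_mulVec, Matrix.dotProduct_mulVec x,
    ← Matrix.mulVec_transpose, torusMat_transpose]

theorem torus_spinD (t : Fin 4 → kˣ) (x y : SpinIndex → k) :
    torusMat spinWt t * spinD x y * torusMat spinWt t⁻¹ =
      spinD (torusMat spinWt t *ᵥ x) (torusMat spinWt t *ᵥ y) := by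
  have h : torusMat spinWt t * spinD x y =
      spinD (torusMat spinWt t *ᵥ x) (torusMat spinWt t *ᵥ y) * torusMat spinWt t := by
    simp only [spinD, Finset.mul_sum, Finset.sum_mul]
    refine Finset.sum_congr rfl fun i _ => Finset.sum_congr rfl fun j _ => ?_
    have e : ((spinE k i j *ᵥ x) ⬝ᵥ spinForm k *ᵥ y) =
        ((torusChar t (gammaWt i) : k) * torusChar t (gammaWt j)) *
        ((spinE k i j *ᵥ (torusMat spinWt t *ᵥ x)) ⬝ᵥ spinForm k *ᵥ (torusMat spinWt t *ᵥ y)) := by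
      rw [← torus_spinForm t (spinE k i j *ᵥ x), Matrix.mulVec_mulVec, torus_spinE,
        Matrix.smul_mulVec, smul_dotProduct, smul_eq_mul, ← Matrix.mulVec_mulVec]
    rw [Matrix.mul_smul, Matrix.smul_mul, ← torus_spinF, smul_smul, e, mul_comm]
  rw [h, Matrix.mul_assoc, torusMat_mul_inv, Matrix.mul_one]

theorem spinL_conj (t : Fin 4 → kˣ) {A : Matrix SpinIndex SpinIndex k} (hA : A ∈ spinL k) :
    torusMat spinWt t * A * torusMat spinWt t⁻¹ ∈ spinL k := by
  obtain ⟨hB, R, hR, h⟩ := hA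
  refine ⟨?_, torusMat gammaWt t⁻¹ * R * torusMat gammaWt t⁻¹⁻¹, ?_, fun i => ?_⟩
  · have h1 := conj_transpose_mul_form spinWt (spinForm k) spinForm_weight t A
    rw [h1.1, h1.2, ← Matrix.add_mul, ← Matrix.mul_add, hB]; simp
  · have h1 := conj_transpose_mul_form gammaWt (spinQInv k) spinQInv_weight t⁻¹ R
    rw [h1.1, h1.2, ← Matrix.add_mul, ← Matrix.mul_add, hR]; simp
  · have hg : ∀ j, torusMat spinWt t * spinGamma k j * torusMat spinWt t⁻¹ =
        (torusChar t (gammaWt j) : k) • spinGamma k j := by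
      intro j
      rw [torus_spinGamma, Matrix.smul_mul, Matrix.mul_assoc, torusMat_mul_inv, Matrix.mul_one]
    have hg' : spinGamma k i = (torusChar t⁻¹ (gammaWt i) : k) •
        (torusMat spinWt t * spinGamma k i * torusMat spinWt t⁻¹) := by
      rw [hg, smul_smul, torusChar_inv, Units.inv_mul, one_smul]
    have e : torusMat spinWt t * A * torusMat spinWt t⁻¹ * spinGamma k i -
        spinGamma k i * (torusMat spinWt t * A * torusMat spinWt t⁻¹) =
        (torusChar t⁻¹ (gammaWt i) : k) • (torusMat spinWt t *
          (A * spinGamma k i - spinGamma k i * A) * torusMat spinWt t⁻¹) := by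
      conv_lhs => rw [hg']
      rw [Matrix.mul_sub, Matrix.sub_mul, conj_mul, conj_mul, Matrix.mul_smul, Matrix.smul_mul,
        smul_sub]
    rw [e, h, Finset.mul_sum, Finset.sum_mul, Finset.smul_sum]
    refine Finset.sum_congr rfl fun j _ => ?_
    rw [Matrix.mul_smul, Matrix.smul_mul, hg, smul_smul, smul_smul, conj_apply,
      torusChar_inv t (gammaWt j), inv_inv]

/-- `V` = the spin representation with `L = 𝔰𝔬(7)`, `24` times its invariant form and the map
`spinD`. -/
def f4Data (k : Type*) [Field k] : TripleData k SpinIndex (Fin 4) where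
  L := spinL k
  b := (24 : k) • spinForm k
  D := LinearMap.mk₂ k spinD
    (fun x x' y => by
      simp only [spinD, Matrix.mulVec_add, add_dotProduct, add_smul, Finset.sum_add_distrib])
    (fun c x y => by
      simp only [spinD, Matrix.mulVec_smul, smul_dotProduct, smul_assoc, Finset.smul_sum])
    (fun x y y' => by
      simp only [spinD, Matrix.mulVec_add, dotProduct_add, add_smul, Finset.sum_add_distrib])
    (fun c x y => by
      simp only [spinD, Matrix.mulVec_smul, dotProduct_smul, smul_assoc, Finset.smul_sum])
  wt := spinWt
  b_symm := by rw [Matrix.transpose_smul, spin_symm]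
  b_invariant A hA := by
    have := congrArg ((24 : k) • ·) hA.1
    simpa using this
  D_mem := spinD_mem
  D_swap := spinD_swap
  D_equivariant A hA x y := spinD_equivariant hA x y
  D_apply_self := spinD_apply_self
  conj_mem t A hA := spinL_conj t hA
  b_weight i j h := spinForm_weight (k := k) i j (by
    intro h0; simp [h0] at h)
  conj_D := torus_spinD

/-- `F(4) = (𝔰𝔩₂ ⊕ 𝔰𝔬(7)) ⊕ (k² ⊗ spin)`.  The roots are written in coordinates that are twice the
usual ones: `±(2, 0, 0, 0)` for `𝔰𝔩₂`, `±2 e_i` and `±2 e_i ± 2 e_j` for `𝔰𝔬(7)`, and the odd roots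
`(±1, ±1, ±1, ±1)`. -/
def f4 (k : Type*) [Field k] : ToralLieSuperalgebra k := tripleSuper (f4Data k) ![1, 0, 0, 0]

end F4
/-! ### The basic classical Lie superalgebras -/

/-- The basic classical Lie superalgebras over a field of characteristic `p > 2`, with the restrictions
on `p` under which they are considered. -/
inductive IsBasicClassical {k : Type*} [Field k] (p : ℕ) : ToralLieSuperalgebra k → Prop
  | gl (m n : ℕ) (hp : 2 < p) : IsBasicClassical p (gl k m n)
  | sl (m n : ℕ) (hp : 2 < p) (h : ¬ (p : ℤ) ∣ (m : ℤ) - n) : IsBasicClassical p (sl k m n)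
  | osp (l e n : ℕ) (hp : 2 < p) (he : e ≤ 1) : IsBasicClassical p (osp k l e n)
  | d21 (a : k) (hp : 3 < p) (h0 : a ≠ 0) (h1 : a ≠ -1) : IsBasicClassical p (d21 a)
  | f4 (hp : 15 < p) : IsBasicClassical p (f4 k)
  | g3 (hp : 15 < p) : IsBasicClassical p (g3 k)

/-! ### Roots, Borel subalgebras, reflections -/

namespace ToralLieSuperalgebra

variable {k : Type*} [Field k] (A : ToralLieSuperalgebra k)

/-- The Lie superalgebra `𝔤 = 𝔤₀ ⊕ 𝔤₁` itself. -/
abbrev Carrier := A.even × A.odd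

/-- The bracket `[a + x, b + y] = ([a, b] + [x, y]) + ([a, y] - [b, x])` of `𝔤`, where `a, b` are even
and `x, y` are odd. -/
def bracket (x y : A.Carrier) : A.Carrier :=
  (⁅x.1, y.1⁆ + A.oddBracket x.2 y.2, ⁅x.1, y.2⁆ - ⁅y.1, x.2⁆)

/-- The space `𝔤_lam` of the elements on which every `t ∈ T` acts by the character `lam`. -/
def weightSpace (lam : A.I → ℤ) : Submodule k A.Carrier where
  carrier := {x | ∀ t : A.I → kˣ,
    torusMat A.wt t * x.1 * torusMat A.wt t⁻¹ = (torusChar t lam : k) • (x.1 : Matrix A.ι A.ι k) ∧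
    torusMat A.wt t * x.2 * torusMat A.wt t⁻¹ = (torusChar t lam : k) • (x.2 : Matrix A.ι A.ι k)}
  add_mem' {x y} hx hy t := by
    simp [Matrix.mul_add, Matrix.add_mul, (hx t).1, (hx t).2, (hy t).1, (hy t).2]
  zero_mem' t := by simp
  smul_mem' c x hx t := by simp [(hx t).1, (hx t).2, smul_comm c]

/-- The Cartan subalgebra `𝔥`: the centralizer of `T`. -/
def cartan : Submodule k A.Carrier := A.weightSpace 0

/-- `Δ₀` -/
def evenRoots : Set (A.I → ℤ) := {lam | lam ≠ 0 ∧ ∃ a : A.even, a ≠ 0 ∧ (a, 0) ∈ A.weightSpace lam}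

/-- `Δ₁` -/
def oddRoots : Set (A.I → ℤ) := {lam | lam ≠ 0 ∧ ∃ x : A.odd, x ≠ 0 ∧ (0, x) ∈ A.weightSpace lam}

/-- `Δ` -/
def roots : Set (A.I → ℤ) := A.evenRoots ∪ A.oddRoots

/-- `Δ̄₀`: the even roots `α` with `α / 2 ∉ Δ₁`. -/
def evenRootsBar : Set (A.I → ℤ) := {α | α ∈ A.evenRoots ∧ ∀ β ∈ A.oddRoots, 2 • β ≠ α}

/-- `Δ̄₁`: the odd roots `β` with `2 β ∉ Δ₀`; these are the isotropic odd roots. -/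
def oddRootsBar : Set (A.I → ℤ) := {β | β ∈ A.oddRoots ∧ 2 • β ∉ A.evenRoots}

/-- A positive system: the roots on which some linear functional, that vanishes on no root, is
positive. -/
def IsPositiveSystem (P : Set (A.I → ℤ)) : Prop :=
  ∃ f : (A.I → ℤ) →+ ℝ, (∀ α ∈ A.roots, f α ≠ 0) ∧ P = {α | α ∈ A.roots ∧ 0 < f α}

/-- The Borel subalgebras that contain `𝔥`: the subalgebras `𝔥 + Σ_{θ ∈ P} 𝔤_θ` for the positive
systems `P`. -/
structure IsBorel (B : Submodule k A.Carrier) : Prop where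
  bracket_mem : ∀ x ∈ B, ∀ y ∈ B, A.bracket x y ∈ B
  exists_positiveSystem : ∃ P, A.IsPositiveSystem P ∧ B = A.cartan ⊔ ⨆ θ ∈ P, A.weightSpace θ

/-- The set of the Borel subalgebras that contain `𝔥`. -/
def Borel : Type _ := {B : Submodule k A.Carrier // A.IsBorel B}

variable {A}

/-- The positive system `Δ(B)⁺` of a Borel subalgebra. -/
def posRoots (B : A.Borel) : Set (A.I → ℤ) := {θ | θ ∈ A.roots ∧ A.weightSpace θ ≤ B.1}

/-- The simple roots `Π(B)`: the positive roots that are not the sum of two positive roots. -/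
def simpleRoots (B : A.Borel) : Set (A.I → ℤ) :=
  {θ | θ ∈ posRoots B ∧ ¬ ∃ α ∈ posRoots B, ∃ β ∈ posRoots B, α + β = θ}

variable (A)

/-- `s` is the reflection `s_θ` on the roots: `s θ = -θ`, `s` permutes the roots and moves each root
by a multiple of `θ`.  This determines `s` on the roots; for the usual invariant form and a
non-isotropic root `θ` it is the map `α ↦ α - 2 (α, θ) / (θ, θ) θ`. -/
def IsRootReflection (θ : A.I → ℤ) (s : (A.I → ℤ) →+ (A.I → ℤ)) : Prop :=
  s θ = -θ ∧ ∀ α ∈ A.roots, s α ∈ A.roots ∧ ∃ n : ℤ, s α = α + n • θ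

/-- `r` is the real reflection `r̂_θ` of the set of Borel subalgebras, for a non-isotropic root `θ`:
it sends `𝔥 + Σ_{α ∈ Δ(B)⁺} 𝔤_α` to `𝔥 + Σ_{α ∈ Δ(B)⁺} 𝔤_{s_θ α}`. -/
def IsRealReflection (θ : A.I → ℤ) (r : Equiv.Perm A.Borel) : Prop :=
  θ ∈ A.roots \ A.oddRootsBar ∧ ∃ s, A.IsRootReflection θ s ∧ ∀ B, posRoots (r B) = s '' posRoots B

/-- `r` is the odd reflection `r̂_θ` of the set of Borel subalgebras, for an isotropic odd root `θ`:
if `θ` or `-θ` is a simple root of `B`, it is replaced by its negative in `Δ(B)⁺`; the other Borel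
subalgebras are fixed. -/
def IsOddReflection (θ : A.I → ℤ) (r : Equiv.Perm A.Borel) : Prop :=
  θ ∈ A.oddRootsBar ∧ ∀ B,
    (θ ∈ simpleRoots B → posRoots (r B) = posRoots B \ {θ} ∪ {-θ}) ∧
    (-θ ∈ simpleRoots B → posRoots (r B) = posRoots B \ {-θ} ∪ {θ}) ∧
    (θ ∉ simpleRoots B → -θ ∉ simpleRoots B → r B = B)

/-- `r = r̂_θ`. -/
def IsSuperReflection (θ : A.I → ℤ) (r : Equiv.Perm A.Borel) : Prop :=
  A.IsRealReflection θ r ∨ A.IsOddReflection θ r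

/-- The super Weyl group `Ŵ`, generated by all real and odd reflections. -/
def superWeylGroup : Subgroup (Equiv.Perm A.Borel) :=
  Subgroup.closure {r | ∃ θ, A.IsSuperReflection θ r}

variable {A}

/-- The product `r (i - 1) * ⋯ * r 1 * r 0` of the first `i` terms of a sequence. -/
def partialProd (r : ℕ → Equiv.Perm A.Borel) : ℕ → Equiv.Perm A.Borel
  | 0 => 1
  | i + 1 => r i * partialProd r i

/-- `r (n - 1) * ⋯ * r 0`, with `r i = r̂_{θ i}`, is a standard expression that takes `Π = Π(B)` to
`S`: each `θ i` is a simple root of `(r (i - 1) * ⋯ * r 0) B`, and at the end `S` is the set of simple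
roots. -/
def IsStandardExpression (B : A.Borel) (S : Set (A.I → ℤ)) (n : ℕ) (θ : ℕ → A.I → ℤ)
    (r : ℕ → Equiv.Perm A.Borel) : Prop :=
  (∀ i < n, A.IsSuperReflection (θ i) (r i) ∧ θ i ∈ simpleRoots (partialProd r i B)) ∧
    simpleRoots (partialProd r n B) = S

/-- A standard expression that takes `Π(B)` to `S` is reduced if it has the smallest length of all of
them. -/
def IsStandardReduced (B : A.Borel) (S : Set (A.I → ℤ)) (n : ℕ) (θ : ℕ → A.I → ℤ)
    (r : ℕ → Equiv.Perm A.Borel) : Prop :=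
  IsStandardExpression B S n θ r ∧ ∀ m θ' r', IsStandardExpression B S m θ' r' → n ≤ m

/-- The distinguished elements of `Ŵ` with respect to `Π = Π(B)`: the standard representatives of the
class of the elements that take `Π` to `-Π`, that is, those with a standard reduced expression. -/
def IsDistinguished (B : A.Borel) (w : Equiv.Perm A.Borel) : Prop :=
  w ∈ A.superWeylGroup ∧ ∃ n θ r, IsStandardReduced B ((fun α => -α) '' simpleRoots B) n θ r ∧
    w = partialProd r n

/-! Basic facts that show that the notions above are meaningful: there are finitely many roots, each
positive system gives a Borel subalgebra, there is one, and `B` is determined by its positive roots. -/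

theorem posRoots_injective {B B' : A.Borel} (h : posRoots B = posRoots B') : B = B' := by
  have key : ∀ B B' : A.Borel, posRoots B = posRoots B' → B.1 ≤ B'.1 := by
    intro B B' h
    obtain ⟨P, ⟨f, -, hP⟩, hB⟩ := B.2.exists_positiveSystem
    obtain ⟨P', -, hB'⟩ := B'.2.exists_positiveSystem
    rw [hB]
    refine sup_le (hB' ▸ le_sup_left) (iSup₂_le fun θ hθ => ?_)
    have h1 : θ ∈ posRoots B := ⟨(hP ▸ hθ).1, by
      rw [hB]; exact le_sup_of_le_right (le_iSup₂_of_le θ hθ le_rfl)⟩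
    exact (h ▸ h1).2
  exact Subtype.ext (le_antisymm (key _ _ h) (key _ _ h.symm))

theorem conj_lie_odd (t : A.I → kˣ) (a : A.even) (x : A.odd) :
    torusMat A.wt t * (⁅a, x⁆ : A.odd) * torusMat A.wt t⁻¹ =
      (torusMat A.wt t * a * torusMat A.wt t⁻¹) * (torusMat A.wt t * x * torusMat A.wt t⁻¹) -
      (torusMat A.wt t * x * torusMat A.wt t⁻¹) * (torusMat A.wt t * a * torusMat A.wt t⁻¹) := by
  rw [← conj_mul, ← conj_mul, ← Matrix.sub_mul, ← Matrix.mul_sub]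
  rfl

theorem bracket_mem_weightSpace {lam mu : A.I → ℤ} {x y : A.Carrier} (hx : x ∈ A.weightSpace lam)
    (hy : y ∈ A.weightSpace mu) : A.bracket x y ∈ A.weightSpace (lam + mu) := by
  intro t
  obtain ⟨hx1, hx2⟩ := hx t
  obtain ⟨hy1, hy2⟩ := hy t
  have hc : ((torusChar t (lam + mu) : kˣ) : k) = torusChar t lam * torusChar t mu := by
    rw [torusChar_add, Units.val_mul]
  have hodd : ∀ (z : A.odd) (c : k), torusMat A.wt t * z * torusMat A.wt t⁻¹ =
      c • (z : Matrix A.ι A.ι k) → (⟨_, A.conj_mem_odd t z z.2⟩ : A.odd) = c • z :=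
    fun z c h => Subtype.ext h
  have hb := A.conj_oddBracket t x.2 y.2
  rw [hodd _ _ hx2, hodd _ _ hy2] at hb
  refine ⟨?_, ?_⟩
  · have e : torusMat A.wt t * ((⁅x.1, y.1⁆ : A.even) : Matrix A.ι A.ι k) * torusMat A.wt t⁻¹ =
        (torusMat A.wt t * x.1 * torusMat A.wt t⁻¹) * (torusMat A.wt t * y.1 * torusMat A.wt t⁻¹) -
        (torusMat A.wt t * y.1 * torusMat A.wt t⁻¹) * (torusMat A.wt t * x.1 * torusMat A.wt t⁻¹) := by
      rw [← conj_mul, ← conj_mul, ← Matrix.sub_mul, ← Matrix.mul_sub]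
      rfl
    change torusMat A.wt t * (((⁅x.1, y.1⁆ : A.even) : Matrix A.ι A.ι k) +
      (A.oddBracket x.2 y.2 : Matrix A.ι A.ι k)) * torusMat A.wt t⁻¹ = (torusChar t (lam + mu) : k) •
      (((⁅x.1, y.1⁆ : A.even) : Matrix A.ι A.ι k) + (A.oddBracket x.2 y.2 : Matrix A.ι A.ι k))
    rw [Matrix.mul_add, Matrix.add_mul, e, hb, hx1, hy1, hc, smul_add]
    congr 1
    · rw [Matrix.smul_mul, Matrix.mul_smul, Matrix.smul_mul, Matrix.mul_smul, smul_smul, smul_smul,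
        mul_comm (torusChar t mu : k), ← smul_sub]
      rfl
    · rw [map_smul, map_smul, LinearMap.smul_apply, smul_smul, mul_comm]
      rfl
  · change torusMat A.wt t * (((⁅x.1, y.2⁆ : A.odd) : Matrix A.ι A.ι k) -
      ((⁅y.1, x.2⁆ : A.odd) : Matrix A.ι A.ι k)) * torusMat A.wt t⁻¹ = (torusChar t (lam + mu) : k) •
      (((⁅x.1, y.2⁆ : A.odd) : Matrix A.ι A.ι k) - ((⁅y.1, x.2⁆ : A.odd) : Matrix A.ι A.ι k))
    rw [Matrix.mul_sub, Matrix.sub_mul, conj_lie_odd, conj_lie_odd, hx1, hx2, hy1, hy2, hc, smul_sub]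
    simp only [Matrix.smul_mul, Matrix.mul_smul, smul_smul]
    rw [mul_comm (torusChar t mu : k), ← smul_sub, ← smul_sub]
    rfl

theorem weightSpace_eq_bot {lam : A.I → ℤ} (h0 : lam ≠ 0) (h : lam ∉ A.roots) :
    A.weightSpace lam = ⊥ := by
  rw [eq_bot_iff]
  intro x hx
  have h1 : (x.1, 0) ∈ A.weightSpace lam := fun t => ⟨(hx t).1, by simp⟩
  have h2 : (0, x.2) ∈ A.weightSpace lam := fun t => ⟨by simp, (hx t).2⟩
  rw [Submodule.mem_bot]
  refine Prod.ext ?_ ?_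
  · by_contra hne
    exact h (.inl ⟨h0, x.1, hne, h1⟩)
  · by_contra hne
    exact h (.inr ⟨h0, x.2, hne, h2⟩)

theorem isBorel_of_isPositiveSystem {P : Set (A.I → ℤ)} (hP : A.IsPositiveSystem P) :
    A.IsBorel (A.cartan ⊔ ⨆ θ ∈ P, A.weightSpace θ) := by
  refine ⟨?_, P, hP, rfl⟩
  obtain ⟨f, hf, rfl⟩ := hP
  set B := A.cartan ⊔ ⨆ θ ∈ {α | α ∈ A.roots ∧ 0 < f α}, A.weightSpace θ with hB
  set Q : Set (A.I → ℤ) := {lam | lam = 0 ∨ 0 < f lam} with hQ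
  have hBQ : B = ⨆ θ ∈ Q, A.weightSpace θ := by
    apply le_antisymm
    · refine sup_le (le_iSup₂_of_le 0 (.inl rfl) le_rfl) (iSup₂_le fun θ hθ => ?_)
      exact le_iSup₂_of_le θ (.inr hθ.2) le_rfl
    · refine iSup₂_le fun θ hθ => ?_
      rcases eq_or_ne θ 0 with rfl | h0
      · exact le_sup_left
      · by_cases hr : θ ∈ A.roots
        · exact le_sup_of_le_right (le_iSup₂_of_le θ ⟨hr, hθ.resolve_left h0⟩ le_rfl)
        · rw [weightSpace_eq_bot h0 hr]; exact bot_le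
  have hadd : ∀ lam ∈ Q, ∀ mu ∈ Q, lam + mu ∈ Q := by
    rintro lam (rfl | h) mu (rfl | h')
    · exact .inl (add_zero 0)
    · exact .inr (by simpa using h')
    · exact .inr (by simpa using h)
    · exact .inr (by rw [map_add]; exact add_pos h h')
  have hlin1 : ∀ x x' y, A.bracket (x + x') y = A.bracket x y + A.bracket x' y := by
    intro x x' y
    refine Prod.ext ?_ ?_ <;> simp [bracket] <;> abel
  have hlin2 : ∀ x y y', A.bracket x (y + y') = A.bracket x y + A.bracket x y' := by
    intro x y y'
    refine Prod.ext ?_ ?_ <;> simp [bracket] <;> abel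
  have hz1 : ∀ y, A.bracket 0 y = 0 := by
    intro y; refine Prod.ext ?_ ?_ <;> simp [bracket]
  have hz2 : ∀ x, A.bracket x 0 = 0 := by
    intro x; refine Prod.ext ?_ ?_ <;> simp [bracket]
  rw [hBQ]
  intro x hx y hy
  rw [iSup_subtype'] at hx hy
  induction hx using Submodule.iSup_induction' with
  | zero => rw [hz1]; exact zero_mem _
  | add x x' _ _ h h' => rw [hlin1]; exact add_mem h h'
  | mem lam x hx =>
    induction hy using Submodule.iSup_induction' with
    | zero => rw [hz2]; exact zero_mem _
    | add y y' _ _ h h' => rw [hlin2]; exact add_mem h h'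
    | mem mu y hy =>
      exact Submodule.mem_iSup_of_mem (lam.1 + mu.1) (Submodule.mem_iSup_of_mem
        (hadd _ lam.2 _ mu.2) (bracket_mem_weightSpace hx hy))

theorem exists_isPositiveSystem : ∃ P, A.IsPositiveSystem P := by
  obtain ⟨x, hx⟩ : ∃ x : A.I → ℝ, LinearIndependent ℚ x := by
    have h : Cardinal.lift.{0} (Cardinal.mk A.I) ≤ Cardinal.lift.{0} (Module.rank ℚ ℝ) := by
      rw [Real.rank_rat_real, Cardinal.lift_id, Cardinal.lift_id]
      exact (Cardinal.lt_aleph0_of_finite A.I).le.trans Cardinal.aleph0_le_continuum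
    let b := Module.Basis.ofVectorSpace ℚ ℝ
    rw [← b.mk_eq_rank''] at h
    obtain ⟨g⟩ := Cardinal.lift_mk_le'.1 h
    exact ⟨fun i => b (g i), b.linearIndependent.comp g g.injective⟩
  let f : (A.I → ℤ) →+ ℝ :=
    { toFun := fun lam => ∑ i, (lam i : ℝ) * x i
      map_zero' := by simp
      map_add' := fun a b => by simp [add_mul, Finset.sum_add_distrib] }
  refine ⟨_, f, fun α hα h0 => ?_, rfl⟩
  have hne : α ≠ 0 := hα.elim (fun h => h.1) (fun h => h.1)
  refine hne (funext fun i => ?_)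
  have := Fintype.linearIndependent_iff.1 hx (fun i => (α i : ℚ)) (by
    simpa [f, Rat.smul_def] using h0) i
  exact_mod_cast this

instance : Nonempty A.Borel :=
  let ⟨_, hP⟩ := exists_isPositiveSystem (A := A)
  ⟨⟨_, isBorel_of_isPositiveSystem hP⟩⟩

theorem torusChar_injective [Infinite k] {I : Type} [Fintype I] {a b : I → ℤ}
    (h : ∀ t : I → kˣ, torusChar t a = torusChar t b) : a = b := by
  classical
  funext i
  have h1 : ∀ u : kˣ, u ^ (a i - b i) = 1 := by
    intro u
    have := h (Pi.mulSingle i u)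
    have e : ∀ c : I → ℤ, torusChar (Pi.mulSingle i u) c = u ^ c i := by
      intro c
      rw [torusChar, Finset.prod_eq_single i]
      · simp
      · intro j _ hj; simp [hj]
      · simp
    rw [e, e] at this
    rw [_root_.zpow_sub, this, mul_inv_cancel]
  by_contra hne
  have hn : (a i - b i).natAbs ≠ 0 := by
    rw [Int.natAbs_ne_zero]; exact sub_ne_zero.2 hne
  have h2 : ∀ u : kˣ, u ^ (a i - b i).natAbs = 1 := by
    intro u
    rcases Int.natAbs_eq (a i - b i) with h | h
    · rw [← zpow_natCast, ← h, h1]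
    · have := h1 u
      rw [h, _root_.zpow_neg, inv_eq_one, zpow_natCast] at this
      exact this
  have : NeZero (a i - b i).natAbs := ⟨hn⟩
  have hfin : Finite (rootsOfUnity (a i - b i).natAbs k) := inferInstance
  have htop : rootsOfUnity (a i - b i).natAbs k = ⊤ := by
    rw [eq_top_iff]; intro u _; exact h2 u
  rw [htop] at hfin
  have hu : Finite kˣ := Finite.of_equiv _ (Subgroup.topEquiv (G := kˣ)).toEquiv
  refine Set.infinite_univ (α := k) (((Set.finite_range (fun u : kˣ => (u : k))).insert 0).subset ?_)
  intro c _
  rcases eq_or_ne c 0 with rfl | hc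
  · exact .inl rfl
  · exact .inr ⟨Units.mk0 c hc, rfl⟩

theorem roots_finite [Infinite k] : A.roots.Finite := by
  have key : ∀ (lam : A.I → ℤ) (x : Matrix A.ι A.ι k), x ≠ 0 →
      (∀ t, torusMat A.wt t * x * torusMat A.wt t⁻¹ = (torusChar t lam : k) • x) →
      ∃ p : A.ι × A.ι, A.wt p.1 - A.wt p.2 = lam := by
    intro lam x hx h
    obtain ⟨i, j, hij⟩ : ∃ i j, x i j ≠ 0 := by
      by_contra! h0
      exact hx (by ext i j; exact h0 i j)
    refine ⟨(i, j), torusChar_injective (k := k) fun t => ?_⟩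
    have := congrFun (congrFun (h t) i) j
    rw [conj_apply, Matrix.smul_apply, smul_eq_mul, mul_right_comm] at this
    rw [sub_eq_add_neg, torusChar_add, torusChar_neg]
    ext
    rw [Units.val_mul]
    exact mul_right_cancel₀ hij this
  refine (Set.finite_range fun p : A.ι × A.ι => A.wt p.1 - A.wt p.2).subset ?_
  rintro lam (⟨-, x, hx, h⟩ | ⟨-, x, hx, h⟩)
  · exact key lam x (by simpa using hx) fun t => (h t).1
  · exact key lam x (by simpa using hx) fun t => (h t).2

end ToralLieSuperalgebra

end SuperLie

/-! Only the root system matters. A positive system is cut out by a real functional `f`, and a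
simple root θ spans an extremal ray of the cone of positive roots: some functional vanishes at θ and
is positive on every positive root other than θ and 2θ (`exists_wall`). Tilting this wall functional
slightly towards `-f` gives a positive system that differs from the old one exactly in the signs of
θ and 2θ (`exists_isFlip`). Both kinds of reflection in a simple root have this effect: an odd one
by definition, since 2θ is then not a root, and a real one because `s_θ` moves roots by multiples of
θ and hence preserves the wall functional (`isFlip_of_isRootReflection`).

Fix `B` and call a root primitive if it is not twice a root. For a Borel subalgebra `B'`, count the
primitive roots that are positive for both `B` and `B'`. A flip of `B'` at a simple root lowers this
count by at most 1, and by exactly 1 if that simple root is positive for `B`. While the count is not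
0 there is such a simple root, since otherwise all simple roots of `B'`, hence all its positive
roots, would be negative for `B`; once the count is 0, `B'` is opposite to `B`. So a greedy walk
reaches the opposite Borel subalgebra in as many steps as there are primitive positive roots, and no
standard expression from Π to -Π is shorter. Each positive root changes sign at some step, where it
is θ_i or 2θ_i; this lists the positive roots. Those that are not primitive are the doubles of the
positive non-isotropic odd roots, which gives N.

The wall comes from the classical fact that distinct simple roots pair non-positively. This needs a
pairing with θ that is positive at θ and for which β - θ is a root whenever β ≠ θ pairs positively
with θ. The invariant form cannot serve, since isotropic roots have norm 0; a positive definite form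
on the weights does, also for isotropic roots. This property and the others that the argument needs
are collected in `IsReflective`. They are verified on explicit root systems: differences of basis
vectors for gl and sl, sums of two weights ±e_i or 0 for osp, and finite lists for the exceptional
types. To identify these as the actual roots, characters of the torus must separate weights, which
holds because `k` is infinite; where it is needed, 2 (and for G(3) also 3) is invertible. -/

namespace SuperLie

namespace ToralLieSuperalgebra

variable {k : Type*} [Field k] {A : ToralLieSuperalgebra k}

/-! ### Combinatorics of positive systems -/

/-- A root system with the properties that govern its real and odd reflections: it is symmetric; each
root `θ` has a functional `ℓ` with `0 < ℓ θ` such that `β - θ` is a root for all other roots `β` with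
`0 < ℓ β`; there are root reflections in the non-isotropic roots; the only multiples of roots are the
doubles of odd roots; and no root is both even and odd. -/
structure IsReflective (A : ToralLieSuperalgebra k) : Prop where
  neg_mem : ∀ α ∈ A.roots, -α ∈ A.roots
  exists_pairing : ∀ θ ∈ A.roots, ∃ l : (A.I → ℤ) →+ ℤ, 0 < l θ ∧
    ∀ β ∈ A.roots, β ≠ θ → 0 < l β → β - θ ∈ A.roots
  exists_reflection : ∀ θ ∈ A.roots \ A.oddRootsBar, ∃ s, A.IsRootReflection θ s
  eq_of_nsmul_mem : ∀ θ ∈ A.roots, ∀ n : ℕ, n • θ ∈ A.roots →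
    n = 1 ∨ n = 2 ∧ θ ∈ A.oddRoots ∧ 2 • θ ∈ A.evenRoots
  disjoint : ∀ α ∈ A.evenRoots, α ∉ A.oddRoots

/-! ### Root vectors as matrices supported on one weight difference. -/

theorem ne_zero_of_mem_roots {α : A.I → ℤ} (h : α ∈ A.roots) : α ≠ 0 :=
  h.elim (fun h => h.1) (fun h => h.1)

/-- Conjugation by `t` multiplies the entry `(i, j)` by the character of `w i - w j`, and over an
infinite field different weights are different characters. -/
theorem weight_of_conj_eq_smul [Infinite k] {ι I : Type} [Fintype ι] [DecidableEq ι] [Fintype I]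
    {w : ι → I → ℤ} {lam : I → ℤ} {x : Matrix ι ι k}
    (h : ∀ t, torusMat w t * x * torusMat w t⁻¹ = (torusChar t lam : k) • x) {i j}
    (hij : x i j ≠ 0) : w i - w j = lam := by
  refine torusChar_injective (k := k) fun t => ?_
  have := congrFun (congrFun (h t) i) j
  rw [conj_apply, Matrix.smul_apply, smul_eq_mul, mul_right_comm] at this
  rw [sub_eq_add_neg, torusChar_add, torusChar_neg]
  ext
  rw [Units.val_mul]
  exact mul_right_cancel₀ hij this

theorem conj_eq_smul_of_entries {lam : A.I → ℤ} {x : Matrix A.ι A.ι k}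
    (h : ∀ i j, x i j ≠ 0 → A.wt i - A.wt j = lam) (t : A.I → kˣ) :
    torusMat A.wt t * x * torusMat A.wt t⁻¹ = (torusChar t lam : k) • x := by
  ext i j
  by_cases hij : x i j = 0
  · simp [conj_apply, hij]
  · rw [conj_apply, Matrix.smul_apply, smul_eq_mul, mul_right_comm, ← h i j hij, sub_eq_add_neg,
      torusChar_add, torusChar_neg, Units.val_mul]

/-- Replaces the torus action by a condition on the support of a matrix; the roots of each
superalgebra are computed from this description. -/
theorem mem_evenRoots_iff [Infinite k] {lam : A.I → ℤ} : lam ∈ A.evenRoots ↔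
    lam ≠ 0 ∧ ∃ x ∈ A.even, x ≠ 0 ∧ ∀ i j, x i j ≠ 0 → A.wt i - A.wt j = lam := by
  constructor
  · rintro ⟨h0, a, ha, h⟩
    exact ⟨h0, a, a.2, by simpa using ha, fun i j hij => weight_of_conj_eq_smul (fun t => (h t).1) hij⟩
  · rintro ⟨h0, x, hx, hne, h⟩
    exact ⟨h0, ⟨x, hx⟩, fun h => hne (congrArg Subtype.val h),
      fun t => ⟨conj_eq_smul_of_entries h t, by simp⟩⟩

theorem mem_oddRoots_iff [Infinite k] {lam : A.I → ℤ} : lam ∈ A.oddRoots ↔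
    lam ≠ 0 ∧ ∃ x ∈ A.odd, x ≠ 0 ∧ ∀ i j, x i j ≠ 0 → A.wt i - A.wt j = lam := by
  constructor
  · rintro ⟨h0, a, ha, h⟩
    exact ⟨h0, a, a.2, by simpa using ha, fun i j hij => weight_of_conj_eq_smul (fun t => (h t).2) hij⟩
  · rintro ⟨h0, x, hx, hne, h⟩
    exact ⟨h0, ⟨x, hx⟩, fun h => hne (congrArg Subtype.val h),
      fun t => ⟨by simp, conj_eq_smul_of_entries h t⟩⟩

/-- The Borel subalgebra of a positive system. -/
def borelOf {P : Set (A.I → ℤ)} (hP : A.IsPositiveSystem P) : A.Borel :=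
  ⟨_, isBorel_of_isPositiveSystem hP⟩

/-- The point is that no further root space lies in the Borel subalgebra. All its elements have
their entries at weight differences in `P ∪ {0}` (the submodule `S`), while a nonzero root vector of
θ has an entry at the difference θ. -/
theorem posRoots_borelOf [Infinite k] {P : Set (A.I → ℤ)} (hP : A.IsPositiveSystem P) :
    posRoots (borelOf hP) = P := by
  ext θ
  constructor
  · rintro ⟨hθ, hle⟩
    let S : Submodule k A.Carrier :=
      { carrier := {x | ∀ i j, ((x.1 : Matrix A.ι A.ι k) i j ≠ 0 ∨ (x.2 : Matrix A.ι A.ι k) i j ≠ 0) →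
          A.wt i - A.wt j = 0 ∨ A.wt i - A.wt j ∈ P}
        zero_mem' := by intro i j h; simp at h
        add_mem' := by
          intro x y hx hy i j h
          by_contra hn
          have h1 := mt (hx i j) hn
          have h2 := mt (hy i j) hn
          push Not at h1 h2
          simp [h1, h2] at h
        smul_mem' := by
          intro c x hx i j h
          refine hx i j ?_
          change c * _ ≠ 0 ∨ c * _ ≠ 0 at h
          exact h.imp right_ne_zero_of_mul right_ne_zero_of_mul }
    have hw : ∀ lam, (lam = 0 ∨ lam ∈ P) → A.weightSpace lam ≤ S := by
      intro lam hl x hx i j h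
      have : A.wt i - A.wt j = lam := h.elim (weight_of_conj_eq_smul (fun t => (hx t).1))
        (weight_of_conj_eq_smul (fun t => (hx t).2))
      rwa [this]
    have hS : (borelOf hP).1 ≤ S := sup_le (hw 0 (.inl rfl)) (iSup₂_le fun lam hl => hw lam (.inr hl))
    have key : ∀ x : A.Carrier, x ≠ 0 → x ∈ A.weightSpace θ → θ ∈ P := by
      intro x hx0 hx
      obtain ⟨i, j, h⟩ : ∃ i j,
          (x.1 : Matrix A.ι A.ι k) i j ≠ 0 ∨ (x.2 : Matrix A.ι A.ι k) i j ≠ 0 := by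
        by_contra! h0
        exact hx0 (Prod.ext (Subtype.ext (by ext i j; exact (h0 i j).1))
          (Subtype.ext (by ext i j; exact (h0 i j).2)))
      have hd : A.wt i - A.wt j = θ := h.elim (weight_of_conj_eq_smul (fun t => (hx t).1))
        (weight_of_conj_eq_smul (fun t => (hx t).2))
      exact hd ▸ ((hS (hle hx)) i j h).resolve_left (hd ▸ ne_zero_of_mem_roots hθ)
    rcases hθ with ⟨-, a, ha, h⟩ | ⟨-, a, ha, h⟩
    · exact key _ (by simpa using ha) h
    · exact key _ (by simpa using ha) h
  · intro hθ
    have hr : θ ∈ A.roots := by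
      obtain ⟨f, -, rfl⟩ := hP
      exact hθ.1
    exact ⟨hr, le_sup_of_le_right (le_iSup₂_of_le θ hθ le_rfl)⟩

/-! ### Positive roots through the functional that defines them. -/

theorem exists_functional [Infinite k] (B : A.Borel) : ∃ f : (A.I → ℤ) →+ ℝ,
    (∀ α ∈ A.roots, f α ≠ 0) ∧ ∀ α, α ∈ posRoots B ↔ α ∈ A.roots ∧ 0 < f α := by
  obtain ⟨P, hP, hB⟩ := B.2.exists_positiveSystem
  have h : B = borelOf hP := Subtype.ext hB
  have h2 := posRoots_borelOf hP
  rw [← h] at h2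
  obtain ⟨f, hf, rfl⟩ := hP
  exact ⟨f, hf, fun α => by rw [h2]; rfl⟩

theorem exists_borel_of_functional [Infinite k] (f : (A.I → ℤ) →+ ℝ) (hf : ∀ α ∈ A.roots, f α ≠ 0) :
    ∃ B : A.Borel, ∀ α, α ∈ posRoots B ↔ α ∈ A.roots ∧ 0 < f α :=
  ⟨borelOf (P := {α | α ∈ A.roots ∧ 0 < f α}) ⟨f, hf, rfl⟩,
    fun α => Set.ext_iff.1 (posRoots_borelOf _) α⟩

theorem finite_posRoots [Infinite k] (B : A.Borel) : (posRoots B).Finite :=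
  roots_finite.subset fun _ h => h.1

theorem neg_notMem_posRoots [Infinite k] {B : A.Borel} {α : A.I → ℤ} (h : α ∈ posRoots B) :
    -α ∉ posRoots B := by
  obtain ⟨f, -, hf⟩ := exists_functional B
  rw [hf] at h ⊢
  rw [map_neg]
  intro h'
  linarith [h.2, h'.2]

theorem add_mem_posRoots [Infinite k] {B : A.Borel} {α β : A.I → ℤ} (h : α ∈ posRoots B)
    (h' : β ∈ posRoots B) (hr : α + β ∈ A.roots) : α + β ∈ posRoots B := by
  obtain ⟨f, -, hf⟩ := exists_functional B
  rw [hf] at h h' ⊢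
  rw [map_add]
  exact ⟨hr, add_pos h.2 h'.2⟩

theorem mem_posRoots_of_two_nsmul_mem [Infinite k] {B : A.Borel} {α : A.I → ℤ} (hr : α ∈ A.roots)
    (h : 2 • α ∈ posRoots B) : α ∈ posRoots B := by
  obtain ⟨f, -, hf⟩ := exists_functional B
  rw [hf] at h ⊢
  rw [two_nsmul, map_add] at h
  exact ⟨hr, by linarith [h.2]⟩

/-- Every positive root is a sum of simple roots: a counterexample with the least value of the
defining functional is not simple, and both parts of a decomposition have smaller values. -/
theorem posRoots_induction [Infinite k] {B : A.Borel} {p : (A.I → ℤ) → Prop}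
    (simple : ∀ α ∈ simpleRoots B, p α)
    (add : ∀ α ∈ posRoots B, ∀ β ∈ posRoots B, α + β ∈ posRoots B → p α → p β → p (α + β))
    {α : A.I → ℤ} (hα : α ∈ posRoots B) : p α := by
  by_contra hp
  obtain ⟨f, -, hf⟩ := exists_functional B
  obtain ⟨γ, ⟨hγ, hγp⟩, hmin⟩ := Set.exists_min_image {α | α ∈ posRoots B ∧ ¬ p α} f
    ((finite_posRoots B).subset fun _ h => h.1) ⟨α, hα, hp⟩
  obtain ⟨β, hβ, δ, hδ, rfl⟩ := not_not.1 fun h => hγp (simple γ ⟨hγ, h⟩)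
  have pβ := ((hf β).1 hβ).2
  have pδ := ((hf δ).1 hδ).2
  refine hγp (add β hβ δ hδ hγ ?_ ?_) <;> by_contra hn
  · have := hmin β ⟨hβ, hn⟩
    rw [map_add] at this; linarith
  · have := hmin δ ⟨hδ, hn⟩
    rw [map_add] at this; linarith

theorem posRoots_subset_of_simpleRoots_subset [Infinite k] {B B' : A.Borel}
    (h : simpleRoots B ⊆ posRoots B') : posRoots B ⊆ posRoots B' := fun _ hα =>
  posRoots_induction (p := fun α => α ∈ posRoots B') h
    (fun _ _ _ _ hs h1 h2 => add_mem_posRoots h1 h2 hs.1) hα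

/-! ### Simple roots as extremal rays of the positive cone. -/

namespace IsReflective

theorem neg_mem_iff (hA : A.IsReflective) {α : A.I → ℤ} : -α ∈ A.roots ↔ α ∈ A.roots :=
  ⟨fun h => neg_neg α ▸ hA.neg_mem _ h, hA.neg_mem α⟩

theorem two_nsmul_mem (hA : A.IsReflective) {θ : A.I → ℤ} (h : θ ∈ A.roots) (h2 : 2 • θ ∈ A.roots) :
    θ ∈ A.oddRoots ∧ 2 • θ ∈ A.evenRoots := by
  simpa using hA.eq_of_nsmul_mem θ h 2 h2

theorem two_nsmul_notMem (hA : A.IsReflective) {θ : A.I → ℤ} (h : θ ∈ A.oddRootsBar) :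
    2 • θ ∉ A.roots := fun h2 => h.2 (hA.two_nsmul_mem (.inr h.1) h2).2

variable [Infinite k]

theorem neg_mem_posRoots (hA : A.IsReflective) {B : A.Borel} {α : A.I → ℤ} (hr : α ∈ A.roots)
    (h : α ∉ posRoots B) : -α ∈ posRoots B := by
  obtain ⟨f, hf0, hf⟩ := exists_functional B
  rw [hf] at h ⊢
  refine ⟨hA.neg_mem α hr, ?_⟩
  rw [map_neg]
  have : ¬ 0 < f α := fun h' => h ⟨hr, h'⟩
  have := hf0 α hr
  grind

/-- A positive system contains exactly one of α and -α for each root α, so no positive system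
properly contains another. -/
theorem posRoots_eq_of_subset (hA : A.IsReflective) {B B' : A.Borel}
    (h : posRoots B ⊆ posRoots B') : B = B' := by
  refine posRoots_injective (h.antisymm fun α hα => ?_)
  by_contra hn
  exact neg_notMem_posRoots hα (h (hA.neg_mem_posRoots hα.1 hn))

/-- A simple root spans an extremal ray of the cone of the positive roots. -/
theorem exists_wall (hA : A.IsReflective) {B : A.Borel} {θ : A.I → ℤ} (hθ : θ ∈ simpleRoots B) :
    ∃ g : (A.I → ℤ) →+ ℝ, g θ = 0 ∧ ∀ α ∈ posRoots B, α = θ ∨ α = 2 • θ ∨ 0 < g α := by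
  obtain ⟨f, -, hf⟩ := exists_functional B
  obtain ⟨l, hl0, hl⟩ := hA.exists_pairing θ hθ.1.1
  have hl0' : (0 : ℝ) < l θ := by exact_mod_cast hl0
  -- The multiple of `l` is the one that makes the difference vanish at θ. On another simple root β
  -- the correction can only help, once `l β ≤ 0` is known.
  let g : (A.I → ℤ) →+ ℝ :=
    { toFun := fun x => f x - f θ / l θ * l x
      map_zero' := by simp
      map_add' := fun x y => by simp only [map_add, Int.cast_add]; ring }
  have hg : g θ = 0 := by
    change f θ - f θ / l θ * l θ = 0
    field_simp; ring
  refine ⟨g, hg, fun α hα => ?_⟩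
  -- The claim is stable under sums: multiples of θ add up to multiples of θ, and any other summand
  -- makes `g` positive.
  have key : (∃ n : ℕ, α = n • θ) ∨ 0 < g α := by
    refine posRoots_induction (B := B) (p := fun α => (∃ n : ℕ, α = n • θ) ∨ 0 < g α) ?_ ?_ hα
    · intro β hβ
      by_cases hne : β = θ
      · exact .inl ⟨1, by simpa using hne⟩
      · right
        have hlb : l β ≤ 0 := by
          -- Otherwise β - θ is a root, and one of the simple roots splits: either β = (β - θ) + θ
          -- or θ = (θ - β) + β.
          by_contra! h
          have h1 := hl β hβ.1.1 hne h
          by_cases h2 : β - θ ∈ posRoots B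
          · exact hβ.2 ⟨_, h2, θ, hθ.1, by abel⟩
          · have h3 := hA.neg_mem_posRoots h1 h2
            rw [neg_sub] at h3
            exact hθ.2 ⟨_, h3, β, hβ.1, by abel⟩
        have hlb' : (l β : ℝ) ≤ 0 := by exact_mod_cast hlb
        have h1 := ((hf β).1 hβ.1).2
        have h2 := ((hf θ).1 hθ.1).2
        have h3 : f θ / l θ * l β ≤ 0 := mul_nonpos_of_nonneg_of_nonpos (by positivity) hlb'
        change 0 < f β - f θ / l θ * l β
        linarith
    · rintro β - γ - - (⟨m, rfl⟩ | hβ) (⟨n, rfl⟩ | hγ)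
      · exact .inl ⟨m + n, (add_nsmul ..).symm⟩
      · right; rw [map_add, map_nsmul, hg]; simpa using hγ
      · right; rw [map_add, map_nsmul, hg]; simpa using hβ
      · right; rw [map_add]; exact add_pos hβ hγ
  rcases key with ⟨n, rfl⟩ | h
  · rcases hA.eq_of_nsmul_mem θ hθ.1.1 n hα.1 with rfl | ⟨rfl, -⟩
    · simp
    · simp
  · exact .inr (.inr h)

end IsReflective

/-- The positive roots of `B'` are those of `B`, except that the multiples of `θ` change their sign. -/
def IsFlip (B B' : A.Borel) (θ : A.I → ℤ) : Prop :=
  ∀ α ∈ A.roots, α ∈ posRoots B' ↔ (α ∈ posRoots B ∧ α ≠ θ ∧ α ≠ 2 • θ) ∨ α = -θ ∨ α = -(2 • θ)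

namespace IsReflective

variable [Infinite k]

/-- Tilting the wall functional `g`: the functional `M * g - f` is negative at θ, where `g`
vanishes, and for large `M` it is positive on the finitely many positive roots with `g > 0`. The
negative roots follow by symmetry. -/
theorem exists_isFlip (hA : A.IsReflective) {B : A.Borel} {θ : A.I → ℤ} (hθ : θ ∈ simpleRoots B) :
    ∃ B', IsFlip B B' θ := by
  obtain ⟨f, -, hf⟩ := exists_functional B
  obtain ⟨g, hg0, hg⟩ := hA.exists_wall hθ
  obtain ⟨M, hM⟩ : ∃ M : ℝ, ∀ α ∈ posRoots B, 0 < g α → f α < M * g α := by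
    obtain ⟨M, hM⟩ := ((finite_posRoots B).image fun α => f α / g α).bddAbove
    refine ⟨M + 1, fun α hα h0 => ?_⟩
    have := hM ⟨α, hα, rfl⟩
    rw [div_le_iff₀ h0] at this
    linarith
  let e : (A.I → ℤ) →+ ℝ :=
    { toFun := fun x => M * g x - f x
      map_zero' := by simp
      map_add' := fun x y => by simp only [map_add]; ring }
  have he : ∀ x, e x = M * g x - f x := fun _ => rfl
  have hfθ := ((hf θ).1 hθ.1).2
  have he1 : e θ < 0 := by rw [he, hg0]; linarith
  have he2 : e (2 • θ) < 0 := by rw [map_nsmul, two_nsmul]; linarith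
  have hpos : ∀ α ∈ posRoots B, (α = θ ∨ α = 2 • θ) ∧ e α < 0 ∨ (α ≠ θ ∧ α ≠ 2 • θ) ∧ 0 < e α := by
    intro α hα
    by_cases h1 : α = θ
    · exact .inl ⟨.inl h1, h1 ▸ he1⟩
    by_cases h2 : α = 2 • θ
    · exact .inl ⟨.inr h2, h2 ▸ he2⟩
    · have h3 := ((hg α hα).resolve_left h1).resolve_left h2
      exact .inr ⟨⟨h1, h2⟩, by rw [he]; linarith [hM α hα h3]⟩
  have hneg : ∀ α ∈ A.roots, α ∉ posRoots B →
      (α = -θ ∨ α = -(2 • θ)) ∧ 0 < e α ∨ (α ≠ -θ ∧ α ≠ -(2 • θ)) ∧ e α < 0 := by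
    intro α hr hα
    have h := hpos (-α) (hA.neg_mem_posRoots hr hα)
    simpa only [neg_eq_iff_eq_neg, map_neg, neg_lt_zero, neg_pos, ne_eq] using h
  have hne : ∀ α ∈ A.roots, e α ≠ 0 := by
    intro α hr
    by_cases hα : α ∈ posRoots B
    · rcases hpos α hα with h | h
      · exact h.2.ne
      · exact h.2.ne'
    · rcases hneg α hr hα with h | h
      · exact h.2.ne'
      · exact h.2.ne
  obtain ⟨B', hB'⟩ := exists_borel_of_functional e hne
  refine ⟨B', fun α hr => ?_⟩
  rw [hB']
  by_cases hα : α ∈ posRoots B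
  · have h1 : ¬ (α = -θ ∨ α = -(2 • θ)) := by
      have := ((hf α).1 hα).2
      rintro (rfl | rfl)
      · rw [map_neg] at this; linarith
      · rw [map_neg, map_nsmul] at this; simp at this; linarith
    have := hpos α hα
    grind
  · have := hneg α hr hα
    grind

end IsReflective

end ToralLieSuperalgebra

namespace ToralLieSuperalgebra

variable {k : Type*} [Field k] {A : ToralLieSuperalgebra k}

/-! ### Existence of the reflections and their effect on positive roots -/

/-- As `s α = α + n • θ` and `s θ = -θ`, the second application takes away what the first one added.
-/
theorem IsRootReflection.apply_apply {θ : A.I → ℤ} {s : (A.I → ℤ) →+ (A.I → ℤ)}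
    (hs : A.IsRootReflection θ s) {α : A.I → ℤ} (hα : α ∈ A.roots) : s (s α) = α := by
  obtain ⟨-, n, hn⟩ := hs.2 α hα
  conv_lhs => rw [hn]
  rw [map_add, map_zsmul, hs.1, hn]
  simp

theorem IsRootReflection.mem_image_iff {θ : A.I → ℤ} {s : (A.I → ℤ) →+ (A.I → ℤ)}
    (hs : A.IsRootReflection θ s) {B : A.Borel} {α : A.I → ℤ} (hα : α ∈ A.roots) :
    α ∈ s '' posRoots B ↔ s α ∈ posRoots B := by
  constructor
  · rintro ⟨β, hβ, rfl⟩
    rwa [hs.apply_apply hβ.1]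
  · exact fun h => ⟨_, h, hs.apply_apply hα⟩

/-- If `f` defines the positive system of `B`, then `f ∘ s` defines the reflected one. Since `s` is
an involution on roots, so is the resulting map on Borel subalgebras. -/
theorem IsRootReflection.exists_perm [Infinite k] {θ : A.I → ℤ} {s : (A.I → ℤ) →+ (A.I → ℤ)}
    (hs : A.IsRootReflection θ s) : ∃ r : Equiv.Perm A.Borel, ∀ B, posRoots (r B) = s '' posRoots B := by
  have h : ∀ B : A.Borel, ∃ B' : A.Borel, posRoots B' = s '' posRoots B := by
    intro B
    obtain ⟨f, hf0, hf⟩ := exists_functional B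
    obtain ⟨B', hB'⟩ := exists_borel_of_functional (A := A) (f.comp s)
      fun α hα => hf0 _ (hs.2 α hα).1
    refine ⟨B', Set.ext fun α => ?_⟩
    rw [hB']
    constructor
    · rintro ⟨h1, h2⟩
      exact (hs.mem_image_iff h1).2 ((hf _).2 ⟨(hs.2 α h1).1, h2⟩)
    · rintro ⟨β, hβ, rfl⟩
      refine ⟨(hs.2 β hβ.1).1, ?_⟩
      rw [AddMonoidHom.comp_apply, hs.apply_apply hβ.1]
      exact ((hf β).1 hβ).2
  choose r hr using h
  have hinv : Function.Involutive r := fun B => posRoots_injective (by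
    rw [hr, hr, Set.image_image]
    exact (Set.image_congr fun α hα => hs.apply_apply hα.1).trans (Set.image_id _))
  exact ⟨hinv.toPerm, hr⟩

namespace IsReflective

variable [Infinite k]

/-- The wall functional `g` vanishes at θ, so it is invariant under `s` on roots. A positive root
that is not a multiple of θ has `g > 0`, hence so does its image, which is therefore positive; the
multiples of θ are negated. -/
theorem isFlip_of_isRootReflection (hA : A.IsReflective) {B B' : A.Borel} {θ : A.I → ℤ}
    (hθ : θ ∈ simpleRoots B) {s} (hs : A.IsRootReflection θ s) (hB' : posRoots B' = s '' posRoots B) :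
    IsFlip B B' θ := by
  obtain ⟨g, hg0, hg⟩ := hA.exists_wall hθ
  have hgs : ∀ α ∈ A.roots, g (s α) = g α := by
    intro α hα
    obtain ⟨-, n, hn⟩ := hs.2 α hα
    rw [hn, map_add, map_zsmul, hg0]; simp
  have hg' : ∀ α ∈ posRoots B, 0 ≤ g α := by
    intro α hα
    rcases hg α hα with rfl | rfl | h
    · exact hg0.ge
    · rw [map_nsmul, hg0]; simp
    · exact h.le
  have hpos : ∀ α ∈ posRoots B, α ≠ θ → α ≠ 2 • θ → s α ∈ posRoots B := by
    intro α hα h1 h2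
    by_contra hn
    have h3 := hg' _ (hA.neg_mem_posRoots (hs.2 α hα.1).1 hn)
    rw [map_neg, hgs α hα.1] at h3
    linarith [((hg α hα).resolve_left h1).resolve_left h2]
  have hmul : ∀ α ∈ posRoots B, α = θ ∨ α = 2 • θ → s α ∉ posRoots B := by
    intro α hα h
    have : s α = -α := by
      rcases h with rfl | rfl
      · exact hs.1
      · rw [map_nsmul, hs.1, smul_neg]
    rw [this]
    exact neg_notMem_posRoots hα
  intro α hr
  rw [hB', hs.mem_image_iff hr]
  by_cases hα : α ∈ posRoots B
  · have h1 : ¬ (α = -θ ∨ α = -(2 • θ)) := by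
      rintro (rfl | rfl)
      · exact neg_notMem_posRoots hθ.1 hα
      · have h2 := neg_notMem_posRoots hα
        rw [neg_neg] at h2
        refine h2 ?_
        rw [two_nsmul]
        refine add_mem_posRoots hθ.1 hθ.1 ?_
        rw [← two_nsmul]
        exact hA.neg_mem_iff.1 hr
    by_cases h2 : α = θ ∨ α = 2 • θ
    · have := hmul α hα h2
      grind
    · push Not at h2
      have := hpos α hα h2.1 h2.2
      grind
  · have hn := hA.neg_mem_posRoots hr hα
    -- Since `s` commutes with negation, the negative roots are settled by the positive ones.
    have hsn : s α ∈ posRoots B ↔ s (-α) ∉ posRoots B := by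
      rw [map_neg]
      refine ⟨fun h => neg_notMem_posRoots h, fun h => ?_⟩
      have := hA.neg_mem_posRoots (hA.neg_mem _ (hs.2 α hr).1) h
      rwa [neg_neg] at this
    by_cases h2 : -α = θ ∨ -α = 2 • θ
    · have := hmul _ hn h2
      have h3 : α = -θ ∨ α = -(2 • θ) := by simpa only [neg_eq_iff_eq_neg] using h2
      grind
    · have h3 : ¬ (α = -θ ∨ α = -(2 • θ)) := by simpa only [neg_eq_iff_eq_neg] using h2
      push Not at h2
      have := hpos _ hn h2.1 h2.2
      grind

theorem posRoots_of_isFlip (hA : A.IsReflective) {B B' : A.Borel} {θ : A.I → ℤ}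
    (hθ : θ ∈ A.roots) (h : IsFlip B B' θ) (h2 : 2 • θ ∉ A.roots) :
    posRoots B' = posRoots B \ {θ} ∪ {-θ} := by
  have h3 : -(2 • θ) ∉ A.roots := fun h => h2 (hA.neg_mem_iff.1 h)
  have h4 := hA.neg_mem θ hθ
  ext α
  simp only [Set.mem_union, Set.mem_sdiff, Set.mem_singleton_iff]
  by_cases hr : α ∈ A.roots
  · rw [h α hr]
    grind
  · have : α ∉ posRoots B := fun h => hr h.1
    have : α ∉ posRoots B' := fun h => hr h.1
    grind

theorem isFlip_of_posRoots_eq (hA : A.IsReflective) {B B' : A.Borel} {θ : A.I → ℤ}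
    (h : posRoots B' = posRoots B \ {θ} ∪ {-θ}) (h2 : 2 • θ ∉ A.roots) : IsFlip B B' θ := by
  have h3 : -(2 • θ) ∉ A.roots := fun h => h2 (hA.neg_mem_iff.1 h)
  intro α hr
  rw [h]
  simp only [Set.mem_union, Set.mem_sdiff, Set.mem_singleton_iff]
  grind

/-- If -θ split into two roots of the old system, it would be positive there; if -θ itself were one
of the summands, the other would be 0. This is what lets an odd reflection undo itself. -/
theorem neg_mem_simpleRoots_of_isFlip (hA : A.IsReflective) {B B' : A.Borel} {θ : A.I → ℤ}
    (hθ : θ ∈ simpleRoots B) (h2 : 2 • θ ∉ A.roots) (h : IsFlip B B' θ) : -θ ∈ simpleRoots B' := by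
  rw [simpleRoots, hA.posRoots_of_isFlip hθ.1.1 h h2]
  have h0 : θ ≠ 0 := ne_zero_of_mem_roots hθ.1.1
  refine ⟨.inr rfl, ?_⟩
  rintro ⟨α, hα | rfl, β, hβ | rfl, hs⟩
  · exact neg_notMem_posRoots hθ.1
      (hs ▸ add_mem_posRoots hα.1 hβ.1 (hs ▸ hA.neg_mem _ hθ.1.1))
  · rw [add_eq_right] at hs
    exact ne_zero_of_mem_roots hα.1.1 hs
  · rw [add_eq_left] at hs
    exact ne_zero_of_mem_roots hβ.1.1 hs
  · rw [add_eq_left, neg_eq_zero] at hs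
    exact h0 hs

/-- The map flips at whichever of θ and -θ is simple and fixes the remaining Borel subalgebras.
After a flip at θ the root -θ is simple, and flipping there goes back, so the map is an involution.
-/
theorem exists_isOddReflection (hA : A.IsReflective) {θ : A.I → ℤ} (hθ : θ ∈ A.oddRootsBar) :
    ∃ r, A.IsOddReflection θ r := by
  classical
  have h2 : 2 • θ ∉ A.roots := hA.two_nsmul_notMem hθ
  have h2' : 2 • (-θ) ∉ A.roots := by rwa [smul_neg, hA.neg_mem_iff]
  have hr : θ ∈ A.roots := .inr hθ.1
  have hr' : -θ ∈ A.roots := hA.neg_mem θ hr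
  -- `F B α` is a flip only if α is simple for `B`; its other values play no role.
  choose! F hF using fun (B : A.Borel) (α : A.I → ℤ) (h : α ∈ simpleRoots B) => hA.exists_isFlip h
  let r : A.Borel → A.Borel := fun B =>
    if θ ∈ simpleRoots B then F B θ else if -θ ∈ simpleRoots B then F B (-θ) else B
  have hFF : ∀ (B : A.Borel) (α : A.I → ℤ), α ∈ A.roots → 2 • α ∉ A.roots → α ∈ simpleRoots B →
      α ∉ simpleRoots (F B α) ∧ -α ∈ simpleRoots (F B α) ∧ F (F B α) (-α) = B := by
    intro B α hα hα2 hs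
    have h1 := hA.neg_mem_simpleRoots_of_isFlip hs hα2 (hF B α hs)
    refine ⟨fun h => neg_notMem_posRoots h.1 h1.1, h1, posRoots_injective ?_⟩
    rw [hA.posRoots_of_isFlip (hA.neg_mem α hα) (hF _ _ h1) (by rwa [smul_neg, hA.neg_mem_iff]),
      hA.posRoots_of_isFlip hα (hF _ _ hs) hα2]
    have h3 := neg_notMem_posRoots hs.1
    have h4 := hs.1
    ext β
    simp only [Set.mem_union, Set.mem_sdiff, Set.mem_singleton_iff, neg_neg]
    grind
  have hexcl : ∀ B : A.Borel, θ ∈ simpleRoots B → -θ ∉ simpleRoots B := fun B h h' =>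
    neg_notMem_posRoots h.1 h'.1
  have hinv : Function.Involutive r := by
    intro B
    by_cases h : θ ∈ simpleRoots B
    · obtain ⟨e1, e2, e3⟩ := hFF B θ hr h2 h
      have : r B = F B θ := if_pos h
      rw [this]
      simp only [r, if_neg e1, if_pos e2, e3]
    · by_cases h' : -θ ∈ simpleRoots B
      · obtain ⟨e1, e2, e3⟩ := hFF B (-θ) hr' h2' h'
        rw [neg_neg] at e2 e3
        have : r B = F B (-θ) := by simp only [r, if_neg h, if_pos h']
        rw [this]
        simp only [r, if_pos e2, e3]
      · simp only [r, if_neg h, if_neg h']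
  refine ⟨hinv.toPerm, hθ, fun B => ⟨fun h => ?_, fun h => ?_, fun h h' => ?_⟩⟩
  · rw [← hA.posRoots_of_isFlip hr (hF B θ h) h2]
    exact congrArg posRoots (if_pos h)
  · have h' : θ ∉ simpleRoots B := fun h' => hexcl B h' h
    have := hA.posRoots_of_isFlip hr' (hF B _ h) h2'
    rw [neg_neg] at this
    rw [← this]
    exact congrArg posRoots ((if_neg h').trans (if_pos h))
  · exact (if_neg h).trans (if_neg h')

theorem exists_isSuperReflection (hA : A.IsReflective) {θ : A.I → ℤ} (hθ : θ ∈ A.roots) :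
    ∃ r, A.IsSuperReflection θ r := by
  by_cases h : θ ∈ A.oddRootsBar
  · obtain ⟨r, hr⟩ := hA.exists_isOddReflection h
    exact ⟨r, .inr hr⟩
  · obtain ⟨s, hs⟩ := hA.exists_reflection θ ⟨hθ, h⟩
    obtain ⟨r, hr⟩ := hs.exists_perm
    exact ⟨r, .inl ⟨⟨hθ, h⟩, s, hs, hr⟩⟩

/-- Both kinds of reflection have the same effect at a simple root, so the counting argument need
not tell them apart. -/
theorem isFlip_of_isSuperReflection (hA : A.IsReflective) {B : A.Borel} {θ : A.I → ℤ}
    (hθ : θ ∈ simpleRoots B) {r} (hr : A.IsSuperReflection θ r) : IsFlip B (r B) θ := by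
  rcases hr with ⟨-, s, hs, h⟩ | ⟨h1, h⟩
  · exact hA.isFlip_of_isRootReflection hθ hs (h B)
  · exact hA.isFlip_of_posRoots_eq ((h B).1 hθ) (hA.two_nsmul_notMem h1)

/-! ### The path from `B` to the opposite Borel subalgebra -/

/-- Defined by the negated functional; negation carries decompositions of positive roots to
decompositions of negative ones. -/
theorem exists_opposite (hA : A.IsReflective) (B : A.Borel) : ∃ B' : A.Borel,
    posRoots B' = (fun α => -α) '' posRoots B ∧ simpleRoots B' = (fun α => -α) '' simpleRoots B := by
  obtain ⟨f, hf0, hf⟩ := exists_functional B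
  obtain ⟨B', hB'⟩ := exists_borel_of_functional (A := A) (-f) fun α hα => neg_ne_zero.2 (hf0 α hα)
  have h : ∀ α, α ∈ posRoots B' ↔ -α ∈ posRoots B := by
    intro α
    rw [hB', hf, hA.neg_mem_iff, map_neg, AddMonoidHom.neg_apply]
  refine ⟨B', Set.ext fun α => ?_, Set.ext fun α => ?_⟩
  · simp [h]
  · simp only [Set.image_neg_eq_neg, Set.mem_neg, simpleRoots, h]
    refine and_congr Iff.rfl (not_congr ⟨?_, ?_⟩)
    · rintro ⟨β, hβ, γ, hγ, rfl⟩
      exact ⟨_, hβ, _, hγ, by abel⟩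
    · rintro ⟨β, hβ, γ, hγ, h⟩
      exact ⟨-β, by simpa using hβ, -γ, by simpa using hγ, by rw [← neg_add, h, neg_neg]⟩

end IsReflective

/-- The roots that are positive for both `B` and `B'` and are not the doubles of roots. -/
def commonPrimitive (B B' : A.Borel) : Set (A.I → ℤ) :=
  {α | α ∈ posRoots B ∧ α ∈ posRoots B' ∧ ∀ β ∈ A.roots, 2 • β ≠ α}

/-- A positive double 2β splits as β + β with β positive, so it is not simple. Hence every simple
root of `B'` that is positive for `B` enters the count of `commonPrimitive`. -/
theorem ne_two_nsmul_of_mem_simpleRoots [Infinite k] {B : A.Borel} {θ : A.I → ℤ}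
    (hθ : θ ∈ simpleRoots B) : ∀ β ∈ A.roots, 2 • β ≠ θ := by
  rintro β hβ rfl
  have := mem_posRoots_of_two_nsmul_mem hβ hθ.1
  exact hθ.2 ⟨β, this, β, this, (two_nsmul β).symm⟩

theorem finite_commonPrimitive [Infinite k] (B B' : A.Borel) : (commonPrimitive B B').Finite :=
  (finite_posRoots B).subset fun _ h => h.1

namespace IsReflective

variable [Infinite k]

/-- A flip at θ removes only θ and 2θ from the positive roots, and 2θ is not primitive. -/
theorem ncard_commonPrimitive_le (B : A.Borel) {B' B'' : A.Borel}
    {θ : A.I → ℤ} (hθ : θ ∈ A.roots) (h : IsFlip B' B'' θ) :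
    (commonPrimitive B B').ncard ≤ (commonPrimitive B B'').ncard + 1 := by
  refine le_trans (Set.ncard_le_ncard (t := insert θ (commonPrimitive B B'')) ?_
    ((finite_commonPrimitive B B'').insert θ)) (Set.ncard_insert_le _ _)
  rintro α ⟨h1, h2, h3⟩
  by_cases hα : α = θ
  · exact .inl hα
  · exact .inr ⟨h1, (h α h1.1).2 (.inl ⟨h2, hα, (h3 θ hθ).symm⟩), h3⟩

/-- Here θ is really lost, and nothing is gained in exchange: -θ is negative for `B`, and -2θ is the
double of the root -θ. -/
theorem ncard_commonPrimitive_flip (hA : A.IsReflective) {B B' B'' : A.Borel} {θ : A.I → ℤ}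
    (hθ : θ ∈ simpleRoots B') (hθB : θ ∈ posRoots B) (h : IsFlip B' B'' θ) :
    (commonPrimitive B B'').ncard + 1 = (commonPrimitive B B').ncard := by
  have e : commonPrimitive B B' = insert θ (commonPrimitive B B'') := by
    ext α
    constructor
    · rintro ⟨h1, h2, h3⟩
      by_cases hα : α = θ
      · exact .inl hα
      · exact .inr ⟨h1, (h α h1.1).2 (.inl ⟨h2, hα, (h3 θ hθB.1).symm⟩), h3⟩
    · rintro (rfl | ⟨h1, h2, h3⟩)
      · exact ⟨hθB, hθ.1, ne_two_nsmul_of_mem_simpleRoots hθ⟩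
      · rcases (h α h1.1).1 h2 with h4 | rfl | rfl
        · exact ⟨h1, h4.1, h3⟩
        · exact absurd h1 (neg_notMem_posRoots hθB)
        · exact absurd (smul_neg 2 θ) (h3 _ (hA.neg_mem θ hθB.1))
  have h1 : θ ∉ commonPrimitive B B'' := by
    rintro ⟨-, h2, -⟩
    have h0 := ne_zero_of_mem_roots hθB.1
    rcases (h θ hθB.1).1 h2 with h4 | h4 | h4
    · exact h4.2.1 rfl
    · exact neg_notMem_posRoots hθB (h4 ▸ hθB)
    -- The remaining possibility θ = -2θ would make θ a torsion element of the weight lattice.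
    · have h5 : (3 : ℕ) • θ = 0 := by
        rw [show (3 : ℕ) = 1 + 2 from rfl, add_nsmul, one_nsmul]
        nth_rewrite 1 [h4]
        simp
      exact h0 ((smul_eq_zero.1 h5).resolve_left (by norm_num))
  rw [e, Set.ncard_insert_of_notMem h1 (finite_commonPrimitive B B'')]

/-- If all simple roots of `B'` were negative for `B`, so would be all its positive roots, which are
sums of simple ones, and no root would be positive for both. -/
theorem exists_simple_common (hA : A.IsReflective) {B B' : A.Borel}
    (h : (commonPrimitive B B').ncard ≠ 0) : ∃ θ ∈ simpleRoots B', θ ∈ posRoots B := by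
  by_contra! hn
  obtain ⟨Bo, hBo, -⟩ := hA.exists_opposite B
  have hsub : simpleRoots B' ⊆ posRoots Bo := by
    intro θ hθ
    rw [hBo]
    exact ⟨-θ, hA.neg_mem_posRoots hθ.1.1 (hn θ hθ), neg_neg θ⟩
  have hsub' := posRoots_subset_of_simpleRoots_subset hsub
  refine h ?_
  convert Set.ncard_empty (A.I → ℤ)
  rw [Set.eq_empty_iff_forall_notMem]
  rintro α ⟨h1, h2, -⟩
  have h3 := hsub' h2
  rw [hBo] at h3
  obtain ⟨β, hβ, rfl⟩ := h3
  exact neg_notMem_posRoots hβ h1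

/-- Simple roots are primitive. If the count is 0, those of `B'` are all negative for `B`, so `B'`
has its positive roots in the opposite system, and an inclusion of positive systems is an equality.
-/
theorem eq_opposite_of_ncard_eq_zero (hA : A.IsReflective) {B B' Bo : A.Borel}
    (hBo : posRoots Bo = (fun α => -α) '' posRoots B) (h : (commonPrimitive B B').ncard = 0) :
    B' = Bo := by
  rw [Set.ncard_eq_zero (finite_commonPrimitive B B')] at h
  refine hA.posRoots_eq_of_subset (posRoots_subset_of_simpleRoots_subset fun θ hθ => ?_)
  rw [hBo]
  refine ⟨-θ, hA.neg_mem_posRoots hθ.1.1 fun hB => ?_, neg_neg θ⟩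
  have : θ ∈ commonPrimitive B B' := ⟨hB, hθ.1, ne_two_nsmul_of_mem_simpleRoots hθ⟩
  rw [h] at this
  exact this

theorem ncard_commonPrimitive_opposite {B Bo : A.Borel}
    (hBo : posRoots Bo = (fun α => -α) '' posRoots B) : (commonPrimitive B Bo).ncard = 0 := by
  rw [Set.ncard_eq_zero (finite_commonPrimitive B Bo), Set.eq_empty_iff_forall_notMem]
  rintro α ⟨h1, h2, -⟩
  rw [hBo] at h2
  obtain ⟨β, hβ, rfl⟩ := h2
  exact neg_notMem_posRoots hβ h1

/-- Every standard expression from `Π` to `-Π` has at least as many factors as there are primitive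
positive roots. -/
theorem ncard_le_of_isStandardExpression (hA : A.IsReflective) {B : A.Borel} {m : ℕ}
    {θ : ℕ → A.I → ℤ} {r : ℕ → Equiv.Perm A.Borel}
    (h : IsStandardExpression B ((fun α => -α) '' simpleRoots B) m θ r) :
    (commonPrimitive B B).ncard ≤ m := by
  obtain ⟨Bo, hBo, hBo'⟩ := hA.exists_opposite B
  -- Each factor lowers the count by at most 1, and over the whole expression it has to fall to 0.
  have key : ∀ i ≤ m, (commonPrimitive B B).ncard ≤
      (commonPrimitive B (partialProd r i B)).ncard + i := by
    intro i
    induction i with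
    | zero => intro _; exact le_rfl
    | succ i ih =>
      intro hi
      obtain ⟨h1, h2⟩ := h.1 i hi
      have h3 := hA.isFlip_of_isSuperReflection h2 h1
      have := IsReflective.ncard_commonPrimitive_le B h2.1.1 h3
      have := ih (by omega)
      change _ ≤ (commonPrimitive B (r i (partialProd r i B))).ncard + (i + 1)
      omega
  -- A Borel subalgebra is determined by its simple roots, because these generate the positive
  -- roots.
  have hend : partialProd r m B = Bo := by
    refine hA.posRoots_eq_of_subset (posRoots_subset_of_simpleRoots_subset ?_)
    rw [h.2, hBo]
    exact Set.image_mono fun _ h => h.1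
  have := key m le_rfl
  rwa [hend, IsReflective.ncard_commonPrimitive_opposite hBo, zero_add] at this

/-- The greedy walk: reflect in any simple root of the current Borel subalgebra that is still
positive for `B`. The count drops by exactly 1 each time, so the walk can go on for as many steps as
the initial count. -/
theorem exists_path (hA : A.IsReflective) (B : A.Borel) :
    ∃ (θ : ℕ → A.I → ℤ) (r : ℕ → Equiv.Perm A.Borel), ∀ i < (commonPrimitive B B).ncard,
      A.IsSuperReflection (θ i) (r i) ∧ θ i ∈ simpleRoots (partialProd r i B) ∧ θ i ∈ posRoots B ∧
      (commonPrimitive B (partialProd r (i + 1) B)).ncard + (i + 1) = (commonPrimitive B B).ncard := by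
  have step : ∀ B' : A.Borel, ∃ (θ : A.I → ℤ) (r : Equiv.Perm A.Borel),
      (commonPrimitive B B').ncard ≠ 0 →
        θ ∈ simpleRoots B' ∧ θ ∈ posRoots B ∧ A.IsSuperReflection θ r := by
    intro B'
    by_cases h : (commonPrimitive B B').ncard = 0
    · exact ⟨0, 1, fun h' => absurd h h'⟩
    · obtain ⟨θ, h1, h2⟩ := hA.exists_simple_common h
      obtain ⟨r, hr⟩ := hA.exists_isSuperReflection h2.1
      exact ⟨θ, r, fun _ => ⟨h1, h2, hr⟩⟩
  choose t ρ hρ using step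
  -- `b i` is the Borel subalgebra after `i` steps. Each reflection depends on it, so it is built
  -- first and then identified with the action of the partial products.
  let b : ℕ → A.Borel := fun i => Nat.rec B (fun _ B' => ρ B' B') i
  have hb : ∀ i, partialProd (fun i => ρ (b i)) i B = b i := by
    intro i
    induction i with
    | zero => rfl
    | succ i ih =>
      change ρ (b i) (partialProd (fun i => ρ (b i)) i B) = ρ (b i) (b i)
      rw [ih]
  have hcard : ∀ i ≤ (commonPrimitive B B).ncard,
      (commonPrimitive B (b i)).ncard + i = (commonPrimitive B B).ncard := by
    intro i
    induction i with
    | zero => intro _; rfl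
    | succ i ih =>
      intro hi
      have h1 := ih (by omega)
      obtain ⟨h2, h3, h4⟩ := hρ (b i) (by omega)
      have h5 := hA.ncard_commonPrimitive_flip h2 h3 (hA.isFlip_of_isSuperReflection h2 h4)
      change (commonPrimitive B (ρ (b i) (b i))).ncard + (i + 1) = _
      omega
  refine ⟨fun i => t (b i), fun i => ρ (b i), fun i hi => ?_⟩
  have h1 := hcard i hi.le
  obtain ⟨h2, h3, h4⟩ := hρ (b i) (by omega)
  rw [hb, hb]
  exact ⟨h4, h2, h3, hcard (i + 1) hi⟩

/-! ### The effect of each factor, and the number of factors. -/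

theorem posRoots_flip_of_evenRootsBar (hA : A.IsReflective) {B B' : A.Borel} {θ : A.I → ℤ}
    (h : IsFlip B B' θ) (hθ : θ ∈ A.evenRootsBar) : posRoots B' = posRoots B \ {θ} ∪ {-θ} :=
  -- A root whose double is a root is odd, so 2θ is not a root for even θ.
  hA.posRoots_of_isFlip (.inl hθ.1) h fun h2 =>
    hA.disjoint θ hθ.1 (hA.two_nsmul_mem (.inl hθ.1) h2).1

theorem posRoots_flip_of_nonisotropic (hA : A.IsReflective) {B B' : A.Borel} {θ : A.I → ℤ}
    (h : IsFlip B B' θ) (hθ : θ ∈ A.oddRoots \ A.oddRootsBar) :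
    posRoots B' = posRoots B \ {2 • θ, θ} ∪ {-(2 • θ), -θ} := by
  have hr : θ ∈ A.roots := .inr hθ.1
  have h2 : 2 • θ ∈ A.roots := .inl (by
    by_contra hn
    exact hθ.2 ⟨hθ.1, hn⟩)
  have h3 := hA.neg_mem θ hr
  have h4 := hA.neg_mem _ h2
  ext α
  simp only [Set.mem_union, Set.mem_sdiff, Set.mem_singleton_iff, Set.mem_insert_iff]
  by_cases hr : α ∈ A.roots
  · rw [h α hr]
    grind
  · have : α ∉ posRoots B := fun h => hr h.1
    have : α ∉ posRoots B' := fun h => hr h.1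
    grind

/-- The positive roots that are not primitive are exactly the doubles of the positive non-isotropic
odd roots, and doubling is injective. -/
theorem ncard_commonPrimitive_self (hA : A.IsReflective) (B : A.Borel) :
    (commonPrimitive B B).ncard + (posRoots B ∩ (A.oddRoots \ A.oddRootsBar)).ncard =
      (posRoots B).ncard := by
  have hinj : Function.Injective fun β : A.I → ℤ => 2 • β := fun a b h =>
    smul_right_injective _ (two_ne_zero : (2 : ℕ) ≠ 0) h
  rw [← Set.ncard_image_of_injective (posRoots B ∩ _) hinj, ← Set.ncard_union_eq ?_ (finite_commonPrimitive B B)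
    (((finite_posRoots B).subset Set.inter_subset_left).image _)]
  · congr 1
    ext α
    constructor
    · rintro (h | ⟨β, ⟨h1, h2, h3⟩, rfl⟩)
      · exact h.1
      · have : 2 • β ∈ A.evenRoots := by
          by_contra hn
          exact h3 ⟨h2, hn⟩
        change 2 • β ∈ _
        rw [two_nsmul] at this ⊢
        exact add_mem_posRoots h1 h1 (.inl this)
    · intro hα
      by_cases h : ∀ β ∈ A.roots, 2 • β ≠ α
      · exact .inl ⟨hα, hα, h⟩
      · push Not at h
        obtain ⟨β, hβ, rfl⟩ := h
        obtain ⟨h1, h2⟩ := hA.two_nsmul_mem hβ hα.1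
        exact .inr ⟨β, ⟨mem_posRoots_of_two_nsmul_mem hβ hα, h1, fun h => h.2 h2⟩, rfl⟩
  · rw [Set.disjoint_left]
    rintro _ h ⟨β, hβ, rfl⟩
    exact h.2.2 β hβ.1.1 rfl

/-- The longest element of the super Weyl groupoid. -/
theorem exists_longest (hA : A.IsReflective) (B : A.Borel) :
    ∃ (w₀ : Equiv.Perm A.Borel) (N : ℕ) (θ : ℕ → A.I → ℤ) (r : ℕ → Equiv.Perm A.Borel),
      w₀ ∈ A.superWeylGroup ∧ IsDistinguished B w₀ ∧ w₀ = partialProd r N ∧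
      IsStandardReduced B ((fun α => -α) '' simpleRoots B) N θ r ∧
      (∀ i < N, A.IsSuperReflection (θ i) (r i) ∧ θ i ∈ posRoots B) ∧
      (∀ i < N, θ i ∈ simpleRoots (partialProd r i B)) ∧
      (simpleRoots (w₀ B) = (fun α => -α) '' simpleRoots B ∧
        posRoots (w₀ B) = (fun α => -α) '' posRoots B) ∧
      (∀ i < N,
        (θ i ∈ posRoots (partialProd r i B) ∩ A.evenRootsBar →
          posRoots (partialProd r (i + 1) B) =
            posRoots (partialProd r i B) \ {θ i} ∪ {-θ i}) ∧
        (θ i ∈ posRoots (partialProd r i B) ∩ A.oddRootsBar →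
          posRoots (partialProd r (i + 1) B) =
            posRoots (partialProd r i B) \ {θ i} ∪ {-θ i}) ∧
        (θ i ∈ posRoots (partialProd r i B) ∩ (A.oddRoots \ A.oddRootsBar) →
          posRoots (partialProd r (i + 1) B) =
            posRoots (partialProd r i B) \ {2 • θ i, θ i} ∪ {-(2 • θ i), -θ i})) ∧
      N + (posRoots B ∩ (A.oddRoots \ A.oddRootsBar)).ncard = (posRoots B).ncard ∧
      posRoots B = {α | ∃ i < N, α = θ i} ∪
        {α | ∃ i < N, θ i ∈ posRoots B ∩ posRoots (partialProd r i B) ∩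
          (A.oddRoots \ A.oddRootsBar) ∧ α = 2 • θ i} := by
  obtain ⟨θ, r, h⟩ := hA.exists_path B
  obtain ⟨Bo, hBo, hBo'⟩ := hA.exists_opposite B
  set N := (commonPrimitive B B).ncard with hN
  have hflip : ∀ i < N, IsFlip (partialProd r i B) (partialProd r (i + 1) B) (θ i) := fun i hi =>
    hA.isFlip_of_isSuperReflection (h i hi).2.1 (h i hi).1
  have hend : partialProd r N B = Bo := by
    refine hA.eq_opposite_of_ncard_eq_zero hBo ?_
    -- The path records the count only after a step, so a path without steps is treated separately.
    rcases Nat.eq_zero_or_pos N with h0 | h0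
    · rw [h0]; exact hN.symm.trans h0
    · have := (h (N - 1) (by omega)).2.2.2
      rw [Nat.sub_add_cancel h0] at this
      omega
  have hred : IsStandardReduced B ((fun α => -α) '' simpleRoots B) N θ r :=
    ⟨⟨fun i hi => ⟨(h i hi).1, (h i hi).2.1⟩, by rw [hend, hBo']⟩,
      fun m _ _ hm => hA.ncard_le_of_isStandardExpression hm⟩
  have hmem : partialProd r N ∈ A.superWeylGroup := by
    have : ∀ i ≤ N, partialProd r i ∈ A.superWeylGroup := by
      intro i
      induction i with
      | zero => intro _; exact one_mem _
      | succ i ih =>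
        intro hi
        exact mul_mem (Subgroup.subset_closure ⟨_, (h i hi).1⟩) (ih (by omega))
    exact this N le_rfl
  refine ⟨partialProd r N, N, θ, r, hmem, ⟨hmem, N, θ, r, hred, rfl⟩, rfl, hred,
    fun i hi => ⟨(h i hi).1, (h i hi).2.2.1⟩, fun i hi => (h i hi).2.1,
    by rw [hend]; exact ⟨hBo', hBo⟩, fun i hi => ⟨fun h1 => ?_, fun h1 => ?_, fun h1 => ?_⟩,
    hA.ncard_commonPrimitive_self B, ?_⟩
  · exact hA.posRoots_flip_of_evenRootsBar (hflip i hi) h1.2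
  · exact hA.posRoots_of_isFlip (.inr h1.2.1) (hflip i hi) (hA.two_nsmul_notMem h1.2)
  · exact hA.posRoots_flip_of_nonisotropic (hflip i hi) h1.2
  · ext α
    constructor
    · intro hα
      -- A positive root of `B` is negative at the end of the path, so it leaves the positive system
      -- at some step `i`; a flip at `θ i` removes only `θ i` and `2 • θ i`.
      obtain ⟨i, hi, h1, h2⟩ : ∃ i < N, α ∈ posRoots (partialProd r i B) ∧
          α ∉ posRoots (partialProd r (i + 1) B) := by
        by_contra! hn
        have : ∀ i ≤ N, α ∈ posRoots (partialProd r i B) := by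
          intro i
          induction i with
          | zero => intro _; exact hα
          | succ i ih => intro hi; exact hn i hi (ih (by omega))
        have := this N le_rfl
        rw [hend, hBo] at this
        obtain ⟨β, hβ, rfl⟩ := this
        exact neg_notMem_posRoots hβ hα
      rw [hflip i hi α hα.1] at h2
      have h3 : α = θ i ∨ α = 2 • θ i := by
        by_contra! h3
        exact h2 (.inl ⟨h1, h3⟩)
      rcases h3 with rfl | rfl
      · exact .inl ⟨i, hi, rfl⟩
      · obtain ⟨h4, h5⟩ := hA.two_nsmul_mem (h i hi).2.2.1.1 hα.1
        exact .inr ⟨i, hi, ⟨⟨(h i hi).2.2.1, (h i hi).2.1.1⟩, h4, fun h => h.2 h5⟩, rfl⟩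
    · rintro (⟨i, hi, rfl⟩ | ⟨i, hi, ⟨⟨h1, -⟩, h2, h3⟩, rfl⟩)
      · exact (h i hi).2.2.1
      · have : 2 • θ i ∈ A.evenRoots := by
          by_contra hn
          exact h3 ⟨h2, hn⟩
        rw [two_nsmul] at this ⊢
        exact add_mem_posRoots h1 h1 (.inl this)

end IsReflective

end ToralLieSuperalgebra
/-- The property `IsReflective` of a root system, in terms of its even roots `R₀` and odd roots `R₁`. -/
structure ReflectiveRoots {I : Type} (R₀ R₁ : Set (I → ℤ)) : Prop where
  neg_mem : ∀ α ∈ R₀ ∪ R₁, -α ∈ R₀ ∪ R₁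
  exists_pairing : ∀ θ ∈ R₀ ∪ R₁, ∃ l : (I → ℤ) →+ ℤ, 0 < l θ ∧
    ∀ β ∈ R₀ ∪ R₁, β ≠ θ → 0 < l β → β - θ ∈ R₀ ∪ R₁
  exists_reflection : ∀ θ ∈ R₀ ∪ R₁, (θ ∈ R₁ → 2 • θ ∈ R₀) → ∃ s : (I → ℤ) →+ (I → ℤ),
    s θ = -θ ∧ ∀ α ∈ R₀ ∪ R₁, s α ∈ R₀ ∪ R₁ ∧ ∃ n : ℤ, s α = α + n • θ
  eq_of_nsmul_mem : ∀ θ ∈ R₀ ∪ R₁, ∀ n : ℕ, n • θ ∈ R₀ ∪ R₁ → n = 1 ∨ n = 2 ∧ θ ∈ R₁ ∧ 2 • θ ∈ R₀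
  disjoint : ∀ α ∈ R₀, α ∉ R₁

/-- For a root, to be non-isotropic means that if it is odd, then its double is even; this is the
form of the condition in `ReflectiveRoots`. -/
theorem ReflectiveRoots.isReflective {k : Type*} [Field k] {A : ToralLieSuperalgebra k}
    (h : ReflectiveRoots A.evenRoots A.oddRoots) : A.IsReflective where
  neg_mem := h.neg_mem
  exists_pairing := h.exists_pairing
  exists_reflection θ hθ := h.exists_reflection θ hθ.1 fun h1 => by
    by_contra hn
    exact hθ.2 ⟨h1, hn⟩
  eq_of_nsmul_mem := h.eq_of_nsmul_mem
  disjoint := h.disjoint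

/-! ### The roots of `𝔤𝔩(m|n)` and `𝔰𝔩(m|n)` -/

section TypeA

variable {J : Type} [DecidableEq J]

/-- The differences of basis vectors of the same parity. -/
def evenRootsA (J : Type) [DecidableEq J] (c : J → Bool) : Set (J → ℤ) :=
  {x | ∃ i j, i ≠ j ∧ c i = c j ∧ x = Pi.single i 1 - Pi.single j 1}

/-- The differences of basis vectors of opposite parity. -/
def oddRootsA (J : Type) [DecidableEq J] (c : J → Bool) : Set (J → ℤ) :=
  {x | ∃ i j, i ≠ j ∧ c i ≠ c j ∧ x = Pi.single i 1 - Pi.single j 1}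

theorem mem_rootsA {c : J → Bool} {x : J → ℤ} : x ∈ evenRootsA J c ∪ oddRootsA J c ↔
    ∃ i j, i ≠ j ∧ x = Pi.single i 1 - Pi.single j 1 := by
  constructor
  · rintro (⟨i, j, h, -, rfl⟩ | ⟨i, j, h, -, rfl⟩) <;> exact ⟨i, j, h, rfl⟩
  · rintro ⟨i, j, h, rfl⟩
    by_cases hc : c i = c j
    · exact .inl ⟨i, j, h, hc, rfl⟩
    · exact .inr ⟨i, j, h, hc, rfl⟩

theorem single_sub_single_inj {i j a b : J} (h : i ≠ j)
    (e : (Pi.single i 1 - Pi.single j 1 : J → ℤ) = Pi.single a 1 - Pi.single b 1) :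
    i = a ∧ j = b := by
  have h1 := congrFun e i
  have h2 := congrFun e j
  simp only [Pi.sub_apply, Pi.single_apply] at h1 h2
  constructor
  · by_contra hn
    split_ifs at h1 <;> grind
  · by_contra hn
    split_ifs at h2 <;> grind

/-- Apart from disjointness, parity plays no role: the union is the root system of type A on all of
`J`. The pairing is the dot product with `e_i - e_j`, and the reflection exchanges the coordinates
`i` and `j`. -/
theorem reflectiveRootsA (c : J → Bool) : ReflectiveRoots (evenRootsA J c) (oddRootsA J c) where
  neg_mem α hα := by
    rw [mem_rootsA] at hα ⊢
    obtain ⟨i, j, h, rfl⟩ := hα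
    exact ⟨j, i, h.symm, neg_sub _ _⟩
  exists_pairing θ hθ := by
    rw [mem_rootsA] at hθ
    obtain ⟨i, j, h, rfl⟩ := hθ
    refine ⟨Pi.evalAddMonoidHom (fun _ => ℤ) i - Pi.evalAddMonoidHom (fun _ => ℤ) j,
      by simp [h, h.symm], ?_⟩
    intro β hβ hne hl
    rw [mem_rootsA] at hβ ⊢
    obtain ⟨a, b, hab, rfl⟩ := hβ
    simp only [AddMonoidHom.sub_apply, Pi.evalAddMonoidHom_apply, Pi.sub_apply, Pi.single_apply] at hl
    -- A positive pairing forces the two roots to share the positive or the negative basis vector,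
    -- which cancels in the difference.
    have h1 : i = a ∨ j = b := by
      by_contra! hn
      rw [if_neg hn.1, if_neg hn.2] at hl
      split_ifs at hl <;> omega
    rcases h1 with rfl | rfl
    · exact ⟨j, b, fun e => hne (by rw [e]), by abel⟩
    · exact ⟨a, i, fun e => hne (by rw [e]), by abel⟩
  exists_reflection θ hθ _ := by
    rw [mem_rootsA] at hθ
    obtain ⟨i, j, h, rfl⟩ := hθ
    let s : (J → ℤ) →+ (J → ℤ) :=
      { toFun := fun x => x ∘ Equiv.swap i j, map_zero' := rfl, map_add' := fun _ _ => rfl }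
    have hs : ∀ a, s (Pi.single a 1) = Pi.single (Equiv.swap i j a) 1 := by
      intro a
      funext b
      simp only [s, AddMonoidHom.coe_mk, ZeroHom.coe_mk, Function.comp_apply, Pi.single_apply,
        Equiv.swap_apply_eq_iff]
    have hn : ∀ x, s x = x + (x j - x i) • (Pi.single i 1 - Pi.single j 1) := by
      intro x
      funext b
      simp only [s, AddMonoidHom.coe_mk, ZeroHom.coe_mk, Function.comp_apply, Pi.add_apply,
        Pi.smul_apply, Pi.sub_apply, smul_eq_mul, Pi.single_apply, Equiv.swap_apply_def]
      split_ifs <;> grind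
    refine ⟨s, by rw [map_sub, hs, hs]; simp, fun α hα => ⟨?_, _, hn α⟩⟩
    rw [mem_rootsA] at hα ⊢
    obtain ⟨a, b, hab, rfl⟩ := hα
    exact ⟨_, _, (Equiv.swap i j).injective.ne hab, by rw [map_sub, hs, hs]⟩
  eq_of_nsmul_mem θ hθ n hn := by
    left
    rw [mem_rootsA] at hθ hn
    obtain ⟨i, j, h, rfl⟩ := hθ
    obtain ⟨a, b, hab, e⟩ := hn
    -- At `i` the equation bounds `n` by 1; at `a` it excludes `n = 0`.
    have h1 := congrFun e i
    have h2 := congrFun e a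
    simp only [Pi.sub_apply, Pi.smul_apply, Pi.single_apply, nsmul_eq_mul, if_neg h, if_true,
      if_neg hab] at h1 h2
    have hn0 : n ≠ 0 := by
      rintro rfl
      simp at h2
    split_ifs at h1 <;> grind
  disjoint := by
    rintro _ ⟨i, j, h, hc, rfl⟩ ⟨a, b, hab, hc', e⟩
    obtain ⟨rfl, rfl⟩ := single_sub_single_inj h e
    exact hc' hc

end TypeA

/-! ### Matrix units as root vectors of gl and sl. -/

section

variable {k : Type*} [Field k] {α β : Type} [Fintype α] [DecidableEq α] [Fintype β] [DecidableEq β]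

theorem isEvenMat_iff {x : Matrix (α ⊕ β) (α ⊕ β) k} :
    IsEvenMat x ↔ ∀ i j, x i j ≠ 0 → i.isLeft = j.isLeft := by
  constructor
  · rintro ⟨h1, h2⟩ (i | i) (j | j) h
    · rfl
    · exact absurd (h1 i j) h
    · exact absurd (h2 i j) h
    · rfl
  · intro h
    exact ⟨fun i j => by_contra fun hn => by simpa using h _ _ hn,
      fun i j => by_contra fun hn => by simpa using h _ _ hn⟩

theorem isOddMat_iff {x : Matrix (α ⊕ β) (α ⊕ β) k} :
    IsOddMat x ↔ ∀ i j, x i j ≠ 0 → i.isLeft ≠ j.isLeft := by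
  constructor
  · rintro ⟨h1, h2⟩ (i | i) (j | j) h
    · exact absurd (h1 i j) h
    · simp
    · simp
    · exact absurd (h2 i j) h
  · intro h
    exact ⟨fun i j => by_contra fun hn => by simpa using h _ _ hn,
      fun i j => by_contra fun hn => by simpa using h _ _ hn⟩

theorem exists_entry_ne_zero {ι κ : Type} {x : Matrix ι κ k} (h : x ≠ 0) : ∃ i j, x i j ≠ 0 := by
  by_contra! hn
  exact h (Matrix.ext hn)

theorem single_one_ne_zero {ι : Type} [DecidableEq ι] {i j a b : ι}
    (h : Matrix.single i j (1 : k) a b ≠ 0) : i = a ∧ j = b := by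
  rw [Matrix.single_apply] at h
  exact by_contra fun hn => h (if_neg hn)

theorem single_one_isEvenMat {i j : α ⊕ β} (h : i.isLeft = j.isLeft) :
    IsEvenMat (Matrix.single i j (1 : k)) := isEvenMat_iff.2 fun a b hab => by
  obtain ⟨rfl, rfl⟩ := single_one_ne_zero hab
  exact h

theorem single_one_isOddMat {i j : α ⊕ β} (h : i.isLeft ≠ j.isLeft) :
    IsOddMat (Matrix.single i j (1 : k)) := isOddMat_iff.2 fun a b hab => by
  obtain ⟨rfl, rfl⟩ := single_one_ne_zero hab
  exact h

theorem matrix_single_one_ne_zero {ι : Type} [DecidableEq ι] (i j : ι) :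
    Matrix.single i j (1 : k) ≠ 0 := fun h => by
  have := congrFun (congrFun h i) j
  simp at this

theorem eq_single_sub_single_of_ne_zero {ι : Type} [DecidableEq ι] {x : Matrix ι ι k} (hx : x ≠ 0)
    {lam : ι → ℤ} (h0 : lam ≠ 0)
    (h : ∀ i j, x i j ≠ 0 → (Pi.single i 1 - Pi.single j 1 : ι → ℤ) = lam) :
    ∃ i j, i ≠ j ∧ x i j ≠ 0 ∧ lam = Pi.single i 1 - Pi.single j 1 := by
  obtain ⟨i, j, hij⟩ := exists_entry_ne_zero hx
  have := h i j hij
  exact ⟨i, j, fun e => h0 (by rw [← this, e, sub_self]), hij, this.symm⟩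

theorem single_entry_weight {ι : Type} [DecidableEq ι] {i j : ι} (a b : ι)
    (h : Matrix.single i j (1 : k) a b ≠ 0) :
    (Pi.single a 1 - Pi.single b 1 : ι → ℤ) = Pi.single i 1 - Pi.single j 1 := by
  obtain ⟨rfl, rfl⟩ := single_one_ne_zero h
  rfl

theorem single_sub_single_ne_zero {ι : Type} [DecidableEq ι] {i j : ι} (h : i ≠ j) :
    (Pi.single i 1 - Pi.single j 1 : ι → ℤ) ≠ 0 := fun e => by
  have := congrFun e i
  simp [h] at this

variable [Infinite k] (m n : ℕ)

theorem gl_evenRoots : (gl k m n).evenRoots = evenRootsA (Fin m ⊕ Fin n) Sum.isLeft := by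
  ext lam
  rw [ToralLieSuperalgebra.mem_evenRoots_iff]
  constructor
  · rintro ⟨h0, x, hx, hne, h⟩
    obtain ⟨i, j, hij, hxij, e⟩ := eq_single_sub_single_of_ne_zero hne h0 h
    exact ⟨i, j, hij, isEvenMat_iff.1 hx i j hxij, e⟩
  · rintro ⟨i, j, hij, hc, rfl⟩
    exact ⟨single_sub_single_ne_zero hij, Matrix.single i j 1, single_one_isEvenMat hc,
      matrix_single_one_ne_zero i j, single_entry_weight⟩

theorem gl_oddRoots : (gl k m n).oddRoots = oddRootsA (Fin m ⊕ Fin n) Sum.isLeft := by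
  ext lam
  rw [ToralLieSuperalgebra.mem_oddRoots_iff]
  constructor
  · rintro ⟨h0, x, hx, hne, h⟩
    obtain ⟨i, j, hij, hxij, e⟩ := eq_single_sub_single_of_ne_zero hne h0 h
    exact ⟨i, j, hij, isOddMat_iff.1 hx i j hxij, e⟩
  · rintro ⟨i, j, hij, hc, rfl⟩
    exact ⟨single_sub_single_ne_zero hij, Matrix.single i j 1, single_one_isOddMat hc,
      matrix_single_one_ne_zero i j, single_entry_weight⟩

theorem sl_evenRoots : (sl k m n).evenRoots = evenRootsA (Fin m ⊕ Fin n) Sum.isLeft := by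
  ext lam
  rw [ToralLieSuperalgebra.mem_evenRoots_iff]
  constructor
  · rintro ⟨h0, x, hx, hne, h⟩
    obtain ⟨i, j, hij, hxij, e⟩ := eq_single_sub_single_of_ne_zero hne h0 h
    exact ⟨i, j, hij, isEvenMat_iff.1 hx.1 i j hxij, e⟩
  · rintro ⟨i, j, hij, hc, rfl⟩
    -- An off-diagonal matrix unit has supertrace 0, so the root vectors of gl already lie in sl.
    have h : ∀ a, Matrix.single i j (1 : k) a a = 0 := fun a =>
      by_contra fun hn => hij ((single_one_ne_zero hn).1.trans (single_one_ne_zero hn).2.symm)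
    have hs : supertrace (Matrix.single i j (1 : k)) = 0 := by simp only [supertrace, h]; simp
    exact ⟨single_sub_single_ne_zero hij, Matrix.single i j 1, ⟨single_one_isEvenMat hc, hs⟩,
      matrix_single_one_ne_zero i j, single_entry_weight⟩

theorem sl_oddRoots : (sl k m n).oddRoots = oddRootsA (Fin m ⊕ Fin n) Sum.isLeft := by
  ext lam
  rw [ToralLieSuperalgebra.mem_oddRoots_iff]
  constructor
  · rintro ⟨h0, x, hx, hne, h⟩
    obtain ⟨i, j, hij, hxij, e⟩ := eq_single_sub_single_of_ne_zero hne h0 h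
    exact ⟨i, j, hij, isOddMat_iff.1 hx i j hxij, e⟩
  · rintro ⟨i, j, hij, hc, rfl⟩
    exact ⟨single_sub_single_ne_zero hij, Matrix.single i j 1, single_one_isOddMat hc,
      matrix_single_one_ne_zero i j, single_entry_weight⟩

theorem gl_isReflective : (gl k m n).IsReflective := by
  have h := reflectiveRootsA (J := Fin m ⊕ Fin n) Sum.isLeft
  rw [← gl_evenRoots (k := k), ← gl_oddRoots (k := k)] at h
  exact h.isReflective

theorem sl_isReflective : (sl k m n).IsReflective := by
  have h := reflectiveRootsA (J := Fin m ⊕ Fin n) Sum.isLeft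
  rw [← sl_evenRoots (k := k), ← sl_oddRoots (k := k)] at h
  exact h.isReflective

end

/-! ### The roots of `𝔬𝔰𝔭(m|2n)` -/

section TypeBCD

/-- Weights `0` and `± e_i` of an orthosymplectic space: `c a` holds when `a` belongs to the orthogonal
part, and `*` pairs opposite weights. -/
structure SignedWeights {ι J : Type} [Fintype J] (wt : ι → J → ℤ) (c : ι → Bool) (star : ι → ι) :
    Prop where
  color_star : ∀ a, c (star a) = c a
  wt_star : ∀ a, wt (star a) = -wt a
  star_star : ∀ a, star (star a) = a
  dot_le_one : ∀ a b, wt a ⬝ᵥ wt b ≤ 1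
  eq_of_dot_pos : ∀ a b, 0 < wt a ⬝ᵥ wt b → a = b
  eq_of_eq_zero : ∀ a b, wt a = 0 → wt b = 0 → a = b
  color_of_eq_zero : ∀ a, wt a = 0 → c a = true

/-- The roots of the even part. -/
def evenRootsBCD {ι J : Type} (wt : ι → J → ℤ) (c : ι → Bool) : Set (J → ℤ) :=
  {x | x ≠ 0 ∧ ∃ a b, c a = c b ∧ (a = b → c a = false) ∧ x = wt a + wt b}

/-- The roots of the odd part. -/
def oddRootsBCD {ι J : Type} (wt : ι → J → ℤ) (c : ι → Bool) : Set (J → ℤ) :=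
  {x | x ≠ 0 ∧ ∃ a b, c a ≠ c b ∧ x = wt a + wt b}

/-- As a module, the even part is the exterior square of the orthogonal space plus the symmetric
square of the symplectic one, and the odd part is their tensor product. So all nonzero sums of two
weights occur, except the doubles of orthogonal weights. -/
theorem mem_rootsBCD {ι J : Type} {wt : ι → J → ℤ} {c : ι → Bool} {x : J → ℤ} :
    x ∈ evenRootsBCD wt c ∪ oddRootsBCD wt c ↔
      x ≠ 0 ∧ ∃ a b, (a = b → c a = false) ∧ x = wt a + wt b := by
  constructor
  · rintro (⟨h0, a, b, -, h, rfl⟩ | ⟨h0, a, b, h, rfl⟩)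
    · exact ⟨h0, a, b, h, rfl⟩
    · exact ⟨h0, a, b, fun e => absurd (congrArg c e) h, rfl⟩
  · rintro ⟨h0, a, b, h, rfl⟩
    by_cases hc : c a = c b
    · exact .inl ⟨h0, a, b, hc, h, rfl⟩
    · exact .inr ⟨h0, a, b, hc, rfl⟩

namespace SignedWeights

variable {ι J : Type} [Fintype J] {wt : ι → J → ℤ} {c : ι → Bool} {star : ι → ι}

theorem dot_self (h : SignedWeights wt c star) {a : ι} (ha : wt a ≠ 0) : wt a ⬝ᵥ wt a = 1 := by
  have h1 := h.dot_le_one a a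
  have h2 : wt a ⬝ᵥ wt a ≠ 0 := fun e => ha (dotProduct_self_eq_zero.1 e)
  have h3 : 0 ≤ wt a ⬝ᵥ wt a := Finset.sum_nonneg fun i _ => mul_self_nonneg _
  omega

theorem eq_star_of_dot_neg (h : SignedWeights wt c star) {a b : ι} (hab : wt a ⬝ᵥ wt b < 0) : a = star b := by
  refine h.eq_of_dot_pos a (star b) ?_
  rw [h.wt_star, dotProduct_neg]
  omega

theorem wt_injective (h : SignedWeights wt c star) {a b : ι} (hab : wt a = wt b) : a = b := by
  by_cases ha : wt a = 0
  · exact h.eq_of_eq_zero a b ha (hab ▸ ha)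
  · refine h.eq_of_dot_pos a b ?_
    rw [← hab, h.dot_self ha]
    exact one_pos

/-- Weights with nonzero dot product are equal or opposite, and then they have the same parity. -/
theorem dot_eq_zero_of_color_ne (h : SignedWeights wt c star) {a b : ι} (hc : c a ≠ c b) : wt a ⬝ᵥ wt b = 0 := by
  rcases lt_trichotomy (wt a ⬝ᵥ wt b) 0 with h1 | h1 | h1
  · exact absurd (by rw [h.eq_star_of_dot_neg h1, h.color_star]) hc
  · exact h1
  · exact absurd (congrArg c (h.eq_of_dot_pos a b h1)) hc

theorem wt_ne_zero (h : SignedWeights wt c star) {a : ι} (ha : c a = false) : wt a ≠ 0 := fun e => by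
  rw [h.color_of_eq_zero a e] at ha
  exact absurd ha (by decide)

theorem neg_mem (h : SignedWeights wt c star) {α : J → ℤ} (hα : α ∈ evenRootsBCD wt c ∪ oddRootsBCD wt c) :
    -α ∈ evenRootsBCD wt c ∪ oddRootsBCD wt c := by
  rw [mem_rootsBCD] at hα ⊢
  obtain ⟨h0, a, b, hab, rfl⟩ := hα
  refine ⟨neg_ne_zero.2 h0, star a, star b, fun e => ?_, by rw [h.wt_star, h.wt_star, neg_add]⟩
  rw [h.color_star]
  exact hab (by rw [← h.star_star a, e, h.star_star])

/-- If two sums of two weights have positive dot product, some summand of one has positive product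
with a summand of the other, and then these coincide. They cancel, and a difference of two weights
is left, which is again a sum because weights come in opposite pairs. -/
theorem sub_mem (h : SignedWeights wt c star) {θ β : J → ℤ} (hθ : θ ∈ evenRootsBCD wt c ∪ oddRootsBCD wt c)
    (hβ : β ∈ evenRootsBCD wt c ∪ oddRootsBCD wt c) (hne : β ≠ θ) (hpos : 0 < θ ⬝ᵥ β) :
    β - θ ∈ evenRootsBCD wt c ∪ oddRootsBCD wt c := by
  have key : ∀ a b d, wt a + wt d ≠ wt a + wt b → 0 < (wt a + wt b) ⬝ᵥ (wt a + wt d) →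
      wt a + wt d - (wt a + wt b) ∈ evenRootsBCD wt c ∪ oddRootsBCD wt c := by
    intro a b d hne hpos
    rw [mem_rootsBCD]
    refine ⟨sub_ne_zero.2 hne, d, star b, fun e => ?_, by rw [h.wt_star]; abel⟩
    -- With `d = star b` the product is |wt a|² - |wt b|² ≤ 1 - 1, as `wt b ≠ 0`; so the difference
    -- is never a doubled weight.
    rw [e, h.wt_star] at hpos
    rw [e, h.color_star]
    by_contra hn
    simp only [add_dotProduct, dotProduct_add, dotProduct_neg, dotProduct_comm (wt b) (wt a)] at hpos
    have hb : wt b ≠ 0 := fun hb => hne (by rw [e, h.wt_star, hb, neg_zero])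
    have h1 := h.dot_self hb
    have h2 := h.dot_le_one a a
    omega
  rw [mem_rootsBCD] at hθ hβ
  obtain ⟨-, a, b, -, rfl⟩ := hθ
  obtain ⟨-, d, e, -, rfl⟩ := hβ
  have h1 : 0 < wt a ⬝ᵥ wt d ∨ 0 < wt a ⬝ᵥ wt e ∨ 0 < wt b ⬝ᵥ wt d ∨ 0 < wt b ⬝ᵥ wt e := by
    by_contra! hn
    simp only [add_dotProduct, dotProduct_add] at hpos
    omega
  rcases h1 with h1 | h1 | h1 | h1 <;> obtain rfl := h.eq_of_dot_pos _ _ h1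
  · exact key _ _ _ hne hpos
  · rw [add_comm (wt d)] at hne hpos ⊢
    exact key _ _ _ hne hpos
  · rw [add_comm (wt a)] at hne hpos ⊢
    exact key _ _ _ hne hpos
  · rw [add_comm (wt a), add_comm (wt d)] at hne hpos ⊢
    exact key _ _ _ hne hpos

/-- An involution that permutes the weights of each parity permutes the roots: equal images come
from equal weights, so no doubled orthogonal weight can arise. -/
theorem apply_mem (h : SignedWeights wt c star) {s : (J → ℤ) →+ (J → ℤ)} (hinv : ∀ x, s (s x) = x)
    (hwt : ∀ u, ∃ u', c u' = c u ∧ s (wt u) = wt u') {α : J → ℤ}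
    (hα : α ∈ evenRootsBCD wt c ∪ oddRootsBCD wt c) : s α ∈ evenRootsBCD wt c ∪ oddRootsBCD wt c := by
  rw [mem_rootsBCD] at hα ⊢
  obtain ⟨h0, a, b, hab, rfl⟩ := hα
  obtain ⟨a', ha, ha'⟩ := hwt a
  obtain ⟨b', hb, hb'⟩ := hwt b
  refine ⟨fun e => h0 ?_, a', b', fun e => ?_, by rw [map_add, ha', hb']⟩
  · rw [← hinv (wt a + wt b), e, map_zero]
  · rw [ha]
    refine hab (h.wt_injective ?_)
    rw [← hinv (wt a), ha', e, ← hb', hinv]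

/-- The reflection `x ↦ x - m (v · x) v`. -/
def scaledReflection (m : ℤ) (v : J → ℤ) : (J → ℤ) →+ (J → ℤ) where
  toFun x := x - (m * (v ⬝ᵥ x)) • v
  map_zero' := by simp
  map_add' x y := by rw [dotProduct_add]; module

theorem scaledReflection_apply (m : ℤ) (v x : J → ℤ) :
    scaledReflection m v x = x - (m * (v ⬝ᵥ x)) • v := rfl

theorem scaledReflection_self {m : ℤ} {v : J → ℤ} (hm : m * (v ⬝ᵥ v) = 2) :
    scaledReflection m v v = -v := by
  rw [scaledReflection_apply, hm]
  module

theorem scaledReflection_involutive {m : ℤ} {v : J → ℤ} (hm : m * (v ⬝ᵥ v) = 2) (x : J → ℤ) :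
    scaledReflection m v (scaledReflection m v x) = x := by
  conv_lhs => rw [scaledReflection_apply _ _ x]
  rw [map_sub, map_zsmul, scaledReflection_self hm, scaledReflection_apply]
  module

/-- The reflection exchanges `wt a` and `-wt a`, and every other weight is orthogonal to `wt a`. -/
theorem exists_reflection_single (h : SignedWeights wt c star) {a : ι} (ha : wt a ≠ 0) (u : ι) :
    ∃ u', c u' = c u ∧ scaledReflection 2 (wt a) (wt u) = wt u' := by
  have h1 := h.dot_self ha
  rw [scaledReflection_apply]
  rcases lt_trichotomy (wt a ⬝ᵥ wt u) 0 with h2 | h2 | h2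
  · obtain rfl := h.eq_star_of_dot_neg h2
    refine ⟨star u, h.color_star u, ?_⟩
    rw [h.wt_star] at h1 ⊢
    rw [neg_dotProduct, dotProduct_neg, neg_neg] at h1
    rw [neg_dotProduct, h1]
    module
  · exact ⟨u, rfl, by rw [h2]; module⟩
  · obtain rfl := h.eq_of_dot_pos _ _ h2
    exact ⟨star a, h.color_star a, by rw [h1, h.wt_star]; module⟩

/-- For orthogonal unit vectors v and w the reflection in v + w sends v to -w and w to -v, and it
fixes what is orthogonal to both. It respects parity because `a` and `b` have the same one. -/
theorem exists_reflection_pair (h : SignedWeights wt c star) {a b : ι} (hab : wt a ⬝ᵥ wt b = 0) (ha : wt a ≠ 0) (hb : wt b ≠ 0)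
    (hc : c a = c b) (u : ι) :
    ∃ u', c u' = c u ∧ scaledReflection 1 (wt a + wt b) (wt u) = wt u' := by
  have key : ∀ a b, wt a ⬝ᵥ wt b = 0 → wt a ≠ 0 → c a = c b → wt a ⬝ᵥ wt u ≠ 0 →
      ∃ u', c u' = c u ∧ scaledReflection 1 (wt a + wt b) (wt u) = wt u' := by
    intro a b hab ha hc hu
    have h1 := h.dot_self ha
    rw [scaledReflection_apply, add_dotProduct]
    rcases lt_or_gt_of_ne hu with h2 | h2
    · have hau := h.eq_star_of_dot_neg h2
      have hua : wt u = -wt a := by rw [hau, h.wt_star, neg_neg]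
      refine ⟨b, by rw [← hc, hau, h.color_star], ?_⟩
      rw [hua, dotProduct_neg, dotProduct_neg, h1, dotProduct_comm, hab]
      module
    · obtain rfl := h.eq_of_dot_pos _ _ h2
      refine ⟨star b, by rw [h.color_star, hc], ?_⟩
      rw [h1, dotProduct_comm, hab, h.wt_star]
      module
  by_cases h1 : wt a ⬝ᵥ wt u = 0
  · by_cases h2 : wt b ⬝ᵥ wt u = 0
    · exact ⟨u, rfl, by rw [scaledReflection_apply, add_dotProduct, h1, h2]; module⟩
    · rw [add_comm]
      exact key b a (by rwa [dotProduct_comm]) hb hc.symm h2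
  · exact key a b hab ha hc h1

/-- The roots ±e_i and ±2e_i share their reflection. Any other root is a sum of two orthogonal unit
weights, and these have the same parity since θ is non-isotropic. -/
theorem exists_reflection (h : SignedWeights wt c star) {θ : J → ℤ} (hθ : θ ∈ evenRootsBCD wt c ∪ oddRootsBCD wt c)
    (hni : θ ∈ oddRootsBCD wt c → 2 • θ ∈ evenRootsBCD wt c) : ∃ s : (J → ℤ) →+ (J → ℤ),
    s θ = -θ ∧ ∀ α ∈ evenRootsBCD wt c ∪ oddRootsBCD wt c,
      s α ∈ evenRootsBCD wt c ∪ oddRootsBCD wt c ∧ ∃ n : ℤ, s α = α + n • θ := by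
  have short : ∀ a, wt a ≠ 0 → ∀ θ, θ = wt a ∨ θ = wt a + wt a → ∃ s : (J → ℤ) →+ (J → ℤ),
      s θ = -θ ∧ ∀ α ∈ evenRootsBCD wt c ∪ oddRootsBCD wt c,
        s α ∈ evenRootsBCD wt c ∪ oddRootsBCD wt c ∧ ∃ n : ℤ, s α = α + n • θ := by
    intro a ha θ hθ
    have hm : 2 * (wt a ⬝ᵥ wt a) = 2 := by rw [h.dot_self ha]; rfl
    refine ⟨scaledReflection 2 (wt a), ?_, fun α hα => ⟨h.apply_mem (scaledReflection_involutive hm)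
      (h.exists_reflection_single ha) hα, ?_⟩⟩
    · rcases hθ with rfl | rfl
      · exact scaledReflection_self hm
      · rw [map_add, scaledReflection_self hm, neg_add]
    · rcases hθ with rfl | rfl
      · exact ⟨-(2 * (wt a ⬝ᵥ α)), by rw [scaledReflection_apply]; module⟩
      · exact ⟨-(wt a ⬝ᵥ α), by rw [scaledReflection_apply]; module⟩
  obtain ⟨h0, a, b, hab, rfl⟩ := mem_rootsBCD.1 hθ
  by_cases ha : wt a = 0
  · rw [ha, zero_add] at h0 ⊢
    exact short b h0 _ (.inl rfl)
  by_cases hb : wt b = 0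
  · rw [hb, add_zero] at h0 ⊢
    exact short a h0 _ (.inl rfl)
  by_cases e : a = b
  · subst e
    exact short a ha _ (.inr rfl)
  have ha' := h.dot_self ha
  have hb' := h.dot_self hb
  have hd : wt a ⬝ᵥ wt b = 0 := by
    rcases lt_trichotomy (wt a ⬝ᵥ wt b) 0 with h1 | h1 | h1
    · rw [h.eq_star_of_dot_neg h1, h.wt_star, neg_add_cancel] at h0
      exact absurd rfl h0
    · exact h1
    · exact absurd (h.eq_of_dot_pos _ _ h1) e
  have hd' : wt b ⬝ᵥ wt a = 0 := by rwa [dotProduct_comm]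
  have hc : c a = c b := by
    by_contra hc
    obtain ⟨-, d, f, -, -, hdf⟩ := hni ⟨h0, a, b, hc, rfl⟩
    -- The squared norm of 2θ is 8, but that of a sum of two weights is at most 4.
    have h1 := congrArg (fun x => x ⬝ᵥ x) hdf
    simp only [two_nsmul, add_dotProduct, dotProduct_add, hd, hd', ha', hb',
      dotProduct_comm (wt f) (wt d)] at h1
    have := h.dot_le_one d d
    have := h.dot_le_one f f
    have := h.dot_le_one d f
    omega
  have hm : 1 * ((wt a + wt b) ⬝ᵥ (wt a + wt b)) = 2 := by
    simp [add_dotProduct, dotProduct_add, hd, hd', ha', hb']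
  exact ⟨scaledReflection 1 (wt a + wt b), scaledReflection_self hm, fun α hα =>
    ⟨h.apply_mem (scaledReflection_involutive hm) (h.exists_reflection_pair hd ha hb hc) hα,
      -((wt a + wt b) ⬝ᵥ α), by rw [scaledReflection_apply]; module⟩⟩

/-- Compare a sum of two weights of equal parity with `wt d + wt f`, where `d` is orthogonal and `f`
symplectic. A sum of orthogonal weights has product 0 with `wt f` instead of 1. For a sum of
symplectic weights, the product with `wt d` shows `wt d = 0`, and then the squared norm is even on
one side and 1 on the other. -/
theorem disjoint (h : SignedWeights wt c star) {α : J → ℤ} (h0 : α ∈ evenRootsBCD wt c) : α ∉ oddRootsBCD wt c := by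
  obtain ⟨-, a, b, hab, -, rfl⟩ := h0
  rintro ⟨-, d, f, hdf, e⟩
  have key : ∀ d f, c d = true → c f = false → wt a + wt b ≠ wt d + wt f := by
    intro d f hd hf e
    have hdf : wt d ⬝ᵥ wt f = 0 := h.dot_eq_zero_of_color_ne (by rw [hd, hf]; decide)
    have hff := h.dot_self (h.wt_ne_zero hf)
    by_cases ha : c a = true
    · have h1 := congrArg (fun x => x ⬝ᵥ wt f) e
      simp only [add_dotProduct, hdf, hff] at h1
      rw [h.dot_eq_zero_of_color_ne (a := a) (by rw [ha, hf]; decide),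
        h.dot_eq_zero_of_color_ne (a := b) (by rw [← hab, ha, hf]; decide)] at h1
      omega
    · rw [Bool.not_eq_true] at ha
      have hb := hab ▸ ha
      have h1 := congrArg (fun x => wt d ⬝ᵥ x) e
      simp only [dotProduct_add, hdf] at h1
      rw [h.dot_eq_zero_of_color_ne (b := a) (by rw [ha, hd]; decide),
        h.dot_eq_zero_of_color_ne (b := b) (by rw [hb, hd]; decide)] at h1
      have h2 := congrArg (fun x => x ⬝ᵥ x) e
      simp only [add_dotProduct, dotProduct_add, hdf, hff, dotProduct_comm (wt f) (wt d),
        dotProduct_comm (wt b) (wt a), h.dot_self (h.wt_ne_zero ha),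
        h.dot_self (h.wt_ne_zero hb)] at h2
      omega
  by_cases hd : c d = true
  · exact key d f hd (by grind) e
  · exact key f d (by grind) (by grind) (e.trans (add_comm _ _))

/-- The squared norm of a sum of two weights is at most 4, and that of θ is at least 1, so n² ≤ 4.
If n = 2, equality forces the two weights to coincide, so θ is a single weight, and it is symplectic
because its double is a root. -/
theorem eq_of_nsmul_mem (h : SignedWeights wt c star) {θ : J → ℤ} (hθ : θ ∈ evenRootsBCD wt c ∪ oddRootsBCD wt c) {n : ℕ}
    (hn : n • θ ∈ evenRootsBCD wt c ∪ oddRootsBCD wt c) :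
    n = 1 ∨ n = 2 ∧ θ ∈ oddRootsBCD wt c ∧ 2 • θ ∈ evenRootsBCD wt c := by
  obtain ⟨hn0, a, b, hab, e⟩ := mem_rootsBCD.1 hn
  have h0 : θ ≠ 0 := by
    rintro rfl
    simp at hn0
  have hpos : 0 < θ ⬝ᵥ θ := lt_of_le_of_ne (Finset.sum_nonneg fun i _ => mul_self_nonneg _)
    fun e => h0 (dotProduct_self_eq_zero.1 e.symm)
  have h1 := congrArg (fun x => x ⬝ᵥ x) e
  have hsq : (n • θ) ⬝ᵥ (n • θ) = n * (n * (θ ⬝ᵥ θ)) := by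
    rw [smul_dotProduct, dotProduct_smul, nsmul_eq_mul, nsmul_eq_mul]
  simp only [hsq, add_dotProduct, dotProduct_add, dotProduct_comm (wt b) (wt a)] at h1
  have haa := h.dot_le_one a a
  have hbb := h.dot_le_one b b
  have hle := h.dot_le_one a b
  have hn2 : n ≤ 2 := by
    by_contra! hn
    have h3 : (3 : ℤ) ≤ n := by exact_mod_cast hn
    have h4 : (3 : ℤ) * 1 ≤ n * (θ ⬝ᵥ θ) := mul_le_mul h3 hpos (by norm_num) (by omega)
    have h5 : (3 : ℤ) * 3 ≤ n * (n * (θ ⬝ᵥ θ)) := mul_le_mul h3 (by omega) (by norm_num) (by omega)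
    omega
  have hn1 : n ≠ 0 := by
    rintro rfl
    simp at hn0
  obtain rfl | rfl : n = 1 ∨ n = 2 := by omega
  · exact .inl rfl
  refine .inr ⟨rfl, ?_⟩
  have hab1 : wt a ⬝ᵥ wt b = 1 := by push_cast at h1; omega
  obtain rfl := h.eq_of_dot_pos a b (by omega)
  have ha := hab rfl
  refine ⟨?_, ⟨hn0, a, a, rfl, hab, e⟩⟩
  have eθ : θ = wt a := by
    rw [← two_nsmul] at e
    exact smul_right_injective _ (two_ne_zero : (2 : ℕ) ≠ 0) e
  -- A symplectic unit weight is not an even root: sums of orthogonal weights are perpendicular to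
  -- it, and sums of two symplectic weights have even squared norm.
  refine hθ.resolve_left ?_
  rintro ⟨-, d, f, hdf, -, e'⟩
  by_cases hd : c d = true
  · have h2 := congrArg (fun x => x ⬝ᵥ wt a) (eθ.symm.trans e')
    simp only [add_dotProduct] at h2
    rw [h.dot_eq_zero_of_color_ne (a := d) (by rw [hd, ha]; decide),
      h.dot_eq_zero_of_color_ne (a := f) (by rw [← hdf, hd, ha]; decide)] at h2
    omega
  · rw [Bool.not_eq_true] at hd
    have hf := hdf ▸ hd
    have h2 := congrArg (fun x => x ⬝ᵥ x) (eθ.symm.trans e')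
    simp only [add_dotProduct, dotProduct_add, dotProduct_comm (wt f) (wt d),
      h.dot_self (h.wt_ne_zero hd), h.dot_self (h.wt_ne_zero hf)] at h2
    omega

theorem reflectiveRoots (h : SignedWeights wt c star) : ReflectiveRoots (evenRootsBCD wt c) (oddRootsBCD wt c) where
  neg_mem _ := h.neg_mem
  exists_pairing θ hθ := by
    refine ⟨⟨⟨fun x => θ ⬝ᵥ x, by simp⟩, fun x y => dotProduct_add _ _ _⟩, ?_, fun β hβ hne hl =>
      h.sub_mem hθ hβ hne hl⟩
    exact lt_of_le_of_ne (Finset.sum_nonneg fun i _ => mul_self_nonneg _)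
      fun e => (mem_rootsBCD.1 hθ).1 (dotProduct_self_eq_zero.1 e.symm)
  exists_reflection _ := h.exists_reflection
  eq_of_nsmul_mem _ hθ _ := h.eq_of_nsmul_mem hθ
  disjoint _ := h.disjoint

end SignedWeights

end TypeBCD

/-! ### Root vectors of the orthosymplectic superalgebras. -/

section Osp

variable {k : Type*} [Field k] (l e n : ℕ)

/-- The index set of the standard basis of `k^(2l+e|2n)`. -/
abbrev OspIndex (l e n : ℕ) : Type := (Fin l ⊕ Fin l ⊕ Fin e) ⊕ (Fin n ⊕ Fin n)

/-- The pairing of the basis vectors of opposite weights in `k^(2l+e|2n)`. -/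
def ospStar : OspIndex l e n → OspIndex l e n
  | .inl (.inl i) => .inl (.inr (.inl i))
  | .inl (.inr (.inl i)) => .inl (.inl i)
  | .inl (.inr (.inr i)) => .inl (.inr (.inr i))
  | .inr (.inl j) => .inr (.inr j)
  | .inr (.inr j) => .inr (.inl j)

/-- The value of the form on a basis vector and the basis vector paired with it. -/
def ospSign (k : Type*) [Field k] : OspIndex l e n → k
  | .inr (.inr _) => -1
  | _ => 1

/-- The bound on `e` ensures that the weight 0 occurs at most once. -/
theorem ospSignedWeights (he : e ≤ 1) : SignedWeights (ospWt l e n) Sum.isLeft (ospStar l e n) where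
  color_star := by rintro ((a | a | a) | (a | a)) <;> rfl
  wt_star := by rintro ((a | a | a) | (a | a)) <;> simp [ospStar, ospWt]
  star_star := by rintro ((a | a | a) | (a | a)) <;> rfl
  dot_le_one := by
    rintro ((a | a | a) | (a | a)) ((b | b | b) | (b | b)) <;>
      simp [ospWt, Pi.single_apply] <;> split_ifs <;> simp
  eq_of_dot_pos := by
    rintro ((a | a | a) | (a | a)) ((b | b | b) | (b | b)) <;>
      simp [ospWt, Pi.single_apply] <;> split_ifs <;> simp_all
  eq_of_eq_zero := by
    rintro ((a | a | a) | (a | a)) ((b | b | b) | (b | b)) <;> simp [ospWt]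
    omega
  color_of_eq_zero := by rintro ((a | a | a) | (a | a)) <;> simp [ospWt]

variable {l e n}

/-- The form is a signed permutation matrix, so multiplication by it only relabels entries and
changes signs. -/
theorem ospForm_apply (i j) :
    ospForm k l e n i j = if j = ospStar l e n i then ospSign l e n k i else 0 := by
  rcases i with (i | i | i) | (i | i) <;> rcases j with (j | j | j) | (j | j) <;>
    simp [ospForm, ospStar, ospSign, eq_comm]

theorem ospStar_ospStar (i) : ospStar l e n (ospStar l e n i) = i := by
  rcases i with (i | i | i) | (i | i) <;> rfl

theorem isLeft_ospStar (i) : (ospStar l e n i).isLeft = i.isLeft := by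
  rcases i with (i | i | i) | (i | i) <;> rfl

theorem ospWt_ospStar (i) : ospWt l e n (ospStar l e n i) = -ospWt l e n i := by
  rcases i with (i | i | i) | (i | i) <;> simp [ospStar, ospWt]

theorem eq_ospStar_comm {i j} : i = ospStar l e n j ↔ j = ospStar l e n i := by
  constructor <;> rintro rfl <;> rw [ospStar_ospStar]

theorem transpose_mul_ospForm_apply (x : Matrix (OspIndex l e n) (OspIndex l e n) k) (i j) : (xᵀ * ospForm k l e n) i j =
    x (ospStar l e n j) i * ospSign l e n k (ospStar l e n j) := by
  rw [Matrix.mul_apply, Finset.sum_eq_single (ospStar l e n j)]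
  · simp [ospForm_apply, ospStar_ospStar]
  · intro b _ hb
    rw [ospForm_apply, if_neg (fun h => hb (eq_ospStar_comm.1 h)), mul_zero]
  · simp

theorem ospForm_mul_apply (x : Matrix (OspIndex l e n) (OspIndex l e n) k) (i j) : (ospForm k l e n * x) i j =
    ospSign l e n k i * x (ospStar l e n i) j := by
  rw [Matrix.mul_apply, Finset.sum_eq_single (ospStar l e n i)]
  · simp [ospForm_apply]
  · intro b _ hb
    rw [ospForm_apply, if_neg hb, zero_mul]
  · simp

/-- The sign of the parity of a basis vector. -/
def paritySign (k : Type*) [Field k] {α β : Type} (i : α ⊕ β) : k := if i.isLeft then 1 else -1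

theorem parityMat_mul_ospForm_mul_apply (x : Matrix (OspIndex l e n) (OspIndex l e n) k) (i j) :
    ((parityMat k * ospForm k l e n * x : Matrix (OspIndex l e n) (OspIndex l e n) k) i j) =
      paritySign k i * (ospSign l e n k i * x (ospStar l e n i) j) := by
  rw [Matrix.mul_assoc, parityMat, Matrix.diagonal_mul, ospForm_mul_apply]
  rcases i with i | i <;> simp [paritySign]

theorem ospSign_ospStar (i) :
    ospSign l e n k (ospStar l e n i) = paritySign k i * ospSign l e n k i := by
  rcases i with (i | i | i) | (i | i) <;> simp [ospSign, ospStar, paritySign]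

theorem ospSign_mul_self (i) : ospSign l e n k i * ospSign l e n k i = 1 := by
  rcases i with (i | i | i) | (i | i) <;> simp [ospSign]

theorem paritySign_mul_self {α β : Type} (i : α ⊕ β) : paritySign k i * paritySign k i = 1 := by
  rcases i with i | i <;> simp [paritySign]

/-- The element of weight `ospWt a + ospWt b` of `𝔬𝔰𝔭`, up to the sign `z`. -/
def ospRootVector (k : Type*) [Field k] (z : k) (a b : OspIndex l e n) :
    Matrix (OspIndex l e n) (OspIndex l e n) k :=
  Matrix.single a (ospStar l e n b) 1 + Matrix.single b (ospStar l e n a) z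

theorem ospRootVector_entry {z : k} {a b i j}
    (h : ospRootVector (l := l) (e := e) (n := n) k z a b i j ≠ 0) :
    a = i ∧ ospStar l e n b = j ∨ b = i ∧ ospStar l e n a = j := by
  by_contra! hn
  refine h ?_
  rw [ospRootVector, Matrix.add_apply, Matrix.single_apply, Matrix.single_apply,
    if_neg (fun h => hn.1 h.1 h.2), if_neg (fun h => hn.2 h.1 h.2), add_zero]

theorem ospRootVector_weight {z : k} {a b} (i j)
    (h : ospRootVector (l := l) (e := e) (n := n) k z a b i j ≠ 0) :
    ospWt l e n i - ospWt l e n j = ospWt l e n a + ospWt l e n b := by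
  rcases ospRootVector_entry h with ⟨rfl, rfl⟩ | ⟨rfl, rfl⟩ <;> rw [ospWt_ospStar] <;> abel

theorem ospRootVector_ne_zero {z : k} {a b} (h : a = b → 1 + z ≠ 0) :
    ospRootVector (l := l) (e := e) (n := n) k z a b ≠ 0 := by
  intro h0
  have := congrFun (congrFun h0 a) (ospStar l e n b)
  rw [ospRootVector, Matrix.add_apply, Matrix.single_apply, Matrix.single_apply] at this
  by_cases hab : a = b
  · subst hab
    simp at this
    exact h rfl this
  · rw [if_pos ⟨rfl, rfl⟩, if_neg (fun h => hab h.1.symm), add_zero] at this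
    exact one_ne_zero this

/-- Only the entries `(b*, a*)` and `(a*, b*)` can be nonzero, where `*` is `ospStar`; the two
hypotheses say that the terms cancel there. The function `D` is 1 for the even part and the parity
sign for the odd part. -/
theorem ospRootVector_skew {z : k} {a b} (D : OspIndex l e n → k)
    (h1 : ospSign l e n k a + z * (D (ospStar l e n b) * ospSign l e n k (ospStar l e n b)) = 0)
    (h2 : D (ospStar l e n a) * ospSign l e n k (ospStar l e n a) + z * ospSign l e n k b = 0) (i j) :
    ospRootVector k z a b (ospStar l e n j) i * ospSign l e n k (ospStar l e n j) +
      D i * (ospSign l e n k i * ospRootVector k z a b (ospStar l e n i) j) = 0 := by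
  have hA : ∀ p q w, Matrix.single p (ospStar l e n q) w (ospStar l e n j) i *
      ospSign l e n k (ospStar l e n j) =
      if i = ospStar l e n q ∧ j = ospStar l e n p then w * ospSign l e n k p else 0 := by
    intro p q w
    by_cases h : i = ospStar l e n q ∧ j = ospStar l e n p
    · obtain ⟨rfl, rfl⟩ := h
      simp [ospStar_ospStar]
    · rw [if_neg h, Matrix.single_apply, if_neg, zero_mul]
      exact fun h' => h ⟨h'.2.symm, eq_ospStar_comm.1 h'.1⟩
  have hB : ∀ p q w, D i * (ospSign l e n k i *
      Matrix.single p (ospStar l e n q) w (ospStar l e n i) j) = if i = ospStar l e n p ∧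
        j = ospStar l e n q then D (ospStar l e n p) * ospSign l e n k (ospStar l e n p) * w else 0 := by
    intro p q w
    by_cases h : i = ospStar l e n p ∧ j = ospStar l e n q
    · obtain ⟨rfl, rfl⟩ := h
      simp [ospStar_ospStar, mul_assoc]
    · rw [if_neg h, Matrix.single_apply, if_neg, mul_zero, mul_zero]
      exact fun h' => h ⟨eq_ospStar_comm.1 h'.1, h'.2.symm⟩
  simp only [ospRootVector, Matrix.add_apply, mul_add, add_mul, hA, hB]
  split_ifs
  -- Here the two positions coincide, so both cancellations take place in the same entry.
  · linear_combination h1 + h2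
  · linear_combination h1
  · linear_combination h2
  · simp

theorem isEvenMat_ospRootVector {z : k} {a b} (h : a.isLeft = b.isLeft) :
    IsEvenMat (ospRootVector (l := l) (e := e) (n := n) k z a b) := isEvenMat_iff.2 fun i j hij => by
  rcases ospRootVector_entry hij with ⟨rfl, rfl⟩ | ⟨rfl, rfl⟩ <;> rw [isLeft_ospStar, h]

theorem isOddMat_ospRootVector {z : k} {a b} (h : a.isLeft ≠ b.isLeft) :
    IsOddMat (ospRootVector (l := l) (e := e) (n := n) k z a b) := isOddMat_iff.2 fun i j hij => by
  rcases ospRootVector_entry hij with ⟨rfl, rfl⟩ | ⟨rfl, rfl⟩ <;> rw [isLeft_ospStar]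
  · exact h
  · exact h.symm

theorem paritySign_ospStar (i) : paritySign k (ospStar l e n i) = paritySign k i := by
  rw [paritySign, isLeft_ospStar, paritySign]

/-- The difference of the weights of `i` and `j` is the sum of the weights of `i` and `j*`. If `i =
j*` is orthogonal, the diagonal entry of the skewness condition at `j` reads `2 * x i j = 0`, so
doubled orthogonal weights do not occur. -/
theorem mem_evenRootsBCD_of_entry (h2 : (2 : k) ≠ 0) {x : Matrix (OspIndex l e n) (OspIndex l e n) k}
    (hx : x ∈ ospEven (ospForm k l e n)) {i j} (hij : x i j ≠ 0) {lam : Fin l ⊕ Fin n → ℤ}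
    (h0 : lam ≠ 0) (h : ospWt l e n i - ospWt l e n j = lam) :
    lam ∈ evenRootsBCD (ospWt l e n) Sum.isLeft := by
  refine ⟨h0, i, ospStar l e n j, ?_, ?_, ?_⟩
  · rw [isLeft_ospStar]
    exact isEvenMat_iff.1 hx.1 i j hij
  · intro e'
    by_contra hl
    rw [Bool.not_eq_false] at hl
    have h3 := congrFun (congrFun hx.2 j) j
    rw [Matrix.add_apply, transpose_mul_ospForm_apply, ospForm_mul_apply, ← e'] at h3
    have hs : ∀ i : OspIndex l e n, i.isLeft = true → ospSign l e n k i = 1 := by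
      rintro ((i | i | i) | (i | i)) h <;> first | rfl | exact absurd h (by simp)
    rw [hs i hl, hs j (by rw [← isLeft_ospStar, ← e', hl]), mul_one, one_mul, ← two_mul] at h3
    exact (mul_ne_zero h2 hij) h3
  · rw [ospWt_ospStar, ← sub_eq_add_neg]
    exact h.symm

theorem mem_oddRootsBCD_of_entry {x : Matrix (OspIndex l e n) (OspIndex l e n) k}
    (hx : IsOddMat x) {i j} (hij : x i j ≠ 0) {lam : Fin l ⊕ Fin n → ℤ}
    (h0 : lam ≠ 0) (h : ospWt l e n i - ospWt l e n j = lam) :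
    lam ∈ oddRootsBCD (ospWt l e n) Sum.isLeft := by
  refine ⟨h0, i, ospStar l e n j, ?_, ?_⟩
  · rw [isLeft_ospStar]
    exact isOddMat_iff.1 hx i j hij
  · rw [ospWt_ospStar, ← sub_eq_add_neg]
    exact h.symm

variable [Infinite k]

theorem osp_evenRoots (h2 : (2 : k) ≠ 0) :
    (osp k l e n).evenRoots = evenRootsBCD (ospWt l e n) Sum.isLeft := by
  ext lam
  rw [ToralLieSuperalgebra.mem_evenRoots_iff]
  constructor
  · rintro ⟨h0, x, hx, hne, h⟩
    obtain ⟨i, j, hij⟩ := exists_entry_ne_zero hne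
    exact mem_evenRootsBCD_of_entry h2 hx hij h0 (h i j hij)
  · rintro ⟨h0, a, b, hc, hab, rfl⟩
    have hpa : paritySign k a = paritySign k b := by rw [paritySign, hc, paritySign]
    -- The sign solves the first equation of `ospRootVector_skew` for `D = 1`; the second then holds
    -- because `a` and `b` have the same parity.
    refine ⟨h0, ospRootVector k (-(ospSign l e n k a * (paritySign k b * ospSign l e n k b))) a b,
      ⟨isEvenMat_ospRootVector hc, ?_⟩, ospRootVector_ne_zero ?_, ospRootVector_weight⟩
    · ext i j
      rw [Matrix.add_apply, transpose_mul_ospForm_apply, ospForm_mul_apply]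
      have := ospRootVector_skew (k := k)
        (z := -(ospSign l e n k a * (paritySign k b * ospSign l e n k b))) (a := a) (b := b)
        (fun _ => 1) ?_ ?_ i j
      · rwa [one_mul] at this
      · rw [ospSign_ospStar]
        linear_combination (-ospSign l e n k a * paritySign k b * paritySign k b) *
          ospSign_mul_self (k := k) b - ospSign l e n k a * paritySign_mul_self (k := k) b
      · rw [ospSign_ospStar, hpa]
        linear_combination (-ospSign l e n k a * paritySign k b) * ospSign_mul_self (k := k) b
    -- For `a = b` the index is symplectic and the sign is 1, so the two matrix units add up to
    -- twice one of them.
    · rintro rfl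
      have h3 : paritySign k a = -1 := by rw [paritySign, hab rfl]; rfl
      rw [h3]
      have : (1 : k) + -(ospSign l e n k a * (-1 * ospSign l e n k a)) = 2 := by
        linear_combination ospSign_mul_self (k := k) a
      rwa [this]

theorem osp_oddRoots : (osp k l e n).oddRoots = oddRootsBCD (ospWt l e n) Sum.isLeft := by
  ext lam
  rw [ToralLieSuperalgebra.mem_oddRoots_iff]
  constructor
  · rintro ⟨h0, x, hx, hne, h⟩
    obtain ⟨i, j, hij⟩ := exists_entry_ne_zero hne
    exact mem_oddRootsBCD_of_entry hx.1 hij h0 (h i j hij)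
  · rintro ⟨h0, a, b, hc, rfl⟩
    -- Compared with the even case the parity sign drops out, since `D` contributes a second one.
    refine ⟨h0, ospRootVector k (-(ospSign l e n k a * ospSign l e n k b)) a b,
      ⟨isOddMat_ospRootVector hc, ?_⟩,
      ospRootVector_ne_zero fun e' => absurd (congrArg Sum.isLeft e') hc, ospRootVector_weight⟩
    ext i j
    rw [Matrix.add_apply, transpose_mul_ospForm_apply, parityMat_mul_ospForm_mul_apply]
    refine ospRootVector_skew (paritySign k) ?_ ?_ i j
    · rw [paritySign_ospStar, ospSign_ospStar]
      linear_combination (-ospSign l e n k a * paritySign k b * paritySign k b) *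
          ospSign_mul_self (k := k) b - ospSign l e n k a * paritySign_mul_self (k := k) b
    · rw [paritySign_ospStar, ospSign_ospStar]
      linear_combination ospSign l e n k a * paritySign_mul_self (k := k) a -
        ospSign l e n k a * ospSign_mul_self (k := k) b

theorem osp_isReflective (h2 : (2 : k) ≠ 0) (he : e ≤ 1) : (osp k l e n).IsReflective := by
  have h := (ospSignedWeights l e n he).reflectiveRoots
  rw [← osp_evenRoots (k := k) h2, ← osp_oddRoots (k := k)] at h
  exact h.isReflective

end Osp

/-! ### Root systems given by lists -/

/-- The finitely many conditions on the lists of even and odd roots that make a root system reflective;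
`g` gives the pairings, and `x ↦ x - (c θ · x / q θ) θ` are the reflections. -/
theorem reflectiveRoots_of_lists {m : ℕ} {E O : List (Fin m → ℤ)} {R₀ R₁ : Set (Fin m → ℤ)}
    (hE : ∀ x, x ∈ R₀ ↔ x ∈ E) (hO : ∀ x, x ∈ R₁ ↔ x ∈ O)
    (g c v : (Fin m → ℤ) → Fin m → ℤ) (q : (Fin m → ℤ) → ℤ)
    (h_neg : ∀ x ∈ E ++ O, -x ∈ E ++ O)
    (h_pos : ∀ x ∈ E ++ O, 0 < g x ⬝ᵥ x)
    (h_sub : ∀ x ∈ E ++ O, ∀ y ∈ E ++ O, y = x ∨ g x ⬝ᵥ y ≤ 0 ∨ y - x ∈ E ++ O)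
    (h_refl : ∀ x ∈ E ++ O, (x ∈ O ∧ 2 • x ∉ E) ∨ (q x • v x = x ∧ (c x ⬝ᵥ x) • v x = 2 • x ∧
      ∀ y ∈ E ++ O, q x ∣ c x ⬝ᵥ y ∧ y - (c x ⬝ᵥ y) • v x ∈ E ++ O))
    (h_bound : ∀ x ∈ E ++ O, ∀ i, x i ≤ 2 ∧ -2 ≤ x i)
    (h_two : ∀ x ∈ E ++ O, 2 • x ∉ E ++ O ∨ x ∈ O ∧ 2 • x ∈ E)
    (h_disj : ∀ x ∈ E, x ∉ O) : ReflectiveRoots R₀ R₁ := by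
  have hmem : ∀ x, x ∈ R₀ ∪ R₁ ↔ x ∈ E ++ O := fun x => by
    rw [List.mem_append, ← hE, ← hO]; rfl
  have h0 : (0 : Fin m → ℤ) ∉ E ++ O := fun h => by simpa using h_pos 0 h
  refine ⟨?_, ?_, ?_, ?_, ?_⟩
  · simpa only [hmem] using h_neg
  · intro θ hθ
    rw [hmem] at hθ
    refine ⟨AddMonoidHom.mk' (fun x => g θ ⬝ᵥ x) (dotProduct_add _), h_pos θ hθ,
      fun β hβ hne hl => ?_⟩
    rw [hmem] at hβ ⊢
    exact ((h_sub θ hθ β hβ).resolve_left hne).resolve_left (not_le.2 hl)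
  · intro θ hθ hni
    rw [hmem] at hθ
    rw [hE, hO] at hni
    obtain ⟨hq, hc, h⟩ := (h_refl θ hθ).resolve_left fun h => h.2 (hni h.1)
    refine ⟨AddMonoidHom.mk' (fun x => x - (c θ ⬝ᵥ x) • v θ) fun x y => by
      rw [dotProduct_add]; module, ?_, fun α hα => ?_⟩
    · change θ - (c θ ⬝ᵥ θ) • v θ = -θ
      rw [hc]; module
    · rw [hmem] at hα ⊢
      obtain ⟨⟨z, hz⟩, h2⟩ := h α hα
      refine ⟨h2, -z, ?_⟩
      change α - (c θ ⬝ᵥ α) • v θ = α + -z • θ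
      -- The displacement is an integral multiple of θ, because `θ = q θ • v θ` and `q θ` divides
      -- the coefficient.
      have h3 : z • θ = (q θ * z) • v θ := by rw [mul_comm, mul_smul, hq]
      rw [hz, neg_smul, h3, sub_eq_add_neg]
  · intro θ hθ n hn
    rw [hmem] at hθ hn
    rw [hE, hO]
    obtain ⟨i, hi⟩ : ∃ i, θ i ≠ 0 := by
      by_contra! h
      exact h0 ((funext h : θ = 0) ▸ hθ)
    have h1 := h_bound _ hn i
    rw [Pi.smul_apply, nsmul_eq_mul] at h1
    -- A nonzero coordinate of θ is at least 1 in absolute value, while the coordinates of the root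
    -- `n • θ` are at most 2.
    have hn2 : n ≤ 2 := by
      by_contra! h3
      have h3 : (3 : ℤ) ≤ n := by exact_mod_cast h3
      rcases lt_or_gt_of_ne hi with h4 | h4 <;> nlinarith
    have hn0 : n ≠ 0 := by
      rintro rfl
      exact h0 (by simpa using hn)
    obtain rfl | rfl : n = 1 ∨ n = 2 := by omega
    · exact .inl rfl
    · exact .inr ⟨rfl, (h_two θ hθ).resolve_left fun h => h hn⟩
  · intro α
    rw [hE, hO]
    exact h_disj α

/-! ### The roots of `(𝔰𝔩₂ ⊕ L) ⊕ (k² ⊗ V)` -/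

section Triple

variable {k : Type*} [Field k] [Infinite k] {S I : Type} [Fintype S] [DecidableEq S] [Fintype I]
  (d : TripleData k S I)

/-- The nonzero weights of the torus on `L`. -/
def TripleData.rootsL : Set (I → ℤ) :=
  {lam | lam ≠ 0 ∧ ∃ x ∈ d.L, x ≠ 0 ∧ ∀ i j, x i j ≠ 0 → d.wt i - d.wt j = lam}

/-- A weight vector with nonzero block in `L` gives a root of `L`. Otherwise it lives in the block
of `𝔰𝔩₂`, whose off-diagonal units have the weights `±2 • nu` because `k²` has the weights `±nu`. -/
theorem mem_tripleSuper_evenRoots {nu : I → ℤ} (hnu : nu ≠ 0) {lam : I → ℤ} :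
    lam ∈ (tripleSuper d nu).evenRoots ↔ lam ∈ d.rootsL ∨ lam = 2 • nu ∨ lam = -(2 • nu) := by
  have hnu2 : 2 • nu ≠ 0 := fun h => hnu ((smul_eq_zero.1 h).resolve_left (by norm_num))
  refine (ToralLieSuperalgebra.mem_evenRoots_iff (A := tripleSuper d nu)).trans ⟨?_, ?_⟩
  · rintro ⟨h0, _, ⟨x, hx, s, hs, rfl⟩, hne, h⟩
    by_cases hx0 : x = 0
    · right
      have hs0 : s ≠ 0 := by
        rintro rfl
        exact hne (hx0 ▸ fromBlocks_zero)
      obtain ⟨i, j, hij⟩ := exists_entry_ne_zero hs0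
      have h1 : (![nu, -nu] : Fin 2 → I → ℤ) i - (![nu, -nu] : Fin 2 → I → ℤ) j = lam :=
        h (.inr i) (.inr j) hij
      fin_cases i <;> fin_cases j
      · exact absurd (h1.symm.trans (sub_self _)) h0
      · exact .inl (h1.symm.trans (by rw [two_nsmul]; exact sub_neg_eq_add _ _))
      · exact .inr (h1.symm.trans (by rw [two_nsmul, neg_add]; exact sub_eq_add_neg _ _))
      · exact absurd (h1.symm.trans (sub_self _)) h0
    · exact .inl ⟨h0, x, hx, hx0, fun i j hij => h (.inl i) (.inl j) hij⟩
  · have key : ∀ i j : Fin 2, i ≠ j → (![nu, -nu] : Fin 2 → I → ℤ) i - ![nu, -nu] j = lam → lam ≠ 0 →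
        lam ≠ 0 ∧ ∃ x ∈ (tripleSuper d nu).even, x ≠ 0 ∧
          ∀ i j, x i j ≠ 0 → (tripleSuper d nu).wt i - (tripleSuper d nu).wt j = lam := by
      intro i j hij hl h0
      refine ⟨h0, fromBlocks 0 0 0 (Matrix.single i j 1), ⟨0, zero_mem _, _, ?_, rfl⟩,
        fun h => ?_, ?_⟩
      · exact Matrix.trace_single_eq_of_ne i j 1 hij
      · exact matrix_single_one_ne_zero i j (Matrix.fromBlocks_inj.1 (h.trans fromBlocks_zero.symm)).2.2.2
      · rintro (a | a) (b | b) hab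
        · exact absurd rfl hab
        · exact absurd rfl hab
        · exact absurd rfl hab
        · obtain ⟨rfl, rfl⟩ := single_one_ne_zero (k := k) hab
          exact hl
    rintro (⟨h0, x, hx, hne, h⟩ | rfl | rfl)
    · refine ⟨h0, fromBlocks x 0 0 0, ⟨x, hx, 0, by simp, rfl⟩, fun h => ?_, ?_⟩
      · exact hne (Matrix.fromBlocks_inj.1 (h.trans fromBlocks_zero.symm)).1
      · rintro (a | a) (b | b) hab
        · exact h a b hab
        · exact absurd rfl hab
        · exact absurd rfl hab
        · exact absurd rfl hab
    · exact key 0 1 (by decide) (by rw [two_nsmul]; exact sub_neg_eq_add _ _) hnu2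
    · exact key 1 0 (by decide) (by rw [two_nsmul, neg_add]; exact sub_eq_add_neg _ _)
        (neg_ne_zero.2 hnu2)

theorem mem_tripleSuper_oddRoots {nu : I → ℤ} {lam : I → ℤ} : lam ∈ (tripleSuper d nu).oddRoots ↔
    lam ≠ 0 ∧ ∃ a, lam = d.wt a + nu ∨ lam = d.wt a - nu := by
  refine (ToralLieSuperalgebra.mem_oddRoots_iff (A := tripleSuper d nu)).trans
    (and_congr Iff.rfl ⟨?_, ?_⟩)
  · rintro ⟨_, ⟨X, rfl⟩, hne, h⟩
    obtain ⟨i, j, hij⟩ := exists_entry_ne_zero (x := X) (by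
      rintro rfl
      exact hne fromBlocks_zero)
    have h1 : d.wt i - (![nu, -nu] : Fin 2 → I → ℤ) j = lam := h (.inl i) (.inr j) hij
    refine ⟨i, ?_⟩
    fin_cases j
    · exact .inr h1.symm
    · exact .inl (by rw [← h1]; simp)
  · have key : ∀ (a : S) (j : Fin 2), d.wt a - (![nu, -nu] : Fin 2 → I → ℤ) j = lam →
        ∃ x ∈ (tripleSuper d nu).odd, x ≠ 0 ∧
          ∀ i j, x i j ≠ 0 → (tripleSuper d nu).wt i - (tripleSuper d nu).wt j = lam := by
      intro a j hl
      have hX : ∀ b i, (Matrix.of fun b i => if a = b ∧ j = i then (1 : k) else 0) b i ≠ 0 →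
          a = b ∧ j = i := fun b i h => by_contra fun hn => h (if_neg hn)
      refine ⟨fromBlocks 0 (Matrix.of fun b i => if a = b ∧ j = i then 1 else 0) 0 0, ⟨_, rfl⟩,
        fun h => ?_, ?_⟩
      · have := congrFun (congrFun (Matrix.fromBlocks_inj.1 (h.trans fromBlocks_zero.symm)).2.1 a) j
        simp at this
      · rintro (b | b) (i | i) hab
        · exact absurd rfl hab
        · obtain ⟨rfl, rfl⟩ := hX b i hab
          exact hl
        · exact absurd rfl hab
        · exact absurd rfl hab
    rintro ⟨a, rfl | rfl⟩
    · exact key a 1 (by simp)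
    · exact key a 0 (by simp)

theorem rootsL_of_conj {lam : I → ℤ} (h0 : lam ≠ 0) {x : Matrix S S k} (hx : x ∈ d.L) (hne : x ≠ 0)
    (h : ∀ t, torusMat d.wt t * x * torusMat d.wt t⁻¹ = (torusChar t lam : k) • x) :
    lam ∈ d.rootsL :=
  ⟨h0, x, hx, hne, fun _ _ => ToralLieSuperalgebra.weight_of_conj_eq_smul h⟩

/-- A skew matrix has no entry between two basis vectors that are paired by the form. -/
theorem entry_eq_zero_of_skew {b x : Matrix S S k} (h2 : (2 : k) ≠ 0) (hb : bᵀ = b)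
    (hx : xᵀ * b + b * x = 0) {i j : S} (hij : b i j ≠ 0) (h : ∀ a, a ≠ i → b a j = 0) :
    x i j = 0 := by
  have h1 := congrFun (congrFun hx j) j
  have hs : ∀ a c, b a c = b c a := fun a c => congrFun (congrFun hb c) a
  -- In the entry `(j, j)` of the skewness condition each product has a single term, and both terms
  -- equal `b i j * x i j`.
  rw [Matrix.add_apply, Matrix.mul_apply, Matrix.mul_apply, Finset.sum_eq_single i,
    Finset.sum_eq_single i, Matrix.transpose_apply, hs j i, Matrix.zero_apply] at h1
  · have h3 : 2 * b i j * x i j = 0 := by linear_combination h1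
    exact (mul_eq_zero.1 h3).resolve_left (mul_ne_zero h2 hij)
  · intro a _ ha
    rw [hs j a, h a ha, zero_mul]
  · simp
  · intro a _ ha
    rw [h a ha, mul_zero]
  · simp

end Triple

/-- The weights are passed separately as `w`, so that the conditions on the lists do not involve the
field and can be decided by evaluation. -/
theorem tripleSuper_isReflective {k : Type*} [Field k] [Infinite k] {S : Type} [Fintype S]
    [DecidableEq S] {m : ℕ} {d : TripleData k S (Fin m)} {nu : Fin m → ℤ} {L O : List (Fin m → ℤ)}
    (hnu : nu ≠ 0) (hL : ∀ x, x ∈ d.rootsL ↔ x ∈ L) {w : S → Fin m → ℤ} (hw : d.wt = w)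
    (hO : ∀ a, w a + nu ∈ O ∧ w a - nu ∈ O)
    (hO' : ∀ x ∈ O, x ≠ 0 ∧ ∃ a, x = w a + nu ∨ x = w a - nu)
    {E : List (Fin m → ℤ)} (hE : E = 2 • nu :: -(2 • nu) :: L)
    (g c v : (Fin m → ℤ) → Fin m → ℤ) (q : (Fin m → ℤ) → ℤ)
    (h_neg : ∀ x ∈ E ++ O, -x ∈ E ++ O)
    (h_pos : ∀ x ∈ E ++ O, 0 < g x ⬝ᵥ x)
    (h_sub : ∀ x ∈ E ++ O, ∀ y ∈ E ++ O, y = x ∨ g x ⬝ᵥ y ≤ 0 ∨ y - x ∈ E ++ O)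
    (h_refl : ∀ x ∈ E ++ O, (x ∈ O ∧ 2 • x ∉ E) ∨ (q x • v x = x ∧ (c x ⬝ᵥ x) • v x = 2 • x ∧
      ∀ y ∈ E ++ O, q x ∣ c x ⬝ᵥ y ∧ y - (c x ⬝ᵥ y) • v x ∈ E ++ O))
    (h_bound : ∀ x ∈ E ++ O, ∀ i, x i ≤ 2 ∧ -2 ≤ x i)
    (h_two : ∀ x ∈ E ++ O, 2 • x ∉ E ++ O ∨ x ∈ O ∧ 2 • x ∈ E)
    (h_disj : ∀ x ∈ E, x ∉ O) : (tripleSuper d nu).IsReflective := by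
  subst hw
  refine (reflectiveRoots_of_lists (fun x => ?_) (fun x => ?_) g c v q h_neg h_pos h_sub h_refl
    h_bound h_two h_disj).isReflective
  · refine (mem_tripleSuper_evenRoots d hnu).trans ?_
    rw [hE, List.mem_cons, List.mem_cons, hL]
    tauto
  · refine (mem_tripleSuper_oddRoots d).trans ⟨?_, hO' x⟩
    rintro ⟨-, a, rfl | rfl⟩
    exacts [(hO a).1, (hO a).2]

/-! ### `D(2,1;a)` -/

/-- The roots of `𝔰𝔩₂ ⊕ 𝔰𝔩₂`. -/
def d21RootsL : List (Fin 3 → ℤ) := [![0, 2, 0], ![0, -2, 0], ![0, 0, 2], ![0, 0, -2]]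

/-- The even roots of `D(2,1;a)`. -/
def d21RootsEven : List (Fin 3 → ℤ) := ![2, 0, 0] :: ![-2, 0, 0] :: d21RootsL

/-- The odd roots of `D(2,1;a)`. -/
def d21RootsOdd : List (Fin 3 → ℤ) := [![1, 1, 1], ![1, 1, -1], ![1, -1, 1], ![1, -1, -1],
  ![-1, 1, 1], ![-1, 1, -1], ![-1, -1, 1], ![-1, -1, -1]]

section D21

variable {k : Type*} [Field k]

theorem kronSum_apply (p q : Matrix (Fin 2) (Fin 2) k) (a b : Fin 2 × Fin 2) :
    kronSum p q a b = p a.1 b.1 * (if a.2 = b.2 then 1 else 0) +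
      (if a.1 = b.1 then 1 else 0) * q a.2 b.2 := by
  simp only [kronSum, Matrix.add_apply, Matrix.kroneckerMap_apply, Matrix.one_apply]

/-- An entry of `p ⊗ 1 + 1 ⊗ q` vanishes unless one of the two indices is unchanged, so the weight
changes in one coordinate only. Conversely, an off-diagonal matrix unit in one factor is a root
vector. -/
theorem mem_d21_rootsL (a : k) (lam : Fin 3 → ℤ) : lam ∈ (d21Data a).rootsL ↔ lam ∈ d21RootsL := by
  constructor
  · rintro ⟨h0, _, ⟨p, q, -, -, rfl⟩, hne, h⟩
    obtain ⟨i, j, hij⟩ := exists_entry_ne_zero hne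
    have hl : d21Wt i - d21Wt j = lam := h i j hij
    have h1 : i.1 = j.1 ∨ i.2 = j.2 := by
      by_contra! hn
      rw [kronSum_apply, if_neg hn.1, if_neg hn.2] at hij
      simp at hij
    have key : ∀ i j : Fin 2 × Fin 2, i.1 = j.1 ∨ i.2 = j.2 → d21Wt i - d21Wt j ≠ 0 →
        d21Wt i - d21Wt j ∈ d21RootsL := by decide +kernel
    rw [← hl] at h0 ⊢
    exact key i j h1 h0
  · intro hlam
    have h0 : lam ≠ 0 := by
      rintro rfl
      revert hlam
      decide +kernel
    have tr : ∀ i j : Fin 2, i ≠ j → (Matrix.single i j (1 : k)).trace = 0 := fun i j hij =>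
      Matrix.trace_single_eq_of_ne i j 1 hij
    have left : ∀ i j : Fin 2, i ≠ j → (∀ b, d21Wt (i, b) - d21Wt (j, b) = lam) →
        lam ∈ (d21Data a).rootsL := by
      intro i j hij hl
      refine ⟨h0, kronSum (Matrix.single i j 1) 0, ⟨_, _, tr i j hij, by simp, rfl⟩, fun h => ?_, ?_⟩
      · have := congrFun (congrFun h (i, 0)) (j, 0)
        simp [kronSum_apply] at this
      · rintro ⟨c, c'⟩ ⟨e, e'⟩ h
        rw [kronSum_apply] at h
        simp only [Matrix.zero_apply, mul_zero, add_zero, ne_eq, mul_eq_zero, not_or,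
          ite_eq_right_iff, one_ne_zero, imp_false, not_not] at h
        obtain ⟨rfl, rfl⟩ := single_one_ne_zero (k := k) h.1
        obtain rfl := h.2
        exact hl c'
    have right : ∀ i j : Fin 2, i ≠ j → (∀ b, d21Wt (b, i) - d21Wt (b, j) = lam) →
        lam ∈ (d21Data a).rootsL := by
      intro i j hij hl
      refine ⟨h0, kronSum 0 (Matrix.single i j 1), ⟨_, _, by simp, tr i j hij, rfl⟩, fun h => ?_, ?_⟩
      · have := congrFun (congrFun h (0, i)) (0, j)
        simp [kronSum_apply] at this
      · rintro ⟨c, c'⟩ ⟨e, e'⟩ h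
        rw [kronSum_apply] at h
        simp only [Matrix.zero_apply, zero_mul, zero_add, ne_eq, mul_eq_zero, not_or,
          ite_eq_right_iff, one_ne_zero, imp_false, not_not] at h
        obtain ⟨rfl, rfl⟩ := single_one_ne_zero (k := k) h.2
        obtain rfl := h.1
        exact hl c
    simp only [d21RootsL, List.mem_cons, List.not_mem_nil, or_false] at hlam
    rcases hlam with rfl | rfl | rfl | rfl
    · exact left 0 1 (by decide) (by decide +kernel)
    · exact left 1 0 (by decide) (by decide +kernel)
    · exact right 0 1 (by decide) (by decide +kernel)
    · exact right 1 0 (by decide) (by decide +kernel)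

/-- All odd roots are isotropic, so reflections are needed only in `x = ±2e_i`, where `x / 2 = ±e_i`
is the coroot. The pairing is the ordinary dot product, whatever the value of `a`. -/
theorem d21_isReflective [Infinite k] (a : k) : (d21 a).IsReflective :=
  tripleSuper_isReflective (d := d21Data a) (nu := ![1, 0, 0]) (L := d21RootsL) (O := d21RootsOdd)
    (by decide) (mem_d21_rootsL a) (w := d21Wt) rfl (by decide +kernel) (by decide +kernel)
    (E := d21RootsEven) (by decide +kernel) id (fun x i => x i / 2) id (fun _ => 1)
    (by decide +kernel) (by decide +kernel) (by decide +kernel) (by decide +kernel)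
    (by decide +kernel) (by decide +kernel) (by decide +kernel)

end D21

/-- Since `D` is equivariant under the torus, its value on two basis vectors is a weight vector for
the sum of their weights. -/
theorem TripleData.mem_rootsL_of_D_ne_zero {k : Type*} [Field k] [Infinite k] {S I : Type} [Fintype S]
    [DecidableEq S] [Fintype I] (d : TripleData k S I) {i j : S} {lam : I → ℤ} (h0 : lam ≠ 0)
    (hl : d.wt i + d.wt j = lam) (hne : d.D (Pi.single i 1) (Pi.single j 1) ≠ 0) : lam ∈ d.rootsL := by
  refine rootsL_of_conj d h0 (d.D_mem _ _) hne fun t => ?_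
  have h : ∀ i, torusMat d.wt t *ᵥ Pi.single i 1 =
      (torusChar t (d.wt i) : k) • (Pi.single i 1 : S → k) := by
    intro i
    ext a
    rcases eq_or_ne a i with rfl | ha
    · simp [torusMat, Matrix.mulVec_diagonal]
    · simp [torusMat, Matrix.mulVec_diagonal, Pi.single_eq_of_ne ha]
  rw [d.conj_D, h, h, map_smul, map_smul, LinearMap.smul_apply, smul_smul, ← hl, torusChar_add,
    Units.val_mul, mul_comm]

/-! ### `G(3)` -/

/-- The roots of `𝔤₂`. -/
def g3RootsL : List (Fin 3 → ℤ) := [![0, 1, 0], ![0, -1, 0], ![0, 0, 1], ![0, 0, -1], ![0, 1, 1],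
  ![0, -1, -1], ![0, 1, -1], ![0, -1, 1], ![0, 2, 1], ![0, -2, -1], ![0, 1, 2], ![0, -1, -2]]

/-- The even roots of `G(3)`. -/
def g3RootsEven : List (Fin 3 → ℤ) := ![2, 0, 0] :: ![-2, 0, 0] :: g3RootsL

/-- The odd roots of `G(3)`. -/
def g3RootsOdd : List (Fin 3 → ℤ) := [![1, 0, 0], ![1, 1, 0], ![1, -1, 0], ![1, 0, 1], ![1, 0, -1],
  ![1, 1, 1], ![1, -1, -1], ![-1, 0, 0], ![-1, 1, 0], ![-1, -1, 0], ![-1, 0, 1], ![-1, 0, -1],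
  ![-1, 1, 1], ![-1, -1, -1]]

/-- The coefficients of the invariant form with `x`. -/
def g3Pairing (x : Fin 3 → ℤ) : Fin 3 → ℤ := ![2 * x 0, 2 * x 1 - x 2, 2 * x 2 - x 1]

section G3

variable {k : Type*} [Field k]

/-- The dual basis for the norm form, up to scalars. -/
def octDual : OctIndex → OctIndex
  | .inl i => .inl i
  | .inr (.inl i) => .inr (.inr i)
  | .inr (.inr i) => .inr (.inl i)

theorem octForm_octDual (h2 : (2 : k) ≠ 0) (j : OctIndex) : octForm k (octDual j) j ≠ 0 := by
  rcases j with j | j | j <;> simp [octForm, octDual, h2]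

theorem octForm_eq_zero {i j : OctIndex} (h : i ≠ octDual j) : octForm k i j = 0 := by
  rcases i with i | i | i <;> rcases j with j | j | j <;> simp [octForm, octDual] at h ⊢ <;>
    first | exact h | exact (h (Subsingleton.elim _ _)).elim

/-- For `i ≠ j` the commutator of `u_i` and `v_j` is 0, so only the terms with the norm form remain,
and the derivation sends `u_j` to `-6 u_i`. -/
theorem octD_long_ne_zero (h2 : (2 : k) ≠ 0) (h3 : (3 : k) ≠ 0) {i j : Fin 3} (hij : i ≠ j) :
    octD (Pi.single (.inr (.inl i)) (1 : k)) (Pi.single (.inr (.inr j)) 1) ≠ 0 := by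
  intro h
  have h6 : (6 : k) ≠ 0 := by
    have : (6 : k) = 2 * 3 := by norm_num
    rw [this]
    exact mul_ne_zero h2 h3
  have e := congrFun (congrArg (· *ᵥ Pi.single (.inr (.inl j)) (1 : k)) h) (.inr (.inl i))
  simp only [octD_mulVec, octForm_apply, Matrix.zero_mulVec] at e
  revert hij
  fin_cases i <;> fin_cases j <;> intro hij <;> first | exact hij rfl |
    simp [octComm_zero, octComm_u0, octComm_u1, octComm_u2, octComm_v0, octComm_v1, octComm_v2,
      Pi.single_apply, h6] at e

/-- By the identity for `D(x, y) x`, the derivation sends the diagonal basis vector to 8 times the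
other one. -/
theorem octD_short_ne_zero (h2 : (2 : k) ≠ 0) (j : Fin 3 ⊕ Fin 3) :
    octD (Pi.single (.inl 0) (1 : k)) (Pi.single (.inr j) 1) ≠ 0 := by
  intro h
  have e := congrFun (congrArg (· *ᵥ Pi.single (.inl 0) (1 : k)) h) (.inr j)
  rw [octD_apply_self, Matrix.zero_mulVec] at e
  have h4 : (4 : k) ≠ 0 := by
    have : (4 : k) = 2 * 2 := by norm_num
    rw [this]
    exact mul_ne_zero h2 h2
  simp [octForm, h2, h4] at e

/-- Skewness kills the entries between basis vectors of opposite weights, so the doubled short roots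
do not occur; the other nonzero weight differences are roots. Conversely, the short roots come from
`D` on the diagonal vector and another basis vector, and the long roots ε_i - ε_j from `D(u_i,
v_j)`. -/
theorem mem_g3_rootsL [Infinite k] (h2 : (2 : k) ≠ 0) (h3 : (3 : k) ≠ 0) (lam : Fin 3 → ℤ) :
    lam ∈ (g3Data k).rootsL ↔ lam ∈ g3RootsL := by
  constructor
  · rintro ⟨h0, x, hx, hne, h⟩
    obtain ⟨i, j, hij⟩ := exists_entry_ne_zero hne
    have hl : octWt i - octWt j = lam := h i j hij
    have h1 : i ≠ octDual j := by
      rintro rfl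
      exact hij (entry_eq_zero_of_skew h2 octForm_symm hx.1 (octForm_octDual h2 j)
        fun a ha => octForm_eq_zero ha)
    have key : ∀ i j : OctIndex, i ≠ octDual j → octWt i - octWt j ≠ 0 →
        octWt i - octWt j ∈ g3RootsL := by decide +kernel
    rw [← hl] at h0 ⊢
    exact key i j h1 h0
  · intro hlam
    have h0 : lam ≠ 0 := by
      rintro rfl
      revert hlam
      decide +kernel
    have key : ∀ lam ∈ g3RootsL, (∃ j, octWt (.inl 0) + octWt (.inr j) = lam) ∨
        ∃ i j : Fin 3, i ≠ j ∧ octWt (.inr (.inl i)) + octWt (.inr (.inr j)) = lam := by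
      decide +kernel
    obtain ⟨j, hl⟩ | ⟨i, j, hij, hl⟩ := key lam hlam
    · exact (g3Data k).mem_rootsL_of_D_ne_zero (i := .inl 0) (j := .inr j) h0 hl
        (octD_short_ne_zero h2 j)
    · exact (g3Data k).mem_rootsL_of_D_ne_zero (i := .inr (.inl i)) (j := .inr (.inr j)) h0 hl
        (octD_long_ne_zero h2 h3 hij)

theorem g3_isReflective [Infinite k] (h2 : (2 : k) ≠ 0) (h3 : (3 : k) ≠ 0) : (g3 k).IsReflective :=
  tripleSuper_isReflective (d := g3Data k) (nu := ![1, 0, 0]) (L := g3RootsL) (O := g3RootsOdd)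
    (by decide) (mem_g3_rootsL h2 h3) (w := octWt) rfl (by decide +kernel) (by decide +kernel)
    (E := g3RootsEven) (by decide +kernel) g3Pairing
    -- This is the coroot of `x` for the positive definite form of `g3Pairing`; the division is
    -- exact at the non-isotropic roots.
    (fun x i => 2 * g3Pairing x i / (g3Pairing x ⬝ᵥ x)) id (fun _ => 1)
    (by decide +kernel) (by decide +kernel) (by decide +kernel) (by decide +kernel)
    (by decide +kernel) (by decide +kernel) (by decide +kernel)

end G3

/-! ### `F(4)` -/

/-- The roots of `𝔰𝔬(7)`, in the coordinates that are twice the usual ones. -/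
def f4RootsL : List (Fin 4 → ℤ) := [![0, 2, 0, 0], ![0, -2, 0, 0], ![0, 0, 2, 0], ![0, 0, -2, 0],
  ![0, 0, 0, 2], ![0, 0, 0, -2], ![0, 2, 2, 0], ![0, 2, -2, 0], ![0, -2, 2, 0], ![0, -2, -2, 0],
  ![0, 2, 0, 2], ![0, 2, 0, -2], ![0, -2, 0, 2], ![0, -2, 0, -2], ![0, 0, 2, 2], ![0, 0, 2, -2],
  ![0, 0, -2, 2], ![0, 0, -2, -2]]

/-- The even roots of `F(4)`. -/
def f4RootsEven : List (Fin 4 → ℤ) := ![2, 0, 0, 0] :: ![-2, 0, 0, 0] :: f4RootsL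

/-- The odd roots of `F(4)`. -/
def f4RootsOdd : List (Fin 4 → ℤ) := [![1, 1, 1, 1], ![1, 1, 1, -1], ![1, 1, -1, 1], ![1, 1, -1, -1],
  ![1, -1, 1, 1], ![1, -1, 1, -1], ![1, -1, -1, 1], ![1, -1, -1, -1], ![-1, 1, 1, 1],
  ![-1, 1, 1, -1], ![-1, 1, -1, 1], ![-1, 1, -1, -1], ![-1, -1, 1, 1], ![-1, -1, 1, -1],
  ![-1, -1, -1, 1], ![-1, -1, -1, -1]]

/-- `2` for the roots `±2 e_i ± 2 e_j`, and `1` for the other roots. -/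
def f4Divisor (x : Fin 4 → ℤ) : ℤ := if x ⬝ᵥ x = 8 then 2 else 1

section F4

variable {k : Type*} [Field k]

/-- Over the integers the commutator has an entry with square 4, which stays nonzero in `k`. -/
theorem spinE_ne_zero (h2 : (2 : k) ≠ 0) {a b : Fin 7} (hab : gammaWt a + gammaWt b ≠ 0)
    (hne : a ≠ b) : spinE k a b ≠ 0 := by
  intro h
  have key : ∀ a b : Fin 7, gammaWt a + gammaWt b = 0 ∨ a = b ∨ ∃ i j,
      (spinGamma ℤ a * spinGamma ℤ b - spinGamma ℤ b * spinGamma ℤ a) i j *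
        (spinGamma ℤ a * spinGamma ℤ b - spinGamma ℤ b * spinGamma ℤ a) i j = 2 * 2 := by
    decide +kernel
  have e : spinE k a b = (spinGamma ℤ a * spinGamma ℤ b - spinGamma ℤ b * spinGamma ℤ a).map
      (Int.castRingHom k) := by
    rw [spinE, ← spinGamma_map, ← spinGamma_map, Matrix.map_sub _ (map_sub _), Matrix.map_mul,
      Matrix.map_mul]
  obtain ⟨i, j, hij⟩ := ((key a b).resolve_left hab).resolve_left hne
  have h1 := congrFun (congrFun h i) j
  rw [e, Matrix.map_apply] at h1
  have h4 := congrArg (Int.castRingHom k) hij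
  rw [map_mul, h1, Matrix.zero_apply, mul_zero, map_mul, map_ofNat] at h4
  exact mul_ne_zero h2 h2 h4.symm

/-- The dual basis for the invariant form, up to sign. -/
def spinOpp (i : SpinIndex) : SpinIndex := (i.1 + 1, i.2.1 + 1, i.2.2 + 1)

theorem spinForm_spinOpp (j : SpinIndex) : spinForm k (spinOpp j) j ≠ 0 := by
  have key : ∀ j, spinForm ℤ (spinOpp j) j = 1 ∨ spinForm ℤ (spinOpp j) j = -1 := by decide +kernel
  rw [← spinForm_map, Matrix.map_apply]
  rcases key j with h | h <;> simp [h]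

theorem spinForm_eq_zero {i j : SpinIndex} (h : i ≠ spinOpp j) : spinForm k i j = 0 := by
  have key : ∀ i j, i ≠ spinOpp j → spinWt i + spinWt j ≠ 0 := by decide +kernel
  exact by_contra fun hn => key i j h (spinForm_weight i j hn)

/-- Skewness kills the entries at which all three signs of the weight change; changing one or two
signs gives the roots of `𝔰𝔬(7)`. Conversely, the bivector `spinE k a b` has weight `gammaWt a +
gammaWt b`. -/
theorem mem_f4_rootsL [Infinite k] (h2 : (2 : k) ≠ 0) (lam : Fin 4 → ℤ) :
    lam ∈ (f4Data k).rootsL ↔ lam ∈ f4RootsL := by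
  constructor
  · rintro ⟨h0, x, hx, hne, h⟩
    obtain ⟨i, j, hij⟩ := exists_entry_ne_zero hne
    have hl : spinWt i - spinWt j = lam := h i j hij
    have h1 : i ≠ spinOpp j := by
      rintro rfl
      exact hij (entry_eq_zero_of_skew h2 spin_symm hx.1 (spinForm_spinOpp j)
        fun a ha => spinForm_eq_zero ha)
    have key : ∀ i j : SpinIndex, i ≠ spinOpp j → spinWt i - spinWt j ≠ 0 →
        spinWt i - spinWt j ∈ f4RootsL := by decide +kernel
    rw [← hl] at h0 ⊢
    exact key i j h1 h0
  · intro hlam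
    have h0 : lam ≠ 0 := by
      rintro rfl
      revert hlam
      decide +kernel
    have key : ∀ lam ∈ f4RootsL, ∃ a b, a ≠ b ∧ gammaWt a + gammaWt b = lam := by
      decide +kernel
    obtain ⟨a, b, hab, rfl⟩ := key lam hlam
    refine rootsL_of_conj (f4Data k) h0 (spinE_mem a b) (spinE_ne_zero h2 h0 hab) fun t => ?_
    change torusMat spinWt t * spinE k a b * torusMat spinWt t⁻¹ = _
    rw [torus_spinE, Matrix.smul_mul, Matrix.mul_assoc, torusMat_mul_inv, Matrix.mul_one,
      torusChar_add, Units.val_mul]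

theorem f4_isReflective [Infinite k] (h2 : (2 : k) ≠ 0) : (f4 k).IsReflective :=
  tripleSuper_isReflective (d := f4Data k) (nu := ![1, 0, 0, 0]) (L := f4RootsL) (O := f4RootsOdd)
    (by decide) (mem_f4_rootsL h2) (w := spinWt) rfl (by decide +kernel) (by decide +kernel)
    -- For `x = ±2e_i ± 2e_j` the coroot `x / 4` is not integral. The reflection is therefore
    -- written with `x / 2` both as coefficient vector and as direction, and `f4Divisor x = 2`
    -- relates the direction to `x`.
    (E := f4RootsEven) (by decide +kernel) id (fun x i => x i / 2) (fun x i => x i / f4Divisor x)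
    f4Divisor (by decide +kernel) (by decide +kernel) (by decide +kernel) (by decide +kernel)
    (by decide +kernel) (by decide +kernel) (by decide +kernel)

end F4

end SuperLie

/-! ### The theorem, type by type. -/

open SuperLie SuperLie.ToralLieSuperalgebra in
theorem mainTheorem4 {k : Type*} [Field k] [IsAlgClosed k] (p : ℕ) [CharP k p]
    (A : ToralLieSuperalgebra k) (hA : IsBasicClassical p A) (B : A.Borel) :
    ∃ (w₀ : Equiv.Perm A.Borel) (N : ℕ) (θ : ℕ → A.I → ℤ) (r : ℕ → Equiv.Perm A.Borel),
      w₀ ∈ A.superWeylGroup ∧ IsDistinguished B w₀ ∧ w₀ = partialProd r N ∧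
      IsStandardReduced B ((fun α => -α) '' simpleRoots B) N θ r ∧
      (∀ i < N, A.IsSuperReflection (θ i) (r i) ∧ θ i ∈ posRoots B) ∧
      (∀ i < N, θ i ∈ simpleRoots (partialProd r i B)) ∧
      (simpleRoots (w₀ B) = (fun α => -α) '' simpleRoots B ∧
        posRoots (w₀ B) = (fun α => -α) '' posRoots B) ∧
      (∀ i < N,
        (θ i ∈ posRoots (partialProd r i B) ∩ A.evenRootsBar →
          posRoots (partialProd r (i + 1) B) =
            posRoots (partialProd r i B) \ {θ i} ∪ {-θ i}) ∧
        (θ i ∈ posRoots (partialProd r i B) ∩ A.oddRootsBar →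
          posRoots (partialProd r (i + 1) B) =
            posRoots (partialProd r i B) \ {θ i} ∪ {-θ i}) ∧
        (θ i ∈ posRoots (partialProd r i B) ∩ (A.oddRoots \ A.oddRootsBar) →
          posRoots (partialProd r (i + 1) B) =
            posRoots (partialProd r i B) \ {2 • θ i, θ i} ∪ {-(2 • θ i), -θ i})) ∧
      N + (posRoots B ∩ (A.oddRoots \ A.oddRootsBar)).ncard = (posRoots B).ncard ∧
      posRoots B = {α | ∃ i < N, α = θ i} ∪
        {α | ∃ i < N, θ i ∈ posRoots B ∩ posRoots (partialProd r i B) ∩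
          (A.oddRoots \ A.oddRootsBar) ∧ α = 2 • θ i} := by
  have hp (h : 2 < p) : (2 : k) ≠ 0 := fun h0 => by
    have := Nat.le_of_dvd two_pos ((CharP.cast_eq_zero_iff k p 2).1 (by exact_mod_cast h0))
    omega
  refine IsReflective.exists_longest ?_ B
  -- What is left concerns the root system alone; `B` depends on `A`, which the case distinction
  -- makes explicit.
  clear B
  cases hA with
  | gl m n => exact gl_isReflective m n
  | sl m n => exact sl_isReflective m n
  | osp l e n h he => exact osp_isReflective (hp h) he
  | d21 a => exact d21_isReflective a
  | f4 h => exact f4_isReflective (hp (by omega))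
  | g3 h =>
    refine g3_isReflective (hp (by omega)) fun h0 => ?_
    have := Nat.le_of_dvd three_pos ((CharP.cast_eq_zero_iff k p 3).1 (by exact_mod_cast h0))
    omega
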